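/- **Setting.** Let $|GHZ\rangle=(|000\rangle+|111\rangle)/\sqrt2$. For $g=(g_1,g_2,g_3)$ with $g_i\in[0,1/2)$ and $z\in\mathbb C$ with $0<|z|\le 1$, let $\Psi(g,z)$ be the normalization of $(G_1\otimes G_2\otimes G_3)(\mathrm{diag}(z,1/z)\otimes 1\otimes 1)|GHZ\rangle$, where $G_i=(\tfrac12 1+g_i\sigma_x)^{1/2}$; up to local unitaries (LU) these are the states of the GHZ class. Write $\psi\to\varphi$ if some LOCC protocol with finitely many rounds transforms $\psi$ into $\varphi$ deterministically. The maximally entangled set (MES) consists of the three-qubit states that cannot be reached from any LU-inequivalent three-qubit state. The state $\Psi(g,z)$ is called *generic* if $g_1,g_2,g_3\neq0$ and it is not in the MES. For a three-qubit state $\psi$ with one-qubit reduced states $\rho_i$ let $C_i(\psi)=2(1-\mathrm{tr}\,\rho_i^2)$ and $E(\psi)=C_1(\psi)+C_2(\psi)+C_3(\psi)$. Let $V_a(\psi)$, respectively $V_s(\psi)$, be the Lebesgue measure of the set of all $h\in[0,1/2)^3$ for which there is a $z'$ with $0<|z'|\le1$ and $\psi\to\Psi(h,z')$, respectively $\Psi(h,z')\to\psi$.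 Put $E_a=V_a/V_a^{\sup}$ and $E_s=1-V_s/V_s^{\sup}$, with suprema over the generic states. Let $f_z=2|\mathrm{Re}(z^2)|/(1+|z|^4)$ and, if $\mathrm{Re}(z^2)\ne0$, let $\Phi_{\Psi(g,z)}=\Psi\big((g_1,g_2,f_zg_3),\zeta\big)$ with $\zeta=1$ if $\mathrm{Re}(z^2)>0$ and $\zeta=i$ if $\mathrm{Re}(z^2)<0$. **Lemma.** Let $\Psi=\Psi(g,z)$ be generic, and call a generic state *compatible* with $\Psi$ if it has the same five values $C_1,C_2,C_3,E_s,E_a$. Then one of the following holds. (i) Every generic state compatible with $\Psi$ is equal to $\Psi$ up to LU and complex conjugation. (ii) There are two compatible generic states $\Psi_1=\Psi(g,z_1)$ and $\Psi_2=\Psi(g,z_2)$, with $z_1=z$ or $z_2=z$, with $\mathrm{Re}(z_1^2)>0>\mathrm{Re}(z_2^2)$ and $f_{z_1}=f_{z_2}$, which are not equal up to LU and complex conjugation, and every generic state compatible with $\Psi$ equals $\Psi_1$ or $\Psi_2$ up to LU and complex conjugation. The states $\Phi_{\Psi_1}$ and $\Phi_{\Psi_2}$ are in the MES, $\Phi_{\Psi_1}\to\Psi_1$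 and $\Phi_{\Psi_2}\to\Psi_2$, and $E(\Phi_{\Psi_1})<E(\Phi_{\Psi_2})$. Define the bit $b(\Psi')$ of a generic state $\Psi'$ compatible with $\Psi$ to be $1$ if $E(\Phi_{\Psi'})=\max\{E(\Phi_{\Psi_1}),E(\Phi_{\Psi_2})\}$ and $0$ otherwise. Then every generic state $\Psi'$ compatible with $\Psi$ with $b(\Psi')=b(\Psi)$ is equal to $\Psi$ up to LU and complex conjugation. -/

import Mathlib

open MeasureTheory
open scoped Matrix

noncomputable section

namespace ThreeQubit

/-- (Not necessarily normalized) vectors of `ℂ^a ⊗ ℂ^b ⊗ ℂ^c`, by coordinates in the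
computational basis. -/
abbrev Ket (a b c : ℕ) : Type := Fin a → Fin b → Fin c → ℂ

/-- Squared Euclidean norm. -/
def normSq {a b c : ℕ} (ψ : Ket a b c) : ℝ := ∑ i, ∑ j, ∑ k, ‖ψ i j k‖ ^ 2

/-- `A ⊗ 1 ⊗ 1`. -/
def applyA {a a' b c : ℕ} (A : Matrix (Fin a') (Fin a) ℂ) (ψ : Ket a b c) : Ket a' b c :=
  fun i j k => ∑ x, A i x * ψ x j k

/-- `1 ⊗ B ⊗ 1`. -/
def applyB {a b b' c : ℕ} (B : Matrix (Fin b') (Fin b) ℂ) (ψ : Ket a b c) : Ket a b' c :=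
  fun i j k => ∑ y, B j y * ψ i y k

/-- `1 ⊗ 1 ⊗ C`. -/
def applyC {a b c c' : ℕ} (C : Matrix (Fin c') (Fin c) ℂ) (ψ : Ket a b c) : Ket a b c' :=
  fun i j k => ∑ w, C k w * ψ i j w

/-- `A ⊗ B ⊗ C`. -/
def applyABC {a a' b b' c c' : ℕ} (A : Matrix (Fin a') (Fin a) ℂ) (B : Matrix (Fin b') (Fin b) ℂ)
    (C : Matrix (Fin c') (Fin c) ℂ) (ψ : Ket a b c) : Ket a' b' c' :=
  applyA A (applyB B (applyC C ψ))

/-- `LOCC φ ψ`: there is a (finite) LOCC protocol which transforms `ψ` into `φ` deterministically.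
A protocol either ends, the current vector being `φ` up to a nonzero scalar (probability amplitude
and global phase), or one party performs a local measurement with Kraus operators `K i`
(of arbitrary output dimension) and announces the outcome `i`; the protocol is then continued
in a way that may depend on `i`, for every outcome of nonzero probability. -/
inductive LOCC {a₀ b₀ c₀ : ℕ} (φ : Ket a₀ b₀ c₀) : ∀ {a b c : ℕ}, Ket a b c → Prop
  | finish (ψ : Ket a₀ b₀ c₀) (s : ℂ) (hs : s ≠ 0) (h : ψ = s • φ) : LOCC φ ψ
  | alice {a b c : ℕ} (ψ : Ket a b c) (n m : ℕ) (K : Fin n → Matrix (Fin m) (Fin a) ℂ)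
      (hK : ∑ i, (K i)ᴴ * K i = 1)
      (h : ∀ i, applyA (K i) ψ ≠ 0 → LOCC φ (applyA (K i) ψ)) : LOCC φ ψ
  | bob {a b c : ℕ} (ψ : Ket a b c) (n m : ℕ) (K : Fin n → Matrix (Fin m) (Fin b) ℂ)
      (hK : ∑ i, (K i)ᴴ * K i = 1)
      (h : ∀ i, applyB (K i) ψ ≠ 0 → LOCC φ (applyB (K i) ψ)) : LOCC φ ψ
  | charlie {a b c : ℕ} (ψ : Ket a b c) (n m : ℕ) (K : Fin n → Matrix (Fin m) (Fin c) ℂ)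
      (hK : ∑ i, (K i)ᴴ * K i = 1)
      (h : ∀ i, applyC (K i) ψ ≠ 0 → LOCC φ (applyC (K i) ψ)) : LOCC φ ψ

/-- `ψ` can reach `φ` by LOCC. -/
def Reaches (ψ φ : Ket 2 2 2) : Prop := LOCC φ ψ

/-- Local-unitary equivalence. -/
def LUEquiv (ψ φ : Ket 2 2 2) : Prop :=
  ∃ U ∈ Matrix.unitaryGroup (Fin 2) ℂ, ∃ V ∈ Matrix.unitaryGroup (Fin 2) ℂ,
    ∃ W ∈ Matrix.unitaryGroup (Fin 2) ℂ, φ = applyABC U V W ψ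

/-- Complex conjugation in the computational basis. -/
def conjKet (ψ : Ket 2 2 2) : Ket 2 2 2 := fun i j k => star (ψ i j k)

/-- Equality up to local unitaries and complex conjugation. -/
def LUConjEquiv (ψ φ : Ket 2 2 2) : Prop := LUEquiv ψ φ ∨ LUEquiv (conjKet ψ) φ

/-- The maximally entangled set of three qubits: the states that cannot be reached from
any LU-inequivalent three-qubit state. -/
def InMES (ψ : Ket 2 2 2) : Prop :=
  normSq ψ = 1 ∧ ∀ χ : Ket 2 2 2, normSq χ = 1 → Reaches χ ψ → LUEquiv χ ψ

/-- `|GHZ⟩ = (|000⟩ + |111⟩) / √2`. -/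
def ghz : Ket 2 2 2 :=
  fun i j k => if i = j ∧ j = k then (((√2)⁻¹ : ℝ) : ℂ) else 0

/-- The Pauli operator `σ_x`. -/
def sigmaX : Matrix (Fin 2) (Fin 2) ℂ := !![0, 1; 1, 0]

/-- The positive square root of `1/2 + t σ_x`. -/
def gx (t : ℝ) : Matrix (Fin 2) (Fin 2) ℂ :=
  !![(((√(1 / 2 + t) + √(1 / 2 - t)) / 2 : ℝ) : ℂ), (((√(1 / 2 + t) - √(1 / 2 - t)) / 2 : ℝ) : ℂ);
     (((√(1 / 2 + t) - √(1 / 2 - t)) / 2 : ℝ) : ℂ), (((√(1 / 2 + t) + √(1 / 2 - t)) / 2 : ℝ) : ℂ)]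

theorem gx_conjTranspose_mul_self (t : ℝ) (h₁ : -(1 / 2) ≤ t) (h₂ : t ≤ 1 / 2) :
    (gx t)ᴴ * gx t = ((1 / 2 : ℝ) : ℂ) • (1 : Matrix (Fin 2) (Fin 2) ℂ) + (t : ℂ) • sigmaX := by
  have e₁ : √(1 / 2 + t) * √(1 / 2 + t) = 1 / 2 + t := Real.mul_self_sqrt (by linarith)
  have e₂ : √(1 / 2 - t) * √(1 / 2 - t) = 1 / 2 - t := Real.mul_self_sqrt (by linarith)
  unfold gx
  generalize √(1 / 2 + t) = u at e₁ ⊢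
  generalize √(1 / 2 - t) = v at e₂ ⊢
  have f₁ : (u + v) / 2 * ((u + v) / 2) + (u - v) / 2 * ((u - v) / 2) = 1 / 2 := by
    linear_combination (1 / 2) * e₁ + (1 / 2) * e₂
  have f₂ : (u + v) / 2 * ((u - v) / 2) + (u - v) / 2 * ((u + v) / 2) = t := by
    linear_combination (1 / 2) * e₁ - (1 / 2) * e₂
  generalize (u + v) / 2 = p at f₁ f₂ ⊢
  generalize (u - v) / 2 = q at f₁ f₂ ⊢
  rw [← f₁, ← f₂]
  ext i j
  fin_cases i <;> fin_cases j <;>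
    simp [sigmaX, Matrix.mul_apply, Fin.sum_univ_two, Matrix.conjTranspose_apply,
      Complex.conj_ofReal] <;> ring

/-- `P_z = diag(z, 1/z)`. -/
def Pz (z : ℂ) : Matrix (Fin 2) (Fin 2) ℂ := Matrix.diagonal ![z, z⁻¹]

/-- The unnormalized vector `g_x^1 ⊗ g_x^2 ⊗ g_x^3 P_z |GHZ⟩`. -/
def ghzVector (g : Fin 3 → ℝ) (z : ℂ) : Ket 2 2 2 :=
  applyABC (gx (g 0)) (gx (g 1)) (gx (g 2)) (applyA (Pz z) ghz)

/-- The normalized state `|Ψ(g, z)⟩`. -/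
def Ψ (g : Fin 3 → ℝ) (z : ℂ) : Ket 2 2 2 :=
  (((√(normSq (ghzVector g z)))⁻¹ : ℝ) : ℂ) • ghzVector g z

/-- The parameter range `g_i ∈ [0, 1/2)`, `0 < |z| ≤ 1` of the GHZ class. -/
def IsParam (g : Fin 3 → ℝ) (z : ℂ) : Prop :=
  (∀ i, 0 ≤ g i ∧ g i < 1 / 2) ∧ z ≠ 0 ∧ ‖z‖ ≤ 1

/-- Generic parameters: no `g_i` vanishes and the state is not in the MES. -/
def Generic (g : Fin 3 → ℝ) (z : ℂ) : Prop :=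
  IsParam g z ∧ (∀ i, g i ≠ 0) ∧ ¬ InMES (Ψ g z)

/-- The single-qubit reduced states `ρ_1, ρ_2, ρ_3` of a three-qubit vector. -/
def reduced (ψ : Ket 2 2 2) : Fin 3 → Matrix (Fin 2) (Fin 2) ℂ :=
  ![Matrix.of fun x y => ∑ j, ∑ k, ψ x j k * star (ψ y j k),
    Matrix.of fun x y => ∑ i, ∑ k, ψ i x k * star (ψ i y k),
    Matrix.of fun x y => ∑ i, ∑ j, ψ i j x * star (ψ i j y)]

/-- Squared concurrence `C_i = 2 (1 - tr ρ_i²)` between qubit `i` and the other two. -/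
def sqConcurrence (i : Fin 3) (ψ : Ket 2 2 2) : ℝ :=
  2 * (1 - (Matrix.trace (reduced ψ i * reduced ψ i)).re)

/-- `E = C_1 + C_2 + C_3`. -/
def sumConcurrence (ψ : Ket 2 2 2) : ℝ := ∑ i, sqConcurrence i ψ

/-- Parameters of the states in the GHZ class that are accessible from `ψ`. -/
def accessibleSet (ψ : Ket 2 2 2) : Set ((Fin 3 → ℝ) × ℂ) :=
  {p | IsParam p.1 p.2 ∧ Reaches ψ (Ψ p.1 p.2)}

/-- Parameters of the states in the GHZ class that can reach `ψ`. -/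
def sourceSet (ψ : Ket 2 2 2) : Set ((Fin 3 → ℝ) × ℂ) :=
  {p | IsParam p.1 p.2 ∧ Reaches (Ψ p.1 p.2) ψ}

/-- Three-dimensional accessible volume (the one used for generic states): the Lebesgue measure in
the coordinates `h = (h_1, h_2, h_3)`. -/
def accessibleVolume (ψ : Ket 2 2 2) : ℝ :=
  (volume (Prod.fst '' accessibleSet ψ)).toReal

/-- Three-dimensional source volume (the one used for generic states). -/
def sourceVolume (ψ : Ket 2 2 2) : ℝ :=
  (volume (Prod.fst '' sourceSet ψ)).toReal

/-- Supremum of the accessible volume over generic states. -/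
def accessibleVolumeSup : ℝ :=
  sSup {v | ∃ g z, Generic g z ∧ v = accessibleVolume (Ψ g z)}

/-- Supremum of the source volume over generic states. -/
def sourceVolumeSup : ℝ :=
  sSup {v | ∃ g z, Generic g z ∧ v = sourceVolume (Ψ g z)}

/-- Accessible entanglement `E_a = V_a / V_a^sup` (of a generic state). -/
def accessibleEntanglement (ψ : Ket 2 2 2) : ℝ := accessibleVolume ψ / accessibleVolumeSup

/-- Source entanglement `E_s = 1 - V_s / V_s^sup` (of a generic state). -/
def sourceEntanglement (ψ : Ket 2 2 2) : ℝ := 1 - sourceVolume ψ / sourceVolumeSup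

/-- The five measures `C_1, C_2, C_3, E_s, E_a` agree on `ψ` and `φ`. -/
def SameMeasures (ψ φ : Ket 2 2 2) : Prop :=
  (∀ i, sqConcurrence i ψ = sqConcurrence i φ) ∧
    sourceEntanglement ψ = sourceEntanglement φ ∧
    accessibleEntanglement ψ = accessibleEntanglement φ

/-- `f_z = 2 |Re z²| / (1 + |z|⁴)`. -/
def fz (z : ℂ) : ℝ := 2 * |(z ^ 2).re| / (1 + ‖z‖ ^ 4)

/-- The state `Φ_Ψ` attached to `Ψ(g, z)` with `Re z² ≠ 0`: it has parameters
`h = (g_1, g_2, f_z g_3)`, and `1` or `i` in place of `z`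
according as `Re z² > 0` or `Re z² < 0`. -/
def Φ (g : Fin 3 → ℝ) (z : ℂ) : Ket 2 2 2 :=
  Ψ ![g 0, g 1, fz z * g 2] (if 0 < (z ^ 2).re then 1 else Complex.I)

/-- The bit: `1` if `E(Φ) = max (E(Φ₁), E(Φ₂))`, and `0` otherwise. -/
def bitValue (Φ₁ Φ₂ Φ₀ : Ket 2 2 2) : Fin 2 :=
  if sumConcurrence Φ₀ = max (sumConcurrence Φ₁) (sumConcurrence Φ₂) then 1 else 0

end ThreeQubit

end

/-!
Write `τ = z²`, `c = 8 g₁ g₂ g₃`, `bx z = 2 Re τ / (1 + |τ|²)` (so that `f_z = |bx z|`). The state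
`Ψ(g, z)` is a sum of two product vectors, whose local overlaps are `2 g_i`, and this decomposition
is unique (`prodKet_add_unique`).

*Necessary conditions.* Follow the Gram matrix of the two product vectors through a protocol. Every
measurement preserves it on average, and at the end the two terms are those of the target, possibly
interchanged. Moreover local overlaps can only grow, by Cauchy–Schwarz (`LOCC.gram`). Within the GHZ
class this says that the `g_i` do not decrease and that `g₁ g₂ g₃ bx z` is conserved
(`reaches_necessary`). If `τ = ±1` and all `g_i ≠ 0`, then the conditions leave no room, and the
state is in the MES (`inMES_of_sq`). Hence `f_z < 1` for generic states.

*Protocols.* Conversely, one party can increase its `g_i` by a measurement with two outcomes, on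
one of which the two product terms get interchanged. In terms of the point of the unit sphere with
stereographic coordinate `τ`, the condition for this is elementary (`reaches_of_isBloch`). Three
such steps, one for each party, show that the accessible region of a generic state is the box of all
`h_i ≥ g_i`, and that its source region is, up to a null set, given by `h_i ≤ g_i` and
`h₁ h₂ h₃ ≥ f_z g₁ g₂ g₃`. So `V_a = ∏ (1/2 - g_i)`, and `V_s = g₁ g₂ g₃ F(f_z)` with `F` strictly
decreasing (`accessibleVolume_eq`, `sourceVolume_eq`, `cubeVolume_strictAnti`).

*Reconstruction.* With `s_i = 4 g_i²` one has `C_i = K A_i`, where `A_i = (1 - s_i)(1 - s_j s_k)`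
and `K` does not depend on `i`. The ratio `(A_j + A_k) / A_i` is strictly increasing in `s_i` and
strictly decreasing in `s_j` and `s_k`, so two triples with the same ratios are comparable
(`eq_of_concRatio_eq`); if moreover `V_a` agrees, they are equal. Then `V_s` yields `f_z`, and `K`
yields `|τ|` once the sign of `Re τ` is known. Since `g`, `Re τ` and `|τ|` determine the state up to
local unitaries and conjugation (`LUConjEquiv.of_bx_eq`), that sign is the only ambiguity. It is
visible in `E(Φ)`, in which `K = 1 / (1 ± c f_z)²` (`sumConcurrence_Φ_lt`).
-/

noncomputable section

namespace ThreeQubit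

/-! ### Product vectors and local operators -/

/-- The product vector `x ⊗ y ⊗ w`. -/
def prodKet {a b c : ℕ} (x : Fin a → ℂ) (y : Fin b → ℂ) (w : Fin c → ℂ) : Ket a b c :=
  fun i j k => x i * y j * w k

/-- Cyclic relabelling of the parties: Alice becomes the third party. -/
def rot {a b c : ℕ} (ψ : Ket a b c) : Ket b c a := fun j k i => ψ i j k

section Local

variable {a a' a'' b b' b'' c c' c'' : ℕ}

theorem rot_applyA (A : Matrix (Fin a') (Fin a) ℂ) (ψ : Ket a b c) :
    rot (applyA A ψ) = applyC A (rot ψ) := rfl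

theorem rot_applyB (B : Matrix (Fin b') (Fin b) ℂ) (ψ : Ket a b c) :
    rot (applyB B ψ) = applyA B (rot ψ) := rfl

theorem rot_applyC (C : Matrix (Fin c') (Fin c) ℂ) (ψ : Ket a b c) :
    rot (applyC C ψ) = applyB C (rot ψ) := rfl

theorem rot_smul (s : ℂ) (ψ : Ket a b c) : rot (s • ψ) = s • rot ψ := rfl

theorem rot_eq_zero {ψ : Ket a b c} : rot ψ = 0 ↔ ψ = 0 := by
  constructor
  · intro h
    funext i j k
    exact congrFun (congrFun (congrFun h j) k) i
  · rintro rfl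
    rfl

theorem applyA_prodKet (A : Matrix (Fin a') (Fin a) ℂ) (x : Fin a → ℂ) (y : Fin b → ℂ)
    (w : Fin c → ℂ) : applyA A (prodKet x y w) = prodKet (A *ᵥ x) y w := by
  funext i j k
  simp only [applyA, prodKet, Matrix.mulVec, dotProduct, Finset.sum_mul, mul_assoc]

theorem applyB_prodKet (B : Matrix (Fin b') (Fin b) ℂ) (x : Fin a → ℂ) (y : Fin b → ℂ)
    (w : Fin c → ℂ) : applyB B (prodKet x y w) = prodKet x (B *ᵥ y) w := by
  funext i j k
  simp only [applyB, prodKet, Matrix.mulVec, dotProduct, Finset.sum_mul, Finset.mul_sum]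
  exact Finset.sum_congr rfl fun _ _ => by ring

theorem applyC_prodKet (C : Matrix (Fin c') (Fin c) ℂ) (x : Fin a → ℂ) (y : Fin b → ℂ)
    (w : Fin c → ℂ) : applyC C (prodKet x y w) = prodKet x y (C *ᵥ w) := by
  funext i j k
  simp only [applyC, prodKet, Matrix.mulVec, dotProduct, Finset.mul_sum]
  exact Finset.sum_congr rfl fun _ _ => by ring

theorem applyA_add (A : Matrix (Fin a') (Fin a) ℂ) (ψ φ : Ket a b c) :
    applyA A (ψ + φ) = applyA A ψ + applyA A φ := by
  funext i j k
  simp [applyA, mul_add, Finset.sum_add_distrib]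

theorem applyA_smul (A : Matrix (Fin a') (Fin a) ℂ) (s : ℂ) (ψ : Ket a b c) :
    applyA A (s • ψ) = s • applyA A ψ := by
  funext i j k
  simp only [applyA, Pi.smul_apply, smul_eq_mul, Finset.mul_sum]
  exact Finset.sum_congr rfl fun _ _ => by ring

theorem applyB_add (B : Matrix (Fin b') (Fin b) ℂ) (ψ φ : Ket a b c) :
    applyB B (ψ + φ) = applyB B ψ + applyB B φ := by
  funext i j k
  simp [applyB, mul_add, Finset.sum_add_distrib]

theorem applyB_smul (B : Matrix (Fin b') (Fin b) ℂ) (s : ℂ) (ψ : Ket a b c) :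
    applyB B (s • ψ) = s • applyB B ψ := by
  funext i j k
  simp only [applyB, Pi.smul_apply, smul_eq_mul, Finset.mul_sum]
  exact Finset.sum_congr rfl fun _ _ => by ring

theorem applyC_add (C : Matrix (Fin c') (Fin c) ℂ) (ψ φ : Ket a b c) :
    applyC C (ψ + φ) = applyC C ψ + applyC C φ := by
  funext i j k
  simp [applyC, mul_add, Finset.sum_add_distrib]

theorem applyC_smul (C : Matrix (Fin c') (Fin c) ℂ) (s : ℂ) (ψ : Ket a b c) :
    applyC C (s • ψ) = s • applyC C ψ := by
  funext i j k
  simp only [applyC, Pi.smul_apply, smul_eq_mul, Finset.mul_sum]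
  exact Finset.sum_congr rfl fun _ _ => by ring

theorem applyA_applyA (A : Matrix (Fin a'') (Fin a') ℂ) (A' : Matrix (Fin a') (Fin a) ℂ)
    (ψ : Ket a b c) : applyA A (applyA A' ψ) = applyA (A * A') ψ := by
  funext i j k
  simp only [applyA, Matrix.mul_apply, Finset.sum_mul, Finset.mul_sum]
  rw [Finset.sum_comm]
  exact Finset.sum_congr rfl fun _ _ => Finset.sum_congr rfl fun _ _ => by ring

theorem applyB_applyB (B : Matrix (Fin b'') (Fin b') ℂ) (B' : Matrix (Fin b') (Fin b) ℂ)
    (ψ : Ket a b c) : applyB B (applyB B' ψ) = applyB (B * B') ψ := by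
  have := applyA_applyA B B' (rot ψ)
  simp only [← rot_applyB] at this
  exact congrArg (fun χ => rot (rot χ)) this

theorem applyC_applyC (C : Matrix (Fin c'') (Fin c') ℂ) (C' : Matrix (Fin c') (Fin c) ℂ)
    (ψ : Ket a b c) : applyC C (applyC C' ψ) = applyC (C * C') ψ := by
  have := applyA_applyA C C' (rot (rot ψ))
  simp only [← rot_applyB, ← rot_applyC] at this
  exact congrArg rot this

theorem applyA_applyB (A : Matrix (Fin a') (Fin a) ℂ) (B : Matrix (Fin b') (Fin b) ℂ)
    (ψ : Ket a b c) : applyA A (applyB B ψ) = applyB B (applyA A ψ) := by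
  funext i j k
  simp only [applyA, applyB, Finset.mul_sum]
  rw [Finset.sum_comm]
  exact Finset.sum_congr rfl fun _ _ => Finset.sum_congr rfl fun _ _ => by ring

theorem applyB_applyC (B : Matrix (Fin b') (Fin b) ℂ) (C : Matrix (Fin c') (Fin c) ℂ)
    (ψ : Ket a b c) : applyB B (applyC C ψ) = applyC C (applyB B ψ) := by
  have := applyA_applyB B C (rot ψ)
  simp only [← rot_applyB, ← rot_applyC] at this
  exact congrArg (fun χ => rot (rot χ)) this

theorem applyC_applyA (C : Matrix (Fin c') (Fin c) ℂ) (A : Matrix (Fin a') (Fin a) ℂ)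
    (ψ : Ket a b c) : applyC C (applyA A ψ) = applyA A (applyC C ψ) := by
  have := applyA_applyB C A (rot (rot ψ))
  simp only [← rot_applyA, ← rot_applyB, ← rot_applyC] at this
  exact congrArg rot this

theorem applyA_one (ψ : Ket a b c) : applyA 1 ψ = ψ := by
  funext i j k
  simp [applyA, Matrix.one_apply]

theorem applyB_one (ψ : Ket a b c) : applyB 1 ψ = ψ := by
  funext i j k
  simp [applyB, Matrix.one_apply]

theorem applyC_one (ψ : Ket a b c) : applyC 1 ψ = ψ := by
  funext i j k
  simp [applyC, Matrix.one_apply]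

theorem applyA_zero (A : Matrix (Fin a') (Fin a) ℂ) : applyA A (0 : Ket a b c) = 0 := by
  funext i j k
  simp [applyA]

/-- A complete measurement on a nonzero vector has an outcome of nonzero probability. -/
theorem exists_applyA_ne_zero {n m : ℕ} {K : Fin n → Matrix (Fin m) (Fin a) ℂ}
    (hK : ∑ i, (K i)ᴴ * K i = 1) {ψ : Ket a b c} (hψ : ψ ≠ 0) : ∃ i, applyA (K i) ψ ≠ 0 := by
  by_contra! h
  apply hψ
  have h1 : applyA (∑ i, (K i)ᴴ * K i) ψ = ∑ i, applyA ((K i)ᴴ * K i) ψ := by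
    funext i j k
    simp only [applyA, Matrix.sum_apply, Finset.sum_mul, Finset.sum_apply]
    rw [Finset.sum_comm]
  rw [hK, applyA_one] at h1
  rw [h1]
  exact Finset.sum_eq_zero fun i _ => by rw [← applyA_applyA, h i, applyA_zero]

end Local

/-! ### LOCC protocols -/

section Protocols

variable {a₀ b₀ c₀ a b c : ℕ}

theorem LOCC.rot {φ : Ket a₀ b₀ c₀} {ψ : Ket a b c} (h : LOCC φ ψ) :
    LOCC (rot φ) (rot ψ) := by
  induction h with
  | finish ψ s hs h => exact .finish _ s hs (by rw [h]; rfl)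
  | alice ψ n m K hK _ ih => exact .charlie _ n m K hK fun i hi => ih i (mt rot_eq_zero.2 hi)
  | bob ψ n m K hK _ ih => exact .alice _ n m K hK fun i hi => ih i (mt rot_eq_zero.2 hi)
  | charlie ψ n m K hK _ ih => exact .bob _ n m K hK fun i hi => ih i (mt rot_eq_zero.2 hi)

theorem LOCC.smul {φ : Ket a₀ b₀ c₀} {ψ : Ket a b c} (h : LOCC φ ψ) {s : ℂ} (hs : s ≠ 0) :
    LOCC φ (s • ψ) := by
  induction h with
  | finish ψ t ht h => exact .finish _ (s * t) (mul_ne_zero hs ht) (by rw [h, smul_smul])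
  | alice ψ n m K hK _ ih =>
    refine .alice _ n m K hK fun i hi => ?_
    rw [applyA_smul] at hi ⊢
    exact ih i (right_ne_zero_of_smul hi)
  | bob ψ n m K hK _ ih =>
    refine .bob _ n m K hK fun i hi => ?_
    rw [applyB_smul] at hi ⊢
    exact ih i (right_ne_zero_of_smul hi)
  | charlie ψ n m K hK _ ih =>
    refine .charlie _ n m K hK fun i hi => ?_
    rw [applyC_smul] at hi ⊢
    exact ih i (right_ne_zero_of_smul hi)

theorem LOCC.refl (ψ : Ket a b c) : LOCC ψ ψ := .finish ψ 1 one_ne_zero (one_smul _ _).symm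

theorem LOCC.trans {φ : Ket a₀ b₀ c₀} {χ : Ket a b c} {a' b' c' : ℕ} {ψ : Ket a' b' c'}
    (h₁ : LOCC χ ψ) (h₂ : LOCC φ χ) : LOCC φ ψ := by
  induction h₁ with
  | finish ψ s hs h => exact h ▸ h₂.smul hs
  | alice ψ n m K hK _ ih => exact .alice _ n m K hK fun i hi => ih i hi
  | bob ψ n m K hK _ ih => exact .bob _ n m K hK fun i hi => ih i hi
  | charlie ψ n m K hK _ ih => exact .charlie _ n m K hK fun i hi => ih i hi

theorem LOCC.of_isometryA {φ : Ket a₀ b₀ c₀} {ψ : Ket a b c} {a' : ℕ}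
    {U : Matrix (Fin a') (Fin a) ℂ} (hU : Uᴴ * U = 1) (h : LOCC φ (applyA U ψ)) : LOCC φ ψ :=
  .alice ψ 1 a' (fun _ => U) (by simpa using hU) fun _ _ => h

theorem LOCC.of_isometryB {φ : Ket a₀ b₀ c₀} {ψ : Ket a b c} {b' : ℕ}
    {U : Matrix (Fin b') (Fin b) ℂ} (hU : Uᴴ * U = 1) (h : LOCC φ (applyB U ψ)) : LOCC φ ψ :=
  .bob ψ 1 b' (fun _ => U) (by simpa using hU) fun _ _ => h

theorem LOCC.of_isometryC {φ : Ket a₀ b₀ c₀} {ψ : Ket a b c} {c' : ℕ}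
    {U : Matrix (Fin c') (Fin c) ℂ} (hU : Uᴴ * U = 1) (h : LOCC φ (applyC U ψ)) : LOCC φ ψ :=
  .charlie ψ 1 c' (fun _ => U) (by simpa using hU) fun _ _ => h

theorem LUEquiv.reaches {ψ φ : Ket 2 2 2} (h : LUEquiv ψ φ) : Reaches ψ φ := by
  obtain ⟨U, hU, V, hV, W, hW, rfl⟩ := h
  refine .of_isometryC (Matrix.mem_unitaryGroup_iff'.1 hW) ?_
  refine .of_isometryB (Matrix.mem_unitaryGroup_iff'.1 hV) ?_
  exact .of_isometryA (Matrix.mem_unitaryGroup_iff'.1 hU) (.refl _)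

/-- A vector that reaches `φ` is mapped to `φ` by some product operator, the one of a branch of
the protocol which has nonzero probability. -/
theorem LOCC.exists_applyABC {φ : Ket a₀ b₀ c₀} {ψ : Ket a b c} (h : LOCC φ ψ) (hψ : ψ ≠ 0) :
    ∃ A B C, applyABC A B C ψ = φ := by
  induction h with
  | finish ψ s hs h =>
    refine ⟨s⁻¹ • 1, 1, 1, ?_⟩
    rw [applyABC, applyB_one, applyC_one, h, applyA_smul]
    funext i j k
    simp [applyA, Matrix.one_apply, hs]
  | alice ψ n m K hK _ ih =>
    obtain ⟨i, hi⟩ := exists_applyA_ne_zero hK hψ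
    obtain ⟨A, B, C, h⟩ := ih i hi hi
    refine ⟨A * K i, B, C, ?_⟩
    rw [← h, applyABC, applyABC, applyC_applyA, ← applyA_applyB, applyA_applyA]
  | bob ψ n m K hK _ ih =>
    obtain ⟨i, hi⟩ := exists_applyA_ne_zero hK (mt rot_eq_zero.1 hψ)
    have hi' : applyB (K i) ψ ≠ 0 := mt rot_eq_zero.2 hi
    obtain ⟨A, B, C, h⟩ := ih i hi' hi'
    refine ⟨A, B * K i, C, ?_⟩
    rw [← h, applyABC, applyABC, ← applyB_applyC, applyB_applyB]
  | charlie ψ n m K hK _ ih =>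
    obtain ⟨i, hi⟩ := exists_applyA_ne_zero hK (mt rot_eq_zero.1 (mt rot_eq_zero.1 hψ))
    have hi' : applyC (K i) ψ ≠ 0 := mt rot_eq_zero.2 (mt rot_eq_zero.2 hi)
    obtain ⟨A, B, C, h⟩ := ih i hi' hi'
    refine ⟨A, B, C * K i, ?_⟩
    rw [← h, applyABC, applyABC, applyC_applyC]

end Protocols

/-! ### Uniqueness of the decomposition into two product vectors -/

/-- The determinant of the matrix with columns `u` and `v`. -/
def det2 (u v : Fin 2 → ℂ) : ℂ := u 0 * v 1 - u 1 * v 0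

section Decomposition

variable {x₀ x₁ y₀ y₁ w₀ w₁ X₀ X₁ Y₀ Y₁ W₀ W₁ : Fin 2 → ℂ}

theorem rot_prodKet_add {a b c : ℕ} {x₀ x₁ : Fin a → ℂ} {y₀ y₁ : Fin b → ℂ} {w₀ w₁ : Fin c → ℂ} :
    rot (prodKet x₀ y₀ w₀ + prodKet x₁ y₁ w₁) = prodKet y₀ w₀ x₀ + prodKet y₁ w₁ x₁ := by
  funext j k i
  simp only [rot, prodKet, Pi.add_apply]
  ring

/-- Contract the third factor with the functional `m`. -/
theorem contract_third
    (h : prodKet x₀ y₀ w₀ + prodKet x₁ y₁ w₁ = prodKet X₀ Y₀ W₀ + prodKet X₁ Y₁ W₁)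
    (m : Fin 2 → ℂ) (i j : Fin 2) :
    x₀ i * y₀ j * (m ⬝ᵥ w₀) + x₁ i * y₁ j * (m ⬝ᵥ w₁) =
      X₀ i * Y₀ j * (m ⬝ᵥ W₀) + X₁ i * Y₁ j * (m ⬝ᵥ W₁) := by
  have e0 := congrFun (congrFun (congrFun h i) j) 0
  have e1 := congrFun (congrFun (congrFun h i) j) 1
  simp only [prodKet, Pi.add_apply] at e0 e1
  simp only [dotProduct, Fin.sum_univ_two]
  linear_combination m 0 * e0 + m 1 * e1

/-- Both sides are the determinant of the contraction of the third factor with `m`. -/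
theorem contract_third_det
    (h : prodKet x₀ y₀ w₀ + prodKet x₁ y₁ w₁ = prodKet X₀ Y₀ W₀ + prodKet X₁ Y₁ W₁)
    (m : Fin 2 → ℂ) :
    (m ⬝ᵥ w₀) * (m ⬝ᵥ w₁) * (det2 x₀ x₁ * det2 y₀ y₁) =
      (m ⬝ᵥ W₀) * (m ⬝ᵥ W₁) * (det2 X₀ X₁ * det2 Y₀ Y₁) := by
  have e00 := contract_third h m 0 0
  have e01 := contract_third h m 0 1
  have e10 := contract_third h m 1 0
  have e11 := contract_third h m 1 1
  generalize m ⬝ᵥ w₀ = s at *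
  generalize m ⬝ᵥ w₁ = t at *
  generalize m ⬝ᵥ W₀ = S at *
  generalize m ⬝ᵥ W₁ = T at *
  have e := congrArg₂ (· - ·) (congrArg₂ (· * ·) e00 e11) (congrArg₂ (· * ·) e01 e10)
  simp only [det2]
  linear_combination e

/-- The functional dual to `W₀` with respect to the basis `W₀, W₁`. -/
theorem exists_dual (hW : det2 W₀ W₁ ≠ 0) : ∃ m : Fin 2 → ℂ, m ⬝ᵥ W₀ = 1 ∧ m ⬝ᵥ W₁ = 0 := by
  refine ⟨![W₁ 1 / det2 W₀ W₁, -W₁ 0 / det2 W₀ W₁], ?_, ?_⟩ <;>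
    simp only [dotProduct, Fin.sum_univ_two, Matrix.cons_val_zero, Matrix.cons_val_one] <;>
    field_simp <;> simp only [det2] <;> ring

theorem det2_swap (u v : Fin 2 → ℂ) : det2 v u = -det2 u v := by
  simp only [det2]
  ring

theorem det2_ne_zero_of_eq
    (h : prodKet x₀ y₀ w₀ + prodKet x₁ y₁ w₁ = prodKet X₀ Y₀ W₀ + prodKet X₁ Y₁ W₁)
    (hX : det2 X₀ X₁ ≠ 0) (hY : det2 Y₀ Y₁ ≠ 0) (hW : det2 W₀ W₁ ≠ 0) : det2 x₀ x₁ ≠ 0 := by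
  obtain ⟨m, hm0, hm1⟩ := exists_dual hW
  obtain ⟨m', hm1', hm0'⟩ := exists_dual (W₀ := W₁) (W₁ := W₀) (by rwa [det2_swap, neg_ne_zero])
  have := contract_third_det h (m + m')
  intro h0
  simp [add_dotProduct, hm0, hm1, hm0', hm1', h0, hX, hY] at this

/-- A vector of rank two is the sum of two product vectors in only one way. -/
theorem prodKet_add_unique
    (h : prodKet x₀ y₀ w₀ + prodKet x₁ y₁ w₁ = prodKet X₀ Y₀ W₀ + prodKet X₁ Y₁ W₁)
    (hX : det2 X₀ X₁ ≠ 0) (hY : det2 Y₀ Y₁ ≠ 0) (hW : det2 W₀ W₁ ≠ 0) :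
    (prodKet x₀ y₀ w₀ = prodKet X₀ Y₀ W₀ ∧ prodKet x₁ y₁ w₁ = prodKet X₁ Y₁ W₁) ∨
    (prodKet x₀ y₀ w₀ = prodKet X₁ Y₁ W₁ ∧ prodKet x₁ y₁ w₁ = prodKet X₀ Y₀ W₀) := by
  have hx := det2_ne_zero_of_eq h hX hY hW
  have h' : prodKet y₀ w₀ x₀ + prodKet y₁ w₁ x₁ = prodKet Y₀ W₀ X₀ + prodKet Y₁ W₁ X₁ := by
    rw [← rot_prodKet_add, h, rot_prodKet_add]
  have hy := det2_ne_zero_of_eq h' hY hW hX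
  obtain ⟨m, hm0, hm1⟩ := exists_dual hW
  obtain ⟨m', hm1', hm0'⟩ := exists_dual (W₀ := W₁) (W₁ := W₀) (by rwa [det2_swap, neg_ne_zero])
  have hxy : det2 x₀ x₁ * det2 y₀ y₁ ≠ 0 := mul_ne_zero hx hy
  have k := contract_third_det h m
  have k' := contract_third_det h m'
  have ks := contract_third_det h (m + m')
  rw [hm0, hm1, mul_zero, zero_mul, mul_eq_zero, or_iff_left hxy] at k
  rw [hm0', hm1', zero_mul, zero_mul, mul_eq_zero, or_iff_left hxy] at k'
  simp only [add_dotProduct, hm0, hm1, hm0', hm1'] at ks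
  have hs : ¬ (m ⬝ᵥ w₀ + m' ⬝ᵥ w₀ = 0) ∧ ¬ (m ⬝ᵥ w₁ + m' ⬝ᵥ w₁ = 0) := by
    constructor <;> intro h0 <;> rw [h0] at ks <;> simp [hX, hY] at ks
  -- `m` and `m'` determine a vector, so the vanishing contractions give multiples of `W₀`, `W₁`
  have hexp : ∀ w : Fin 2 → ℂ, ∀ k, w k = (m ⬝ᵥ w) * W₀ k + (m' ⬝ᵥ w) * W₁ k := by
    intro w
    simp only [dotProduct, Fin.sum_univ_two] at *
    have d1 : (m 0 * m' 1 - m 1 * m' 0) * det2 W₀ W₁ = 1 := by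
      simp only [det2]
      linear_combination (m' 0 * W₁ 0 + m' 1 * W₁ 1) * hm0 + hm1' -
        (m' 0 * W₀ 0 + m' 1 * W₀ 1) * hm1
    have a1 : (m 0 * m' 1 - m 1 * m' 0) * W₀ 0 = m' 1 := by
      linear_combination m' 1 * hm0 - m 1 * hm0'
    have a2 : (m 0 * m' 1 - m 1 * m' 0) * W₀ 1 = -m' 0 := by
      linear_combination m 0 * hm0' - m' 0 * hm0
    have a3 : (m 0 * m' 1 - m 1 * m' 0) * W₁ 0 = -m 1 := by
      linear_combination m' 1 * hm1 - m 1 * hm1'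
    have a4 : (m 0 * m' 1 - m 1 * m' 0) * W₁ 1 = m 0 := by
      linear_combination m 0 * hm1' - m' 0 * hm1
    have hd : m 0 * m' 1 - m 1 * m' 0 ≠ 0 := left_ne_zero_of_mul_eq_one d1
    intro k
    apply mul_left_cancel₀ hd
    fin_cases k
    · simp only [Fin.zero_eta]
      linear_combination -(m 0 * w 0 + m 1 * w 1) * a1 - (m' 0 * w 0 + m' 1 * w 1) * a3
    · simp only [Fin.mk_one]
      linear_combination -(m 0 * w 0 + m 1 * w 1) * a2 - (m' 0 * w 0 + m' 1 * w 1) * a4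
  rcases mul_eq_zero.1 k with k | k <;> rcases mul_eq_zero.1 k' with k' | k'
  · exact absurd (by rw [k, k', add_zero]) hs.1
  · right
    constructor <;> funext i j l
    · have c := contract_third h m' i j
      rw [k', hm0', hm1'] at c
      simp only [prodKet]
      rw [hexp w₀ l, k]
      linear_combination W₁ l * c
    · have c := contract_third h m i j
      rw [k, hm0, hm1] at c
      simp only [prodKet]
      rw [hexp w₁ l, k']
      linear_combination W₀ l * c
  · left
    constructor <;> funext i j l
    · have c := contract_third h m i j
      rw [k, hm0, hm1] at c
      simp only [prodKet]
      rw [hexp w₀ l, k']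
      linear_combination W₀ l * c
    · have c := contract_third h m' i j
      rw [k', hm0', hm1'] at c
      simp only [prodKet]
      rw [hexp w₁ l, k]
      linear_combination W₁ l * c
  · exact absurd (by rw [k, k', add_zero]) hs.2

end Decomposition

/-! ### Gram data of two product vectors under LOCC -/

/-- The squared Euclidean norm of a vector. -/
def nsq {a : ℕ} (x : Fin a → ℂ) : ℝ := ∑ i, ‖x i‖ ^ 2

/-- The Hermitian inner product, conjugate-linear in the first argument. -/
def ip {a : ℕ} (x y : Fin a → ℂ) : ℂ := star x ⬝ᵥ y

theorem nsq_nonneg {a : ℕ} (x : Fin a → ℂ) : 0 ≤ nsq x := Finset.sum_nonneg fun _ _ => by positivity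

theorem ip_self {a : ℕ} (x : Fin a → ℂ) : ip x x = nsq x := by
  simp only [ip, nsq, dotProduct, Pi.star_apply, Complex.ofReal_sum]
  refine Finset.sum_congr rfl fun i _ => ?_
  rw [Complex.star_def, Complex.conj_mul']
  norm_cast

theorem ip_smul {a : ℕ} (s t : ℂ) (x y : Fin a → ℂ) :
    ip (s • x) (t • y) = star s * t * ip x y := by
  simp only [ip, star_smul, smul_dotProduct, dotProduct_smul, smul_eq_mul]
  ring

theorem nsq_smul {a : ℕ} (s : ℂ) (x : Fin a → ℂ) : nsq (s • x) = ‖s‖ ^ 2 * nsq x := by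
  simp only [nsq, Pi.smul_apply, smul_eq_mul, norm_mul, mul_pow, Finset.mul_sum]

theorem ip_swap {a : ℕ} (x y : Fin a → ℂ) : ip y x = star (ip x y) := by
  simp only [ip, dotProduct, Pi.star_apply, star_sum, star_mul', star_star]
  exact Finset.sum_congr rfl fun _ _ => mul_comm _ _

/-- A complete measurement preserves inner products on average. -/
theorem sum_ip_mulVec {a n m : ℕ} {K : Fin n → Matrix (Fin m) (Fin a) ℂ}
    (hK : ∑ i, (K i)ᴴ * K i = 1) (x y : Fin a → ℂ) : ∑ i, ip (K i *ᵥ x) (K i *ᵥ y) = ip x y := by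
  have : ∀ i, ip (K i *ᵥ x) (K i *ᵥ y) = star x ⬝ᵥ (((K i)ᴴ * K i) *ᵥ y) := fun i => by
    rw [ip, Matrix.star_mulVec, ← Matrix.dotProduct_mulVec, Matrix.mulVec_mulVec]
  simp only [this]
  rw [← dotProduct_sum, ← Matrix.sum_mulVec, hK, Matrix.one_mulVec, ip]

theorem sum_nsq_mulVec {a n m : ℕ} {K : Fin n → Matrix (Fin m) (Fin a) ℂ}
    (hK : ∑ i, (K i)ᴴ * K i = 1) (x : Fin a → ℂ) : ∑ i, nsq (K i *ᵥ x) = nsq x := by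
  have := sum_ip_mulVec hK x x
  simp only [ip_self] at this
  exact_mod_cast this

/-- The overlap of the normalizations of `x₀` and `x₁` has modulus at most `κ`. -/
def OverlapLE (κ : ℝ) {a : ℕ} (x₀ x₁ : Fin a → ℂ) : Prop :=
  ‖ip x₀ x₁‖ ≤ κ * (√(nsq x₀) * √(nsq x₁))

theorem OverlapLE.of_branches {κ : ℝ} (hκ : 0 ≤ κ) {a n m : ℕ}
    {K : Fin n → Matrix (Fin m) (Fin a) ℂ} (hK : ∑ i, (K i)ᴴ * K i = 1) {x₀ x₁ : Fin a → ℂ}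
    (h : ∀ i, OverlapLE κ (K i *ᵥ x₀) (K i *ᵥ x₁)) : OverlapLE κ x₀ x₁ := by
  rw [OverlapLE, ← sum_ip_mulVec hK, ← sum_nsq_mulVec hK x₀, ← sum_nsq_mulVec hK x₁]
  refine (norm_sum_le _ _).trans ((Finset.sum_le_sum fun i _ => h i).trans ?_)
  rw [← Finset.mul_sum]
  exact mul_le_mul_of_nonneg_left
    (Real.sum_sqrt_mul_sqrt_le _ (fun _ => nsq_nonneg _) fun _ => nsq_nonneg _) hκ

theorem OverlapLE.swap {κ : ℝ} {a : ℕ} {x₀ x₁ : Fin a → ℂ} (h : OverlapLE κ x₀ x₁) :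
    OverlapLE κ x₁ x₀ := by
  rw [OverlapLE] at *
  rwa [ip_swap, norm_star, mul_comm (√ _)]

theorem OverlapLE.smul {κ : ℝ} {a : ℕ} {x₀ x₁ : Fin a → ℂ} (h : OverlapLE κ x₀ x₁) (s t : ℂ) :
    OverlapLE κ (s • x₀) (t • x₁) := by
  rw [OverlapLE, ip_smul, nsq_smul, nsq_smul, Real.sqrt_mul (by positivity),
    Real.sqrt_mul (by positivity), Real.sqrt_sq (norm_nonneg _), Real.sqrt_sq (norm_nonneg _),
    norm_mul, norm_mul, norm_star]
  rw [OverlapLE] at h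
  calc _ = (‖s‖ * ‖t‖) * ‖ip x₀ x₁‖ := by ring
    _ ≤ (‖s‖ * ‖t‖) * (κ * (√(nsq x₀) * √(nsq x₁))) := by gcongr
    _ = _ := by ring

/-- The Gram matrix of the two product vectors `x₀ ⊗ y₀ ⊗ w₀`, `x₁ ⊗ y₁ ⊗ w₁` is a nonnegative
combination of the Gram matrix with entries `N₀, O, N₁` and of the one with the two vectors
interchanged. -/
def GramMix (N₀ N₁ : ℝ) (O : ℂ) {a b c : ℕ} (x₀ x₁ : Fin a → ℂ) (y₀ y₁ : Fin b → ℂ)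
    (w₀ w₁ : Fin c → ℂ) : Prop :=
  ∃ p q : ℝ, 0 ≤ p ∧ 0 ≤ q ∧ nsq x₀ * (nsq y₀ * nsq w₀) = p * N₀ + q * N₁ ∧
    nsq x₁ * (nsq y₁ * nsq w₁) = p * N₁ + q * N₀ ∧
    ip x₀ x₁ * (ip y₀ y₁ * ip w₀ w₁) = p * O + q * star O

section Mix

variable {N₀ N₁ : ℝ} {O : ℂ} {a b c : ℕ} {x₀ x₁ : Fin a → ℂ} {y₀ y₁ : Fin b → ℂ}
  {w₀ w₁ : Fin c → ℂ}

theorem GramMix.rot (h : GramMix N₀ N₁ O x₀ x₁ y₀ y₁ w₀ w₁) :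
    GramMix N₀ N₁ O y₀ y₁ w₀ w₁ x₀ x₁ := by
  obtain ⟨p, q, hp, hq, h0, h1, h2⟩ := h
  exact ⟨p, q, hp, hq, by rw [← h0]; ring, by rw [← h1]; ring, by rw [← h2]; ring⟩

theorem GramMix.of_branches {n m : ℕ} {K : Fin n → Matrix (Fin m) (Fin a) ℂ}
    (hK : ∑ i, (K i)ᴴ * K i = 1)
    (h : ∀ i, GramMix N₀ N₁ O (K i *ᵥ x₀) (K i *ᵥ x₁) y₀ y₁ w₀ w₁) :
    GramMix N₀ N₁ O x₀ x₁ y₀ y₁ w₀ w₁ := by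
  choose p q hp hq h0 h1 h2 using h
  refine ⟨∑ i, p i, ∑ i, q i, Finset.sum_nonneg fun i _ => hp i, Finset.sum_nonneg fun i _ => hq i,
    ?_, ?_, ?_⟩
  · rw [← sum_nsq_mulVec hK x₀, Finset.sum_mul, Finset.sum_mul, Finset.sum_mul,
      ← Finset.sum_add_distrib]
    exact Finset.sum_congr rfl fun i _ => h0 i
  · rw [← sum_nsq_mulVec hK x₁, Finset.sum_mul, Finset.sum_mul, Finset.sum_mul,
      ← Finset.sum_add_distrib]
    exact Finset.sum_congr rfl fun i _ => h1 i
  · rw [← sum_ip_mulVec hK x₀, Finset.sum_mul]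
    push_cast
    rw [Finset.sum_mul, Finset.sum_mul, ← Finset.sum_add_distrib]
    exact Finset.sum_congr rfl fun i _ => h2 i

theorem applyABC_prodKet_add {a' b' c' : ℕ} (A : Matrix (Fin a') (Fin a) ℂ)
    (B : Matrix (Fin b') (Fin b) ℂ) (C : Matrix (Fin c') (Fin c) ℂ) :
    applyABC A B C (prodKet x₀ y₀ w₀ + prodKet x₁ y₁ w₁) =
      prodKet (A *ᵥ x₀) (B *ᵥ y₀) (C *ᵥ w₀) + prodKet (A *ᵥ x₁) (B *ᵥ y₁) (C *ᵥ w₁) := by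
  simp only [applyABC, applyC_add, applyB_add, applyA_add, applyC_prodKet, applyB_prodKet,
    applyA_prodKet]

theorem applyABC_rot {a' b' c' : ℕ} (A : Matrix (Fin a') (Fin a) ℂ)
    (B : Matrix (Fin b') (Fin b) ℂ) (C : Matrix (Fin c') (Fin c) ℂ) (ψ : Ket a b c) :
    applyABC B C A (rot ψ) = rot (applyABC A B C ψ) := by
  simp only [applyABC, ← rot_applyA, ← rot_applyB, ← rot_applyC]
  rw [applyC_applyA, ← applyA_applyB]

variable {X₀ X₁ Y₀ Y₁ W₀ W₁ : Fin 2 → ℂ}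

/-- If a measurement outcome annihilates a vector that some product operator maps to a vector
of rank two, then it annihilates both product terms. -/
theorem mulVec_eq_zero_of_applyA {m : ℕ} {K : Matrix (Fin m) (Fin a) ℂ}
    (hX : det2 X₀ X₁ ≠ 0) (hY : det2 Y₀ Y₁ ≠ 0) (hW : det2 W₀ W₁ ≠ 0)
    {A : Matrix (Fin 2) (Fin a) ℂ} {B : Matrix (Fin 2) (Fin b) ℂ} {C : Matrix (Fin 2) (Fin c) ℂ}
    (h : applyABC A B C (prodKet x₀ y₀ w₀ + prodKet x₁ y₁ w₁) =
      prodKet X₀ Y₀ W₀ + prodKet X₁ Y₁ W₁)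
    (hK : applyA K (prodKet x₀ y₀ w₀ + prodKet x₁ y₁ w₁) = 0) :
    K *ᵥ x₀ = 0 ∧ K *ᵥ x₁ = 0 := by
  rw [applyABC_prodKet_add] at h
  have h' : prodKet (B *ᵥ y₀) (C *ᵥ w₀) (A *ᵥ x₀) + prodKet (B *ᵥ y₁) (C *ᵥ w₁) (A *ᵥ x₁) =
      prodKet Y₀ W₀ X₀ + prodKet Y₁ W₁ X₁ := by
    rw [← rot_prodKet_add, h, rot_prodKet_add]
  have h'' : prodKet (C *ᵥ w₀) (A *ᵥ x₀) (B *ᵥ y₀) + prodKet (C *ᵥ w₁) (A *ᵥ x₁) (B *ᵥ y₁) =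
      prodKet W₀ X₀ Y₀ + prodKet W₁ X₁ Y₁ := by
    rw [← rot_prodKet_add, h', rot_prodKet_add]
  have hy := det2_ne_zero_of_eq h' hY hW hX
  have hw := det2_ne_zero_of_eq h'' hW hX hY
  have hz : applyB B (applyC C (applyA K (prodKet x₀ y₀ w₀ + prodKet x₁ y₁ w₁))) = 0 := by
    rw [hK]
    funext i j k
    simp [applyB, applyC]
  simp only [applyC_add, applyB_add, applyA_add, applyC_prodKet, applyB_prodKet,
    applyA_prodKet] at hz
  obtain ⟨m, hm0, hm1⟩ := exists_dual hy
  obtain ⟨m', hm1', hm0'⟩ := exists_dual (W₀ := B *ᵥ y₁) (W₁ := B *ᵥ y₀)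
    (by rwa [det2_swap, neg_ne_zero])
  have hw0 : ∃ k, (C *ᵥ w₀) k ≠ 0 := by
    by_contra! h0
    simp [det2, h0] at hw
  have hw1 : ∃ k, (C *ᵥ w₁) k ≠ 0 := by
    by_contra! h0
    simp [det2, h0] at hw
  obtain ⟨k₀, hk₀⟩ := hw0
  obtain ⟨k₁, hk₁⟩ := hw1
  simp only [dotProduct, Fin.sum_univ_two] at hm0 hm1 hm0' hm1'
  constructor <;> funext i
  · have e0 := congrFun (congrFun (congrFun hz i) 0) k₀
    have e1 := congrFun (congrFun (congrFun hz i) 1) k₀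
    simp only [prodKet, Pi.add_apply, Pi.zero_apply] at e0 e1 ⊢
    refine (mul_eq_zero.1 (?_ : (K *ᵥ x₀) i * (C *ᵥ w₀) k₀ = 0)).resolve_right hk₀
    linear_combination m 0 * e0 + m 1 * e1 - (K *ᵥ x₀) i * (C *ᵥ w₀) k₀ * hm0 -
      (K *ᵥ x₁) i * (C *ᵥ w₁) k₀ * hm1
  · have e0 := congrFun (congrFun (congrFun hz i) 0) k₁
    have e1 := congrFun (congrFun (congrFun hz i) 1) k₁
    simp only [prodKet, Pi.add_apply, Pi.zero_apply] at e0 e1 ⊢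
    refine (mul_eq_zero.1 (?_ : (K *ᵥ x₁) i * (C *ᵥ w₁) k₁ = 0)).resolve_right hk₁
    linear_combination m' 0 * e0 + m' 1 * e1 - (K *ᵥ x₁) i * (C *ᵥ w₁) k₁ * hm1' -
      (K *ᵥ x₀) i * (C *ᵥ w₀) k₁ * hm0'

/-- Equal nonzero product vectors have proportional first factors. -/
theorem exists_smul_of_prodKet_eq {x : Fin 2 → ℂ} {y : Fin 2 → ℂ} {w : Fin 2 → ℂ}
    (h : prodKet x y w = prodKet X₀ Y₀ W₀) (hne : prodKet X₀ Y₀ W₀ ≠ 0) : ∃ s : ℂ, x = s • X₀ := by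
  obtain ⟨i, j, k, hijk⟩ : ∃ i j k, prodKet X₀ Y₀ W₀ i j k ≠ 0 := by
    by_contra! h0
    exact hne (by funext i j k; exact h0 i j k)
  have hyw : y j * w k ≠ 0 := by
    intro h0
    apply hijk
    rw [← h, prodKet, mul_assoc, h0, mul_zero]
  refine ⟨Y₀ j * W₀ k / (y j * w k), ?_⟩
  funext l
  have := congrFun (congrFun (congrFun h l) j) k
  simp only [prodKet] at this
  simp only [Pi.smul_apply, smul_eq_mul]
  rw [div_mul_eq_mul_div, eq_div_iff hyw]
  linear_combination this

theorem prodKet_ne_zero {x : Fin a → ℂ} {y : Fin b → ℂ} {w : Fin c → ℂ} (hx : x ≠ 0) (hy : y ≠ 0)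
    (hw : w ≠ 0) : prodKet x y w ≠ 0 := by
  obtain ⟨i, hi⟩ := Function.ne_iff.1 hx
  obtain ⟨j, hj⟩ := Function.ne_iff.1 hy
  obtain ⟨k, hk⟩ := Function.ne_iff.1 hw
  intro h
  exact mul_ne_zero (mul_ne_zero hi hj) hk (congrFun (congrFun (congrFun h i) j) k)

theorem ne_zero_of_det2_left {u v : Fin 2 → ℂ} (h : det2 u v ≠ 0) : u ≠ 0 := by
  rintro rfl
  simp [det2] at h

theorem ne_zero_of_det2_right {u v : Fin 2 → ℂ} (h : det2 u v ≠ 0) : v ≠ 0 := by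
  rintro rfl
  simp [det2] at h

theorem OverlapLE.of_unique {κ : ℝ} (hκ : OverlapLE κ X₀ X₁) (hX : det2 X₀ X₁ ≠ 0)
    (hY : det2 Y₀ Y₁ ≠ 0) (hW : det2 W₀ W₁ ≠ 0) {x₀ x₁ y₀ y₁ w₀ w₁ : Fin 2 → ℂ}
    (h : prodKet x₀ y₀ w₀ + prodKet x₁ y₁ w₁ = prodKet X₀ Y₀ W₀ + prodKet X₁ Y₁ W₁) :
    OverlapLE κ x₀ x₁ := by
  have n0 := prodKet_ne_zero (ne_zero_of_det2_left hX) (ne_zero_of_det2_left hY)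
    (ne_zero_of_det2_left hW)
  have n1 := prodKet_ne_zero (ne_zero_of_det2_right hX) (ne_zero_of_det2_right hY)
    (ne_zero_of_det2_right hW)
  rcases prodKet_add_unique h hX hY hW with ⟨e0, e1⟩ | ⟨e0, e1⟩
  · obtain ⟨s, rfl⟩ := exists_smul_of_prodKet_eq e0 n0
    obtain ⟨t, rfl⟩ := exists_smul_of_prodKet_eq e1 n1
    exact hκ.smul s t
  · obtain ⟨s, rfl⟩ := exists_smul_of_prodKet_eq e0 n1
    obtain ⟨t, rfl⟩ := exists_smul_of_prodKet_eq e1 n0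
    exact hκ.swap.smul s t

end Mix

theorem normSq_prodKet {a b c : ℕ} (x : Fin a → ℂ) (y : Fin b → ℂ) (w : Fin c → ℂ) :
    normSq (prodKet x y w) = nsq x * (nsq y * nsq w) := by
  simp only [normSq, prodKet, norm_mul, mul_pow, nsq, Finset.sum_mul_sum]
  simp only [Finset.mul_sum]
  refine Finset.sum_congr rfl fun i _ => Finset.sum_congr rfl fun j _ =>
    Finset.sum_congr rfl fun k _ => by ring

theorem sum_star_prodKet_mul_prodKet {a b c : ℕ} (x x' : Fin a → ℂ) (y y' : Fin b → ℂ)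
    (w w' : Fin c → ℂ) :
    ∑ i, ∑ j, ∑ k, star (prodKet x y w i j k) * prodKet x' y' w' i j k =
      ip x x' * (ip y y' * ip w w') := by
  simp only [prodKet, star_mul', ip, dotProduct, Pi.star_apply, Finset.sum_mul_sum]
  simp only [Finset.mul_sum]
  refine Finset.sum_congr rfl fun i _ => Finset.sum_congr rfl fun j _ =>
    Finset.sum_congr rfl fun k _ => by ring

theorem GramMix.zero {N₀ N₁ : ℝ} {O : ℂ} {a b c : ℕ} {y₀ y₁ : Fin b → ℂ} {w₀ w₁ : Fin c → ℂ} :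
    GramMix N₀ N₁ O (0 : Fin a → ℂ) 0 y₀ y₁ w₀ w₁ :=
  ⟨0, 0, le_rfl, le_rfl, by simp [nsq], by simp [nsq], by simp [ip]⟩

theorem OverlapLE.zero {κ : ℝ} {a : ℕ} : OverlapLE κ (0 : Fin a → ℂ) 0 := by
  simp [OverlapLE, nsq, ip]

theorem det2_smul_smul (s t : ℂ) (u v : Fin 2 → ℂ) : det2 (s • u) (t • v) = s * t * det2 u v := by
  simp only [det2, Pi.smul_apply, smul_eq_mul]
  ring

/-- The necessary conditions for a deterministic transformation between vectors of the form
`x₀ ⊗ y₀ ⊗ w₀ + x₁ ⊗ y₁ ⊗ w₁`. The Gram matrix of the two terms is preserved on average by every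
measurement, and in each final branch the two terms are those of the target, in one order or the
other. The local overlaps can only grow, by the Cauchy–Schwarz inequality. -/
theorem LOCC.gram {X₀ X₁ Y₀ Y₁ W₀ W₁ : Fin 2 → ℂ} (hX : det2 X₀ X₁ ≠ 0) (hY : det2 Y₀ Y₁ ≠ 0)
    (hW : det2 W₀ W₁ ≠ 0) {κ₀ κ₁ κ₂ : ℝ} (hκ₀ : 0 ≤ κ₀) (hκ₁ : 0 ≤ κ₁) (hκ₂ : 0 ≤ κ₂)
    (oX : OverlapLE κ₀ X₀ X₁) (oY : OverlapLE κ₁ Y₀ Y₁) (oW : OverlapLE κ₂ W₀ W₁)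
    {φ : Ket 2 2 2} (hφ : φ = prodKet X₀ Y₀ W₀ + prodKet X₁ Y₁ W₁)
    {a b c : ℕ} {ψ : Ket a b c} (h : LOCC φ ψ) :
    ∀ (x₀ x₁ : Fin a → ℂ) (y₀ y₁ : Fin b → ℂ) (w₀ w₁ : Fin c → ℂ),
      ψ = prodKet x₀ y₀ w₀ + prodKet x₁ y₁ w₁ → ψ ≠ 0 →
      GramMix (nsq X₀ * (nsq Y₀ * nsq W₀)) (nsq X₁ * (nsq Y₁ * nsq W₁))
        (ip X₀ X₁ * (ip Y₀ Y₁ * ip W₀ W₁)) x₀ x₁ y₀ y₁ w₀ w₁ ∧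
      OverlapLE κ₀ x₀ x₁ ∧ OverlapLE κ₁ y₀ y₁ ∧ OverlapLE κ₂ w₀ w₁ := by
  induction h with
  | finish ψ s hs h =>
    intro x₀ x₁ y₀ y₁ w₀ w₁ hψ hne
    have e : prodKet x₀ y₀ w₀ + prodKet x₁ y₁ w₁ =
        prodKet (s • X₀) Y₀ W₀ + prodKet (s • X₁) Y₁ W₁ := by
      rw [← hψ, h, hφ]
      funext i j k
      simp only [prodKet, Pi.add_apply, Pi.smul_apply, smul_eq_mul]
      ring
    have hX' : det2 (s • X₀) (s • X₁) ≠ 0 := by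
      rw [det2_smul_smul]
      exact mul_ne_zero (mul_ne_zero hs hs) hX
    have e' : prodKet y₀ w₀ x₀ + prodKet y₁ w₁ x₁ =
        prodKet Y₀ W₀ (s • X₀) + prodKet Y₁ W₁ (s • X₁) := by
      rw [← rot_prodKet_add, e, rot_prodKet_add]
    have e'' : prodKet w₀ x₀ y₀ + prodKet w₁ x₁ y₁ =
        prodKet W₀ (s • X₀) Y₀ + prodKet W₁ (s • X₁) Y₁ := by
      rw [← rot_prodKet_add, e', rot_prodKet_add]
    refine ⟨?_, (oX.smul s s).of_unique hX' hY hW e, oY.of_unique hY hW hX' e',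
      oW.of_unique hW hX' hY e''⟩
    have hs2 : star s * s = ((‖s‖ ^ 2 : ℝ) : ℂ) := by
      rw [Complex.star_def, Complex.conj_mul']
      norm_cast
    rcases prodKet_add_unique e hX' hY hW with ⟨e0, e1⟩ | ⟨e0, e1⟩
    · refine ⟨‖s‖ ^ 2, 0, by positivity, le_rfl, ?_, ?_, ?_⟩
      · rw [← normSq_prodKet, e0, normSq_prodKet, nsq_smul]
        ring
      · rw [← normSq_prodKet, e1, normSq_prodKet, nsq_smul]
        ring
      · rw [← sum_star_prodKet_mul_prodKet, e0, e1, sum_star_prodKet_mul_prodKet, ip_smul, hs2]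
        push_cast
        ring
    · refine ⟨0, ‖s‖ ^ 2, le_rfl, by positivity, ?_, ?_, ?_⟩
      · rw [← normSq_prodKet, e0, normSq_prodKet, nsq_smul]
        ring
      · rw [← normSq_prodKet, e1, normSq_prodKet, nsq_smul]
        ring
      · rw [← sum_star_prodKet_mul_prodKet, e0, e1, sum_star_prodKet_mul_prodKet, ip_smul, hs2,
          ip_swap X₀, ip_swap Y₀, ip_swap W₀]
        simp only [star_mul']
        push_cast
        ring
  | alice ψ n m K hK hi ih =>
    intro x₀ x₁ y₀ y₁ w₀ w₁ hψ hne
    subst hψ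
    obtain ⟨A, B, C, hABC⟩ := LOCC.exists_applyABC (.alice _ n m K hK hi) hne
    have hb : ∀ i, GramMix (nsq X₀ * (nsq Y₀ * nsq W₀)) (nsq X₁ * (nsq Y₁ * nsq W₁))
        (ip X₀ X₁ * (ip Y₀ Y₁ * ip W₀ W₁)) (K i *ᵥ x₀) (K i *ᵥ x₁) y₀ y₁ w₀ w₁ ∧
        OverlapLE κ₀ (K i *ᵥ x₀) (K i *ᵥ x₁) := by
      intro i
      by_cases h0 : applyA (K i) (prodKet x₀ y₀ w₀ + prodKet x₁ y₁ w₁) = 0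
      · obtain ⟨k0, k1⟩ := mulVec_eq_zero_of_applyA hX hY hW (hABC.trans hφ) h0
        rw [k0, k1]
        exact ⟨.zero, .zero⟩
      · have := ih i h0 _ _ _ _ _ _ (by rw [applyA_add, applyA_prodKet, applyA_prodKet]) h0
        exact ⟨this.1, this.2.1⟩
    obtain ⟨i, hi0⟩ := exists_applyA_ne_zero hK hne
    have := ih i hi0 _ _ _ _ _ _ (by rw [applyA_add, applyA_prodKet, applyA_prodKet]) hi0
    exact ⟨.of_branches hK fun i => (hb i).1, .of_branches hκ₀ hK fun i => (hb i).2, this.2.2⟩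
  | bob ψ n m K hK hi ih =>
    intro x₀ x₁ y₀ y₁ w₀ w₁ hψ hne
    subst hψ
    obtain ⟨A, B, C, hABC⟩ := LOCC.exists_applyABC (.bob _ n m K hK hi) hne
    have hABC' := applyABC_rot A B C (prodKet x₀ y₀ w₀ + prodKet x₁ y₁ w₁)
    rw [hABC, hφ, rot_prodKet_add, rot_prodKet_add] at hABC'
    have hb : ∀ i, GramMix (nsq X₀ * (nsq Y₀ * nsq W₀)) (nsq X₁ * (nsq Y₁ * nsq W₁))
        (ip X₀ X₁ * (ip Y₀ Y₁ * ip W₀ W₁)) (K i *ᵥ y₀) (K i *ᵥ y₁) w₀ w₁ x₀ x₁ ∧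
        OverlapLE κ₁ (K i *ᵥ y₀) (K i *ᵥ y₁) := by
      intro i
      by_cases h0 : applyB (K i) (prodKet x₀ y₀ w₀ + prodKet x₁ y₁ w₁) = 0
      · obtain ⟨k0, k1⟩ := mulVec_eq_zero_of_applyA (K := K i) hY hW hX hABC' (by
          rw [← rot_prodKet_add, ← rot_applyB, h0]
          rfl)
        rw [k0, k1]
        exact ⟨.zero, .zero⟩
      · have := ih i h0 _ _ _ _ _ _ (by rw [applyB_add, applyB_prodKet, applyB_prodKet]) h0
        exact ⟨this.1.rot, this.2.2.1⟩
    obtain ⟨i, hi0⟩ : ∃ i, applyB (K i) (prodKet x₀ y₀ w₀ + prodKet x₁ y₁ w₁) ≠ 0 := by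
      obtain ⟨i, hi0⟩ := exists_applyA_ne_zero hK (mt rot_eq_zero.1 hne)
      exact ⟨i, mt rot_eq_zero.2 hi0⟩
    have := ih i hi0 _ _ _ _ _ _ (by rw [applyB_add, applyB_prodKet, applyB_prodKet]) hi0
    exact ⟨(GramMix.of_branches hK fun i => (hb i).1).rot.rot, this.2.1,
      .of_branches hκ₁ hK fun i => (hb i).2, this.2.2.2⟩
  | charlie ψ n m K hK hi ih =>
    intro x₀ x₁ y₀ y₁ w₀ w₁ hψ hne
    subst hψ
    obtain ⟨A, B, C, hABC⟩ := LOCC.exists_applyABC (.charlie _ n m K hK hi) hne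
    have hABC' := (applyABC_rot B C A _).trans (congrArg ThreeQubit.rot
      (applyABC_rot A B C (prodKet x₀ y₀ w₀ + prodKet x₁ y₁ w₁)))
    rw [hABC, hφ, rot_prodKet_add, rot_prodKet_add, rot_prodKet_add, rot_prodKet_add] at hABC'
    have hb : ∀ i, GramMix (nsq X₀ * (nsq Y₀ * nsq W₀)) (nsq X₁ * (nsq Y₁ * nsq W₁))
        (ip X₀ X₁ * (ip Y₀ Y₁ * ip W₀ W₁)) (K i *ᵥ w₀) (K i *ᵥ w₁) x₀ x₁ y₀ y₁ ∧
        OverlapLE κ₂ (K i *ᵥ w₀) (K i *ᵥ w₁) := by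
      intro i
      by_cases h0 : applyC (K i) (prodKet x₀ y₀ w₀ + prodKet x₁ y₁ w₁) = 0
      · obtain ⟨k0, k1⟩ := mulVec_eq_zero_of_applyA (K := K i) hW hX hY hABC' (by
          rw [← rot_prodKet_add, ← rot_prodKet_add, ← rot_applyB, ← rot_applyC, h0]
          rfl)
        rw [k0, k1]
        exact ⟨.zero, .zero⟩
      · have := ih i h0 _ _ _ _ _ _ (by rw [applyC_add, applyC_prodKet, applyC_prodKet]) h0
        exact ⟨this.1.rot.rot, this.2.2.2⟩
    obtain ⟨i, hi0⟩ : ∃ i, applyC (K i) (prodKet x₀ y₀ w₀ + prodKet x₁ y₁ w₁) ≠ 0 := by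
      obtain ⟨i, hi0⟩ := exists_applyA_ne_zero hK (mt rot_eq_zero.1 (mt rot_eq_zero.1 hne))
      exact ⟨i, mt rot_eq_zero.2 (mt rot_eq_zero.2 hi0)⟩
    have := ih i hi0 _ _ _ _ _ _ (by rw [applyC_add, applyC_prodKet, applyC_prodKet]) hi0
    exact ⟨(GramMix.of_branches hK fun i => (hb i).1).rot, this.2.1, this.2.2.1,
      .of_branches hκ₂ hK fun i => (hb i).2⟩

/-! ### The states `Ψ(g, z)` as sums of two product vectors -/

/-- The column `s` of `gx t`. -/
def gcol (t : ℝ) (s : Fin 2) : Fin 2 → ℂ := fun i => gx t i s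

theorem ip_gcol (t : ℝ) (s r : Fin 2) : ip (gcol t s) (gcol t r) = ((gx t)ᴴ * gx t) s r := by
  simp [ip, gcol, Matrix.mul_apply, dotProduct, Matrix.conjTranspose_apply]

theorem nsq_gcol {t : ℝ} (h0 : 0 ≤ t) (h1 : t < 1 / 2) (s : Fin 2) : nsq (gcol t s) = 1 / 2 := by
  have h : ip (gcol t s) (gcol t s) = ((1 / 2 : ℝ) : ℂ) := by
    rw [ip_gcol, gx_conjTranspose_mul_self t (by linarith) h1.le]
    fin_cases s <;> simp [sigmaX]
  rw [ip_self] at h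
  exact_mod_cast h

theorem ip_gcol_zero_one {t : ℝ} (h0 : 0 ≤ t) (h1 : t < 1 / 2) :
    ip (gcol t 0) (gcol t 1) = (t : ℂ) := by
  rw [ip_gcol, gx_conjTranspose_mul_self t (by linarith) h1.le]
  simp [sigmaX]

theorem det2_gcol (t : ℝ) :
    det2 (gcol t 0) (gcol t 1) = ((√(1 / 2 + t) * √(1 / 2 - t) : ℝ) : ℂ) := by
  simp only [det2, gcol, gx, Matrix.of_apply, Matrix.cons_val_zero, Matrix.cons_val_one,
    Matrix.cons_val', Matrix.cons_val_fin_one]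
  push_cast
  ring

theorem det2_gcol_ne_zero {t : ℝ} (h0 : 0 ≤ t) (h1 : t < 1 / 2) :
    det2 (gcol t 0) (gcol t 1) ≠ 0 := by
  rw [det2_gcol]
  have a : 0 < √(1 / 2 + t) := Real.sqrt_pos.2 (by linarith)
  have b : 0 < √(1 / 2 - t) := Real.sqrt_pos.2 (by linarith)
  exact_mod_cast (mul_pos a b).ne'

theorem ghzVector_eq (g : Fin 3 → ℝ) (z : ℂ) :
    ghzVector g z =
      prodKet ((z * ((√2)⁻¹ : ℝ)) • gcol (g 0) 0) (gcol (g 1) 0) (gcol (g 2) 0) +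
      prodKet ((z⁻¹ * ((√2)⁻¹ : ℝ)) • gcol (g 0) 1) (gcol (g 1) 1) (gcol (g 2) 1) := by
  have h : applyA (Pz z) ghz =
      prodKet (Pi.single 0 (z * ((√2)⁻¹ : ℝ))) (Pi.single 0 1) (Pi.single 0 1) +
      prodKet (Pi.single 1 (z⁻¹ * ((√2)⁻¹ : ℝ))) (Pi.single 1 1) (Pi.single 1 1) := by
    funext i j k
    fin_cases i <;> fin_cases j <;> fin_cases k <;>
      simp [applyA, Pz, ghz, prodKet]
  rw [ghzVector, h, applyABC_prodKet_add]
  congr 2 <;> funext i <;> simp [gcol, mul_comm]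

/-- The normalization factor of `Ψ(g, z)`. -/
def nrm (g : Fin 3 → ℝ) (z : ℂ) : ℝ := (√(normSq (ghzVector g z)))⁻¹

theorem Ψ_eq_smul (g : Fin 3 → ℝ) (z : ℂ) : Ψ g z = (nrm g z : ℂ) • ghzVector g z := rfl

/-- The coefficient of one of the two product terms of `Ψ(g, z)`, for `u = z` or `u = z⁻¹`. -/
def coef (g : Fin 3 → ℝ) (z u : ℂ) : ℂ := nrm g z * (u * ((√2)⁻¹ : ℝ))

theorem Ψ_eq (g : Fin 3 → ℝ) (z : ℂ) :
    Ψ g z = prodKet (coef g z z • gcol (g 0) 0) (gcol (g 1) 0) (gcol (g 2) 0) +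
      prodKet (coef g z z⁻¹ • gcol (g 0) 1) (gcol (g 1) 1) (gcol (g 2) 1) := by
  rw [Ψ_eq_smul, ghzVector_eq]
  funext i j k
  simp only [coef, prodKet, Pi.add_apply, Pi.smul_apply, smul_eq_mul]
  ring

theorem normSq_add {a b c : ℕ} (ψ φ : Ket a b c) :
    normSq (ψ + φ) = normSq ψ + normSq φ +
      2 * (∑ i, ∑ j, ∑ k, star (ψ i j k) * φ i j k).re := by
  simp only [normSq, Complex.re_sum, Finset.mul_sum, ← Finset.sum_add_distrib]
  refine Finset.sum_congr rfl fun i _ => Finset.sum_congr rfl fun j _ =>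
    Finset.sum_congr rfl fun k _ => ?_
  simp only [Pi.add_apply, ← Complex.normSq_eq_norm_sq, Complex.normSq_apply, Complex.add_re,
    Complex.add_im, Complex.star_def, Complex.mul_re, Complex.conj_re, Complex.conj_im]
  ring

theorem normSq_prodKet_add {a b c : ℕ} (x₀ x₁ : Fin a → ℂ) (y₀ y₁ : Fin b → ℂ)
    (w₀ w₁ : Fin c → ℂ) : normSq (prodKet x₀ y₀ w₀ + prodKet x₁ y₁ w₁) =
      nsq x₀ * (nsq y₀ * nsq w₀) + nsq x₁ * (nsq y₁ * nsq w₁) +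
        2 * (ip x₀ x₁ * (ip y₀ y₁ * ip w₀ w₁)).re := by
  rw [normSq_add, normSq_prodKet, normSq_prodKet, sum_star_prodKet_mul_prodKet]

theorem normSq_smul {a b c : ℕ} (s : ℂ) (ψ : Ket a b c) : normSq (s • ψ) = ‖s‖ ^ 2 * normSq ψ := by
  simp only [normSq, Finset.mul_sum, Pi.smul_apply, smul_eq_mul, norm_mul, mul_pow]

/-- `|z|² + |z|⁻²`. -/
def zS (z : ℂ) : ℝ := ‖z‖ ^ 2 + ‖z⁻¹‖ ^ 2

/-- `2 Re(z²) / (1 + |z|⁴)`, the signed version of `f_z`. -/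
def bx (z : ℂ) : ℝ := 2 * (z ^ 2).re / (1 + ‖z‖ ^ 4)

theorem fz_eq_abs_bx (z : ℂ) : fz z = |bx z| := by
  have h : 0 < 1 + ‖z‖ ^ 4 := by positivity
  rw [fz, bx, abs_div, abs_mul, abs_of_pos h, abs_of_pos (two_pos : (0 : ℝ) < 2)]

theorem zS_pos {z : ℂ} (hz : z ≠ 0) : 0 < zS z := by
  have := norm_pos_iff.2 hz
  unfold zS
  positivity

theorem bx_mul_zS {z : ℂ} (hz : z ≠ 0) : 2 * (star z * z⁻¹).re = bx z * zS z := by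
  have h : 0 < ‖z‖ := norm_pos_iff.2 hz
  have e : (star z * z⁻¹).re = (z ^ 2).re / ‖z‖ ^ 2 := by
    rw [← Complex.normSq_eq_norm_sq, Complex.inv_def, Complex.star_def,
      ← mul_assoc, Complex.re_mul_ofReal, div_eq_mul_inv]
    congr 1
    simp [pow_two]
  rw [e, bx, zS, norm_inv]
  field_simp
  ring

theorem abs_bx_le_one (z : ℂ) : |bx z| ≤ 1 := by
  rw [← fz_eq_abs_bx, fz, div_le_one (by positivity)]
  have h1 : |(z ^ 2).re| ≤ ‖z‖ ^ 2 := (Complex.abs_re_le_norm _).trans (norm_pow z 2).le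
  nlinarith [sq_nonneg (‖z‖ ^ 2 - 1)]

theorem normSq_ghzVector {g : Fin 3 → ℝ} {z : ℂ} (h : IsParam g z) :
    normSq (ghzVector g z) = zS z / 16 * (1 + 8 * (g 0 * g 1 * g 2) * bx z) := by
  obtain ⟨hg, hz, -⟩ := h
  have hs : ‖(((√2)⁻¹ : ℝ) : ℂ)‖ ^ 2 = 1 / 2 := by
    rw [Complex.norm_real, norm_inv, inv_pow, Real.norm_eq_abs, sq_abs, Real.sq_sqrt two_pos.le]
    norm_num
  have hs' : star (((√2)⁻¹ : ℝ) : ℂ) * (((√2)⁻¹ : ℝ) : ℂ) = ((1 / 2 : ℝ) : ℂ) := by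
    rw [Complex.star_def, Complex.conj_mul']
    exact_mod_cast hs
  rw [ghzVector_eq, normSq_prodKet_add]
  simp only [nsq_smul, ip_smul, nsq_gcol (hg _).1 (hg _).2, ip_gcol_zero_one (hg _).1 (hg _).2,
    norm_mul, mul_pow, hs, star_mul']
  have e : star z * star (((√2)⁻¹ : ℝ) : ℂ) * (z⁻¹ * (((√2)⁻¹ : ℝ) : ℂ)) * (g 0 : ℂ) *
      ((g 1 : ℂ) * (g 2 : ℂ)) = star z * z⁻¹ * ((1 / 2 * (g 0 * g 1 * g 2) : ℝ) : ℂ) := by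
    push_cast at hs' ⊢
    linear_combination (star z * z⁻¹ * g 0 * g 1 * g 2) * hs'
  rw [e, Complex.re_mul_ofReal]
  have := bx_mul_zS hz
  rw [zS] at *
  linear_combination (1 / 2 * (g 0 * g 1 * g 2)) * this

theorem prod_lt_of_isParam {g : Fin 3 → ℝ} {z : ℂ} (h : IsParam g z) :
    0 ≤ g 0 * g 1 * g 2 ∧ 8 * (g 0 * g 1 * g 2) < 1 := by
  have h0 := h.1 0
  have h1 := h.1 1
  have h2 := h.1 2
  have a : g 0 * g 1 ≤ 1 / 2 * (1 / 2) := mul_le_mul h0.2.le h1.2.le h1.1 (by norm_num)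
  have a' : 0 ≤ g 0 * g 1 := mul_nonneg h0.1 h1.1
  refine ⟨mul_nonneg a' h2.1, ?_⟩
  nlinarith

theorem one_add_pos {g : Fin 3 → ℝ} {z : ℂ} (h : IsParam g z) (z' : ℂ) :
    0 < 1 + 8 * (g 0 * g 1 * g 2) * bx z' := by
  have h1 := prod_lt_of_isParam h
  have h2 := (abs_le.1 (abs_bx_le_one z')).1
  nlinarith

theorem normSq_ghzVector_pos {g : Fin 3 → ℝ} {z : ℂ} (h : IsParam g z) :
    0 < normSq (ghzVector g z) := by
  rw [normSq_ghzVector h]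
  have := zS_pos h.2.1
  have := one_add_pos h z
  positivity

theorem nrm_pos {g : Fin 3 → ℝ} {z : ℂ} (h : IsParam g z) : 0 < nrm g z :=
  inv_pos.2 (Real.sqrt_pos.2 (normSq_ghzVector_pos h))

theorem normSq_Ψ {g : Fin 3 → ℝ} {z : ℂ} (h : IsParam g z) : normSq (Ψ g z) = 1 := by
  have := normSq_ghzVector_pos h
  rw [Ψ_eq_smul, normSq_smul, nrm, Complex.norm_real, norm_inv, inv_pow, Real.norm_eq_abs, sq_abs,
    Real.sq_sqrt this.le, inv_mul_cancel₀ this.ne']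

theorem Ψ_ne_zero {g : Fin 3 → ℝ} {z : ℂ} (h : IsParam g z) : Ψ g z ≠ 0 := by
  intro h0
  have := normSq_Ψ h
  rw [h0] at this
  simp [normSq] at this

theorem norm_coef_sq (g : Fin 3 → ℝ) (z u : ℂ) :
    ‖coef g z u‖ ^ 2 = nrm g z ^ 2 / 2 * ‖u‖ ^ 2 := by
  rw [coef, norm_mul, norm_mul, Complex.norm_real, Complex.norm_real, mul_pow, mul_pow, norm_inv,
    inv_pow, Real.norm_eq_abs, Real.norm_eq_abs, sq_abs, sq_abs, Real.sq_sqrt two_pos.le]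
  ring

theorem star_coef_mul_coef (g : Fin 3 → ℝ) (z : ℂ) :
    star (coef g z z) * coef g z z⁻¹ = ((nrm g z ^ 2 / 2 : ℝ) : ℂ) * (star z * z⁻¹) := by
  have hs' : (((√2)⁻¹ : ℝ) : ℂ) * (((√2)⁻¹ : ℝ) : ℂ) = ((1 / 2 : ℝ) : ℂ) := by
    norm_cast
    rw [← mul_inv, Real.mul_self_sqrt two_pos.le]
    norm_num
  simp only [coef, star_mul', Complex.star_def, Complex.conj_ofReal]
  push_cast at hs' ⊢
  linear_combination ((nrm g z : ℂ) ^ 2 * (starRingEnd ℂ z * z⁻¹)) * hs'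

theorem coef_ne_zero {g : Fin 3 → ℝ} {z : ℂ} (h : IsParam g z) {u : ℂ} (hu : u ≠ 0) :
    coef g z u ≠ 0 := by
  have h1 : (nrm g z : ℂ) ≠ 0 := Complex.ofReal_ne_zero.2 (nrm_pos h).ne'
  have h2 : (((√2)⁻¹ : ℝ) : ℂ) ≠ 0 := Complex.ofReal_ne_zero.2 (by positivity)
  exact mul_ne_zero h1 (mul_ne_zero hu h2)

theorem overlapLE_gcol {t : ℝ} (h0 : 0 ≤ t) (h1 : t < 1 / 2) :
    OverlapLE (2 * t) (gcol t 0) (gcol t 1) := by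
  rw [OverlapLE, ip_gcol_zero_one h0 h1, nsq_gcol h0 h1, nsq_gcol h0 h1,
    Real.mul_self_sqrt (by norm_num), Complex.norm_real, Real.norm_eq_abs, abs_of_nonneg h0]
  linarith

theorem le_of_overlapLE_gcol {t κ : ℝ} (h0 : 0 ≤ t) (h1 : t < 1 / 2)
    (h : OverlapLE (2 * κ) (gcol t 0) (gcol t 1)) : t ≤ κ := by
  rw [OverlapLE, ip_gcol_zero_one h0 h1, nsq_gcol h0 h1, nsq_gcol h0 h1,
    Real.mul_self_sqrt (by norm_num), Complex.norm_real, Real.norm_eq_abs, abs_of_nonneg h0] at h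
  linarith

theorem OverlapLE.of_smul {κ : ℝ} {a : ℕ} {x₀ x₁ : Fin a → ℂ} {s t : ℂ} (hs : s ≠ 0) (ht : t ≠ 0)
    (h : OverlapLE κ (s • x₀) (t • x₁)) : OverlapLE κ x₀ x₁ := by
  have := h.smul s⁻¹ t⁻¹
  rwa [inv_smul_smul₀ hs, inv_smul_smul₀ ht] at this

theorem nsq_terms {g : Fin 3 → ℝ} {z : ℂ} (h : IsParam g z) (u : ℂ) (s : Fin 2) :
    nsq (coef g z u • gcol (g 0) s) * (nsq (gcol (g 1) s) * nsq (gcol (g 2) s)) =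
      nrm g z ^ 2 / 16 * ‖u‖ ^ 2 := by
  rw [nsq_smul, norm_coef_sq]
  simp only [nsq_gcol (h.1 _).1 (h.1 _).2]
  ring

theorem ip_terms {g : Fin 3 → ℝ} {z : ℂ} (h : IsParam g z) :
    ip (coef g z z • gcol (g 0) 0) (coef g z z⁻¹ • gcol (g 0) 1) *
        (ip (gcol (g 1) 0) (gcol (g 1) 1) * ip (gcol (g 2) 0) (gcol (g 2) 1)) =
      ((nrm g z ^ 2 / 2 * (g 0 * g 1 * g 2) : ℝ) : ℂ) * (star z * z⁻¹) := by
  rw [ip_smul, star_coef_mul_coef]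
  simp only [ip_gcol_zero_one (h.1 _).1 (h.1 _).2]
  push_cast
  ring

/-- Necessary conditions for reaching `Ψ(h, z')`, for a vector given by two product terms. -/
theorem LOCC.gram_Ψ {h : Fin 3 → ℝ} {z' : ℂ} (hp : IsParam h z') {ψ : Ket 2 2 2}
    {x₀ x₁ y₀ y₁ w₀ w₁ : Fin 2 → ℂ} (hψ : ψ = prodKet x₀ y₀ w₀ + prodKet x₁ y₁ w₁) (h0 : ψ ≠ 0)
    (hr : Reaches ψ (Ψ h z')) :
    GramMix (nrm h z' ^ 2 / 16 * ‖z'‖ ^ 2) (nrm h z' ^ 2 / 16 * ‖z'⁻¹‖ ^ 2)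
        (((nrm h z' ^ 2 / 2 * (h 0 * h 1 * h 2) : ℝ) : ℂ) * (star z' * z'⁻¹)) x₀ x₁ y₀ y₁ w₀ w₁ ∧
      OverlapLE (2 * h 0) x₀ x₁ ∧ OverlapLE (2 * h 1) y₀ y₁ ∧ OverlapLE (2 * h 2) w₀ w₁ := by
  have hd : ∀ i, det2 (gcol (h i) 0) (gcol (h i) 1) ≠ 0 := fun i =>
    det2_gcol_ne_zero (hp.1 i).1 (hp.1 i).2
  have hκ : ∀ i, 0 ≤ 2 * h i := fun i => by linarith [(hp.1 i).1]
  have ho : ∀ i, OverlapLE (2 * h i) (gcol (h i) 0) (gcol (h i) 1) := fun i =>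
    overlapLE_gcol (hp.1 i).1 (hp.1 i).2
  have hX : det2 (coef h z' z' • gcol (h 0) 0) (coef h z' z'⁻¹ • gcol (h 0) 1) ≠ 0 := by
    rw [det2_smul_smul]
    exact mul_ne_zero (mul_ne_zero (coef_ne_zero hp hp.2.1)
      (coef_ne_zero hp (inv_ne_zero hp.2.1))) (hd 0)
  have := LOCC.gram hX (hd 1) (hd 2) (hκ 0) (hκ 1) (hκ 2) ((ho 0).smul _ _) (ho 1) (ho 2)
    (Ψ_eq h z') hr _ _ _ _ _ _ hψ h0
  rwa [nsq_terms hp, nsq_terms hp, ip_terms hp] at this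

/-- Along a transformation within the GHZ class the `g_i` do not decrease, and
`g₁ g₂ g₃ Re(z²) / (1 + |z|⁴)` is conserved. -/
theorem reaches_necessary {g h : Fin 3 → ℝ} {z z' : ℂ} (hg : IsParam g z) (hh : IsParam h z')
    (hr : Reaches (Ψ g z) (Ψ h z')) :
    (∀ i, g i ≤ h i) ∧ g 0 * g 1 * g 2 * bx z = h 0 * h 1 * h 2 * bx z' := by
  obtain ⟨⟨p, q, hp, hq, e0, e1, e2⟩, o0, o1, o2⟩ :=
    LOCC.gram_Ψ hh (Ψ_eq g z) (Ψ_ne_zero hg) hr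
  refine ⟨?_, ?_⟩
  · have o0' := OverlapLE.of_smul (coef_ne_zero hg hg.2.1) (coef_ne_zero hg (inv_ne_zero hg.2.1)) o0
    intro i
    fin_cases i
    · exact le_of_overlapLE_gcol (hg.1 0).1 (hg.1 0).2 o0'
    · exact le_of_overlapLE_gcol (hg.1 1).1 (hg.1 1).2 o1
    · exact le_of_overlapLE_gcol (hg.1 2).1 (hg.1 2).2 o2
  · rw [nsq_terms hg] at e0 e1
    rw [ip_terms hg] at e2
    have e3 := congrArg Complex.re e2
    rw [Complex.add_re, Complex.re_ofReal_mul, Complex.re_ofReal_mul, Complex.re_ofReal_mul,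
      Complex.re_ofReal_mul, Complex.star_def, Complex.conj_re, Complex.re_ofReal_mul] at e3
    have b := bx_mul_zS hg.2.1
    have b' := bx_mul_zS hh.2.1
    have n := nrm_pos hg
    have s : nrm g z ^ 2 * zS z = (p + q) * (nrm h z' ^ 2 * zS z') := by
      simp only [zS]
      linear_combination 16 * e0 + 16 * e1
    have s0 : 0 < nrm g z ^ 2 * zS z := mul_pos (pow_pos n 2) (zS_pos hg.2.1)
    apply mul_left_cancel₀ s0.ne'
    simp only [Complex.star_def] at b b'
    linear_combination 4 * e3 - (nrm g z ^ 2 * (g 0 * g 1 * g 2)) * b +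
      ((p + q) * nrm h z' ^ 2 * (h 0 * h 1 * h 2)) * b' - (h 0 * h 1 * h 2 * bx z') * s

/-! ### States in the maximally entangled set -/

/-- The matrix with columns `u` and `v`. -/
def colMat (u v : Fin 2 → ℂ) : Matrix (Fin 2) (Fin 2) ℂ := Matrix.of fun i s => ![u, v] s i

theorem det_colMat (u v : Fin 2 → ℂ) : (colMat u v).det = det2 u v := by
  simp [colMat, Matrix.det_fin_two, det2]
  ring

theorem colMat_gram (u v : Fin 2 → ℂ) :
    (colMat u v)ᴴ * colMat u v = !![(nsq u : ℂ), ip u v; star (ip u v), (nsq v : ℂ)] := by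
  rw [← ip_self, ← ip_self, ← ip_swap]
  ext i j
  fin_cases i <;> fin_cases j <;>
    simp [colMat, Matrix.mul_apply, ip, dotProduct, Matrix.conjTranspose_apply]

theorem ip_unitary_mulVec {U : Matrix (Fin 2) (Fin 2) ℂ} (hU : U ∈ Matrix.unitaryGroup (Fin 2) ℂ)
    (x y : Fin 2 → ℂ) : ip (U *ᵥ x) (U *ᵥ y) = ip x y := by
  simpa using sum_ip_mulVec (K := fun _ : Fin 1 => U)
    (by simpa [Matrix.star_eq_conjTranspose] using Matrix.mem_unitaryGroup_iff'.1 hU) x y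

/-- Two pairs of vectors with the same Gram matrix differ by a unitary. -/
theorem exists_unitary {x₀ x₁ v₀ v₁ : Fin 2 → ℂ} (hx : det2 x₀ x₁ ≠ 0) (h0 : nsq v₀ = nsq x₀)
    (h1 : nsq v₁ = nsq x₁) (h01 : ip v₀ v₁ = ip x₀ x₁) :
    ∃ U ∈ Matrix.unitaryGroup (Fin 2) ℂ, U *ᵥ x₀ = v₀ ∧ U *ᵥ x₁ = v₁ := by
  have hu : IsUnit (colMat x₀ x₁).det := by
    rw [det_colMat]
    exact hx.isUnit
  have hm : colMat v₀ v₁ * (colMat x₀ x₁)⁻¹ * colMat x₀ x₁ = colMat v₀ v₁ := by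
    rw [mul_assoc, Matrix.nonsing_inv_mul _ hu, mul_one]
  refine ⟨colMat v₀ v₁ * (colMat x₀ x₁)⁻¹, ?_, ?_, ?_⟩
  · rw [Matrix.mem_unitaryGroup_iff', Matrix.star_eq_conjTranspose, Matrix.conjTranspose_mul,
      mul_assoc, ← mul_assoc (colMat v₀ v₁)ᴴ, colMat_gram, h0, h1, h01, ← colMat_gram, mul_assoc,
      Matrix.mul_nonsing_inv _ hu, mul_one, ← Matrix.conjTranspose_mul,
      Matrix.mul_nonsing_inv _ hu, Matrix.conjTranspose_one]
  · funext i
    have := congrFun (congrFun hm i) 0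
    rw [Matrix.mul_apply] at this
    simpa [colMat, Matrix.mulVec, dotProduct] using this
  · funext i
    have := congrFun (congrFun hm i) 1
    rw [Matrix.mul_apply] at this
    simpa [colMat, Matrix.mulVec, dotProduct] using this

theorem nsq_pos {a : ℕ} {x : Fin a → ℂ} (hx : x ≠ 0) : 0 < nsq x := by
  obtain ⟨i, hi⟩ := Function.ne_iff.1 hx
  exact Finset.sum_pos' (fun _ _ => by positivity)
    ⟨i, Finset.mem_univ _, pow_pos (norm_pos_iff.2 hi) 2⟩

/-- Two pairs of vectors with the same modulus of the normalized overlap agree up to a unitary and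
scalar factors, one of which can be taken positive. -/
theorem exists_unitary_smul {x₀ x₁ X₀ X₁ : Fin 2 → ℂ} (hx : det2 x₀ x₁ ≠ 0) (hX : det2 X₀ X₁ ≠ 0)
    (ho : ip X₀ X₁ ≠ 0)
    (h : ‖ip x₀ x₁‖ * (√(nsq X₀) * √(nsq X₁)) = ‖ip X₀ X₁‖ * (√(nsq x₀) * √(nsq x₁))) :
    ∃ U ∈ Matrix.unitaryGroup (Fin 2) ℂ, ∃ s : ℝ, 0 < s ∧ ∃ t : ℂ,
      U *ᵥ x₀ = (s : ℂ) • X₀ ∧ U *ᵥ x₁ = t • X₁ := by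
  have px0 := Real.sqrt_pos.2 (nsq_pos (ne_zero_of_det2_left hx))
  have pX0 := Real.sqrt_pos.2 (nsq_pos (ne_zero_of_det2_left hX))
  have pX1 := Real.sqrt_pos.2 (nsq_pos (ne_zero_of_det2_right hX))
  have hs : 0 < √(nsq x₀) / √(nsq X₀) := div_pos px0 pX0
  set s : ℝ := √(nsq x₀) / √(nsq X₀) with hs_def
  have hsC : (s : ℂ) ≠ 0 := Complex.ofReal_ne_zero.2 hs.ne'
  have hoN : 0 < ‖ip X₀ X₁‖ := norm_pos_iff.2 ho
  set t : ℂ := ip x₀ x₁ / (s * ip X₀ X₁) with ht_def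
  have htn : ‖t‖ * √(nsq X₁) = √(nsq x₁) := by
    rw [ht_def, norm_div, norm_mul, Complex.norm_real, Real.norm_eq_abs, abs_of_pos hs, hs_def]
    field_simp
    linear_combination h
  obtain ⟨U, hU, h0, h1⟩ := exists_unitary (x₀ := x₀) (x₁ := x₁) (v₀ := (s : ℂ) • X₀)
    (v₁ := t • X₁) hx
    (by
      rw [nsq_smul, Complex.norm_real, Real.norm_eq_abs, sq_abs, hs_def, div_pow,
        Real.sq_sqrt (nsq_nonneg _), Real.sq_sqrt (nsq_nonneg _)]
      exact div_mul_cancel₀ _ (nsq_pos (ne_zero_of_det2_left hX)).ne')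
    (by
      rw [nsq_smul, ← Real.sq_sqrt (nsq_nonneg X₁), ← mul_pow, htn, Real.sq_sqrt (nsq_nonneg _)])
    (by
      rw [ip_smul, Complex.star_def, Complex.conj_ofReal, ht_def]
      field_simp)
  exact ⟨U, hU, s, hs, t, h0, h1⟩

section Invertible

variable {X₀ X₁ Y₀ Y₁ W₀ W₁ : Fin 2 → ℂ}

theorem eq_zero_of_applyA_eq_zero {K : Matrix (Fin 2) (Fin 2) ℂ} (hX : det2 X₀ X₁ ≠ 0)
    (hY : det2 Y₀ Y₁ ≠ 0) (hW : det2 W₀ W₁ ≠ 0)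
    (h : applyA K (prodKet X₀ Y₀ W₀ + prodKet X₁ Y₁ W₁) = 0) : K = 0 := by
  obtain ⟨k0, k1⟩ := mulVec_eq_zero_of_applyA (A := 1) (B := 1) (C := 1) hX hY hW
    (by rw [applyABC, applyC_one, applyB_one, applyA_one]) h
  have hu : IsUnit (colMat X₀ X₁).det := by
    rw [det_colMat]
    exact hX.isUnit
  have : K * colMat X₀ X₁ = 0 := by
    ext i s
    have e0 := congrFun k0 i
    have e1 := congrFun k1 i
    fin_cases s
    · simpa [colMat, Matrix.mul_apply, Matrix.mulVec, dotProduct] using e0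
    · simpa [colMat, Matrix.mul_apply, Matrix.mulVec, dotProduct] using e1
  rw [← mul_one K, ← Matrix.mul_nonsing_inv _ hu, ← mul_assoc, this, zero_mul]

theorem det_ne_zero_of_applyABC {A B C : Matrix (Fin 2) (Fin 2) ℂ} {χ : Ket 2 2 2}
    (hX : det2 X₀ X₁ ≠ 0) (hY : det2 Y₀ Y₁ ≠ 0) (hW : det2 W₀ W₁ ≠ 0)
    (h : applyABC A B C χ = prodKet X₀ Y₀ W₀ + prodKet X₁ Y₁ W₁) : A.det ≠ 0 := by
  intro hA
  have hK : applyA A.adjugate (prodKet X₀ Y₀ W₀ + prodKet X₁ Y₁ W₁) = 0 := by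
    rw [← h, applyABC, applyA_applyA, Matrix.adjugate_mul, hA, zero_smul]
    funext i j k
    simp [applyA]
  have h0 := eq_zero_of_applyA_eq_zero hX hY hW hK
  have hA0 : A = 0 := by
    rw [Matrix.adjugate_fin_two] at h0
    ext i j
    have e00 := congrFun (congrFun h0 0) 0
    have e01 := congrFun (congrFun h0 0) 1
    have e10 := congrFun (congrFun h0 1) 0
    have e11 := congrFun (congrFun h0 1) 1
    fin_cases i <;> fin_cases j <;> simp_all
  have h1 : applyA (1 : Matrix (Fin 2) (Fin 2) ℂ) (prodKet X₀ Y₀ W₀ + prodKet X₁ Y₁ W₁) = 0 := by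
    rw [← h, hA0, applyA_one]
    funext i j k
    simp [applyABC, applyA]
  exact one_ne_zero (eq_zero_of_applyA_eq_zero hX hY hW h1)

theorem applyABC_applyABC {a a' a'' b b' b'' c c' c'' : ℕ}
    (A : Matrix (Fin a'') (Fin a') ℂ) (B : Matrix (Fin b'') (Fin b') ℂ)
    (C : Matrix (Fin c'') (Fin c') ℂ) (A' : Matrix (Fin a') (Fin a) ℂ)
    (B' : Matrix (Fin b') (Fin b) ℂ) (C' : Matrix (Fin c') (Fin c) ℂ) (ψ : Ket a b c) :
    applyABC A B C (applyABC A' B' C' ψ) = applyABC (A * A') (B * B') (C * C') ψ := by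
  simp only [applyABC]
  rw [applyC_applyA, ← applyA_applyB, applyA_applyA, ← applyB_applyC, applyB_applyB,
    applyC_applyC]

theorem det2_mulVec (M : Matrix (Fin 2) (Fin 2) ℂ) (u v : Fin 2 → ℂ) :
    det2 (M *ᵥ u) (M *ᵥ v) = M.det * det2 u v := by
  simp only [det2, Matrix.mulVec, dotProduct, Fin.sum_univ_two, Matrix.det_fin_two]
  ring

/-- Every vector that some product operator maps to a vector of rank two of the GHZ class is itself
a sum of two product vectors with locally independent factors. -/
theorem exists_prodKet_of_applyABC {A B C : Matrix (Fin 2) (Fin 2) ℂ} {χ : Ket 2 2 2}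
    (hX : det2 X₀ X₁ ≠ 0) (hY : det2 Y₀ Y₁ ≠ 0) (hW : det2 W₀ W₁ ≠ 0)
    (h : applyABC A B C χ = prodKet X₀ Y₀ W₀ + prodKet X₁ Y₁ W₁) :
    ∃ x₀ x₁ y₀ y₁ w₀ w₁ : Fin 2 → ℂ, χ = prodKet x₀ y₀ w₀ + prodKet x₁ y₁ w₁ ∧
      det2 x₀ x₁ ≠ 0 ∧ det2 y₀ y₁ ≠ 0 ∧ det2 w₀ w₁ ≠ 0 := by
  have h' : applyABC B C A (rot χ) = prodKet Y₀ W₀ X₀ + prodKet Y₁ W₁ X₁ := by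
    rw [applyABC_rot, h, rot_prodKet_add]
  have h'' : applyABC C A B (rot (rot χ)) = prodKet W₀ X₀ Y₀ + prodKet W₁ X₁ Y₁ := by
    rw [applyABC_rot, h', rot_prodKet_add]
  have dA := det_ne_zero_of_applyABC hX hY hW h
  have dB := det_ne_zero_of_applyABC hY hW hX h'
  have dC := det_ne_zero_of_applyABC hW hX hY h''
  have dinv : ∀ {M : Matrix (Fin 2) (Fin 2) ℂ}, M.det ≠ 0 → (M⁻¹).det ≠ 0 := fun {M} hM h0 => by
    have := congrArg Matrix.det (Matrix.nonsing_inv_mul M hM.isUnit)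
    rw [Matrix.det_mul, h0, zero_mul, Matrix.det_one] at this
    exact zero_ne_one this
  refine ⟨A⁻¹ *ᵥ X₀, A⁻¹ *ᵥ X₁, B⁻¹ *ᵥ Y₀, B⁻¹ *ᵥ Y₁, C⁻¹ *ᵥ W₀, C⁻¹ *ᵥ W₁, ?_, ?_, ?_, ?_⟩
  · rw [← applyABC_prodKet_add, ← h, applyABC_applyABC, Matrix.nonsing_inv_mul _ dA.isUnit,
      Matrix.nonsing_inv_mul _ dB.isUnit, Matrix.nonsing_inv_mul _ dC.isUnit, applyABC,
      applyC_one, applyB_one, applyA_one]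
  · rw [det2_mulVec]
    exact mul_ne_zero (dinv dA) hX
  · rw [det2_mulVec]
    exact mul_ne_zero (dinv dB) hY
  · rw [det2_mulVec]
    exact mul_ne_zero (dinv dC) hW

end Invertible

/-- Three factors bounded termwise with the same nonzero product are termwise equal. -/
theorem eq_of_mul_eq_of_le {a₀ a₁ a₂ b₀ b₁ b₂ : ℝ} (h0 : a₀ ≤ b₀) (h1 : a₁ ≤ b₁) (h2 : a₂ ≤ b₂)
    (n0 : 0 ≤ a₀) (n1 : 0 ≤ a₁) (n2 : 0 ≤ a₂) (hb0 : 0 < b₀) (hb1 : 0 < b₁) (hb2 : 0 < b₂)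
    (h : a₀ * (a₁ * a₂) = b₀ * (b₁ * b₂)) : a₀ = b₀ ∧ a₁ = b₁ ∧ a₂ = b₂ := by
  have p12 : a₁ * a₂ ≤ b₁ * b₂ := mul_le_mul h1 h2 n2 hb1.le
  have q12 : 0 < b₁ * b₂ := mul_pos hb1 hb2
  have e0 : a₀ = b₀ := by
    refine le_antisymm h0 (le_of_mul_le_mul_right ?_ q12)
    rw [← h]
    exact mul_le_mul_of_nonneg_left p12 n0
  have e12 : a₁ * a₂ = b₁ * b₂ := by
    rw [e0] at h
    exact mul_left_cancel₀ hb0.ne' h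
  have e1 : a₁ = b₁ := by
    refine le_antisymm h1 (le_of_mul_le_mul_right ?_ hb2)
    rw [← e12]
    exact mul_le_mul_of_nonneg_left h2 n1
  refine ⟨e0, e1, ?_⟩
  rw [e1] at e12
  exact mul_left_cancel₀ hb1.ne' e12

/-- The states `Ψ(h, ζ)` with all `h_i ≠ 0` and `ζ² = ±1` lie in the MES: at a source of such a
state the Gram matrix and the overlap bounds are forced to be those of the state itself. -/
theorem inMES_of_sq {h : Fin 3 → ℝ} {ζ : ℂ} (hp : IsParam h ζ) (hpos : ∀ i, h i ≠ 0)
    (hζ : ζ ^ 2 = 1 ∨ ζ ^ 2 = -1) : InMES (Ψ h ζ) := by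
  refine ⟨normSq_Ψ hp, fun χ hχ hr => ?_⟩
  have hχ0 : χ ≠ 0 := by
    rintro rfl
    simp [normSq] at hχ
  obtain ⟨A, B, C, hABC⟩ := LOCC.exists_applyABC hr hχ0
  have hd : ∀ i, det2 (gcol (h i) 0) (gcol (h i) 1) ≠ 0 := fun i =>
    det2_gcol_ne_zero (hp.1 i).1 (hp.1 i).2
  have hX : det2 (coef h ζ ζ • gcol (h 0) 0) (coef h ζ ζ⁻¹ • gcol (h 0) 1) ≠ 0 := by
    rw [det2_smul_smul]
    exact mul_ne_zero (mul_ne_zero (coef_ne_zero hp hp.2.1)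
      (coef_ne_zero hp (inv_ne_zero hp.2.1))) (hd 0)
  have hposi : ∀ i, 0 < h i := fun i => lt_of_le_of_ne (hp.1 i).1 (hpos i).symm
  rw [Ψ_eq] at hABC
  obtain ⟨x₀, x₁, y₀, y₁, w₀, w₁, hdec, dx, dy, dw⟩ :=
    exists_prodKet_of_applyABC hX (hd 1) (hd 2) hABC
  obtain ⟨⟨p, q, hp0, hq0, e0, e1, e2⟩, o0, o1, o2⟩ := LOCC.gram_Ψ hp hdec hχ0 hr
  have hn1 : ‖ζ‖ = 1 := by
    have : ‖ζ‖ ^ 2 = 1 := by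
      rw [← norm_pow]
      rcases hζ with e | e <;> rw [e] <;> simp
    exact (pow_eq_one_iff_of_nonneg (norm_nonneg _) two_ne_zero).1 this
  have hn1' : ‖ζ⁻¹‖ = 1 := by rw [norm_inv, hn1, inv_one]
  have hnu := nrm_pos hp
  -- the relative sign of the two terms
  obtain ⟨ε, hε, hε'⟩ : ∃ ε : ℝ, star ζ * ζ⁻¹ = (ε : ℂ) ∧ |ε| = 1 := by
    have hs : star ζ = ζ⁻¹ := by
      rw [Complex.inv_def, Complex.normSq_eq_norm_sq, hn1]
      simp
    rcases hζ with e | e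
    · exact ⟨1, by rw [hs, ← mul_inv, ← pow_two, e]; simp, by simp⟩
    · exact ⟨-1, by rw [hs, ← mul_inv, ← pow_two, e]; simp, by simp⟩
  have tnorm := normSq_Ψ hp
  rw [Ψ_eq, normSq_prodKet_add, nsq_terms hp, nsq_terms hp, ip_terms hp, hε, hn1, hn1',
    ← Complex.ofReal_mul, Complex.ofReal_re] at tnorm
  rw [hε, ← Complex.ofReal_mul, Complex.star_def, Complex.conj_ofReal] at e2
  rw [hn1, hn1'] at e0 e1
  have snorm := hχ
  rw [hdec, normSq_prodKet_add, e0, e1, e2, ← Complex.ofReal_mul, ← Complex.ofReal_mul,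
    ← Complex.ofReal_add, Complex.ofReal_re] at snorm
  have hpq : p + q = 1 := by linear_combination snorm - (p + q) * tnorm
  set N : ℝ := nrm h ζ ^ 2 / 16 with hN
  set O : ℝ := nrm h ζ ^ 2 / 2 * (h 0 * h 1 * h 2) * ε with hO
  have hNpos : 0 < N := by positivity
  have e0' : nsq x₀ * (nsq y₀ * nsq w₀) = N := by rw [e0]; linear_combination N * hpq
  have e1' : nsq x₁ * (nsq y₁ * nsq w₁) = N := by rw [e1]; linear_combination N * hpq
  have e2' : ip x₀ x₁ * (ip y₀ y₁ * ip w₀ w₁) = (O : ℂ) := by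
    rw [e2, ← add_mul]
    norm_cast
    rw [hpq, one_mul]
  have sp : ∀ {u v : Fin 2 → ℂ}, det2 u v ≠ 0 → 0 < √(nsq u) * √(nsq v) := fun huv =>
    mul_pos (Real.sqrt_pos.2 (nsq_pos (ne_zero_of_det2_left huv)))
      (Real.sqrt_pos.2 (nsq_pos (ne_zero_of_det2_right huv)))
  have hsq : √(nsq x₀) * √(nsq x₁) * (√(nsq y₀) * √(nsq y₁) * (√(nsq w₀) * √(nsq w₁))) = N := by
    have a0 : √(nsq x₀) * (√(nsq y₀) * √(nsq w₀)) = √N := by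
      rw [← e0', Real.sqrt_mul (nsq_nonneg _), Real.sqrt_mul (nsq_nonneg _)]
    have a1 : √(nsq x₁) * (√(nsq y₁) * √(nsq w₁)) = √N := by
      rw [← e1', Real.sqrt_mul (nsq_nonneg _), Real.sqrt_mul (nsq_nonneg _)]
    rw [← Real.mul_self_sqrt hNpos.le]
    nth_rewrite 1 [← a0]
    rw [← a1]
    ring
  have hmul : ‖ip x₀ x₁‖ * (‖ip y₀ y₁‖ * ‖ip w₀ w₁‖) =
      (2 * h 0 * (√(nsq x₀) * √(nsq x₁))) * ((2 * h 1 * (√(nsq y₀) * √(nsq y₁))) *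
        (2 * h 2 * (√(nsq w₀) * √(nsq w₁)))) := by
    rw [← norm_mul, ← norm_mul, e2', Complex.norm_real, Real.norm_eq_abs, hO, abs_mul, hε',
      abs_of_pos (mul_pos (by positivity) (mul_pos (mul_pos (hposi 0) (hposi 1)) (hposi 2)))]
    linear_combination (-8 * h 0 * h 1 * h 2) * hsq + (8 * h 0 * h 1 * h 2) * hN
  have h2 : ∀ i, 0 < 2 * h i := fun i => mul_pos two_pos (hposi i)
  obtain ⟨q0, q1, q2⟩ := eq_of_mul_eq_of_le o0 o1 o2 (norm_nonneg _) (norm_nonneg _)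
    (norm_nonneg _) (mul_pos (h2 0) (sp dx)) (mul_pos (h2 1) (sp dy)) (mul_pos (h2 2) (sp dw)) hmul
  have tr : ∀ i (u v : Fin 2 → ℂ), ‖ip u v‖ = 2 * h i * (√(nsq u) * √(nsq v)) →
      ‖ip u v‖ * (√(nsq (gcol (h i) 0)) * √(nsq (gcol (h i) 1))) =
        ‖ip (gcol (h i) 0) (gcol (h i) 1)‖ * (√(nsq u) * √(nsq v)) := by
    intro i u v huv
    rw [huv, nsq_gcol (hp.1 i).1 (hp.1 i).2, nsq_gcol (hp.1 i).1 (hp.1 i).2,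
      ip_gcol_zero_one (hp.1 i).1 (hp.1 i).2, Real.mul_self_sqrt (by norm_num), Complex.norm_real,
      Real.norm_eq_abs, abs_of_pos (hposi i)]
    ring
  have hio : ∀ i, ip (gcol (h i) 0) (gcol (h i) 1) ≠ 0 := fun i => by
    rw [ip_gcol_zero_one (hp.1 i).1 (hp.1 i).2]
    exact Complex.ofReal_ne_zero.2 (hpos i)
  obtain ⟨U, hU, s₀, hs₀, t₀, hU0, hU1⟩ := exists_unitary_smul dx (hd 0) (hio 0) (tr 0 _ _ q0)
  obtain ⟨V, hV, s₁, hs₁, t₁, hV0, hV1⟩ := exists_unitary_smul dy (hd 1) (hio 1) (tr 1 _ _ q1)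
  obtain ⟨W, hW, s₂, hs₂, t₂, hW0, hW1⟩ := exists_unitary_smul dw (hd 2) (hio 2) (tr 2 _ _ q2)
  -- the first terms agree in norm, and the second terms agree since the inner products do
  set s : ℝ := s₀ * (s₁ * s₂) with hs
  have hs0 : 0 < s := by positivity
  set c₀ : ℂ := coef h ζ ζ with hc₀
  set c₁ : ℂ := coef h ζ ζ⁻¹ with hc₁
  have n8 : ∀ i r, ip (gcol (h i) r) (gcol (h i) r) = 1 / 2 := fun i r => by
    rw [ip_self, nsq_gcol (hp.1 i).1 (hp.1 i).2]
    norm_num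
  have hcs : star c₀ * c₀ = (s : ℂ) * s := by
    have k : ip x₀ x₀ * (ip y₀ y₀ * ip w₀ w₀) = (N : ℂ) := by
      rw [ip_self, ip_self, ip_self]
      exact_mod_cast e0'
    rw [← ip_unitary_mulVec hU x₀, ← ip_unitary_mulVec hV y₀, ← ip_unitary_mulVec hW w₀, hU0, hV0,
      hW0, ip_smul, ip_smul, ip_smul, n8, n8, n8] at k
    have k' : star c₀ * c₀ = ((8 * N : ℝ) : ℂ) := by
      rw [Complex.star_def, Complex.conj_mul', hc₀]
      have := norm_coef_sq h ζ ζ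
      rw [hn1] at this
      exact_mod_cast this.trans (by rw [hN]; ring)
    rw [k']
    simp only [Complex.star_def, Complex.conj_ofReal] at k
    push_cast [hs] at k ⊢
    linear_combination -8 * k
  have hct : (s : ℂ) * (t₀ * (t₁ * t₂)) = star c₀ * c₁ := by
    have k := e2'
    rw [← ip_unitary_mulVec hU x₀, ← ip_unitary_mulVec hV y₀, ← ip_unitary_mulVec hW w₀, hU0, hV0,
      hW0, hU1, hV1, hW1, ip_smul, ip_smul, ip_smul] at k
    have k' : star c₀ * c₁ * (ip (gcol (h 0) 0) (gcol (h 0) 1) *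
        (ip (gcol (h 1) 0) (gcol (h 1) 1) * ip (gcol (h 2) 0) (gcol (h 2) 1))) = (O : ℂ) := by
      have := ip_terms hp
      rw [ip_smul, hε] at this
      rw [hO]
      push_cast at this ⊢
      rw [← this]
      ring
    apply mul_right_cancel₀ (mul_ne_zero (hio 0) (mul_ne_zero (hio 1) (hio 2)))
    rw [k', ← k]
    simp only [Complex.star_def, Complex.conj_ofReal]
    push_cast [hs]
    ring
  have hsC : (s : ℂ) ≠ 0 := Complex.ofReal_ne_zero.2 hs0.ne'
  have hμ : star (c₀ / s) * (c₀ / s) = 1 := by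
    rw [star_div₀, div_mul_div_comm, hcs, Complex.star_def, Complex.conj_ofReal, div_self]
    exact mul_ne_zero hsC hsC
  refine ⟨(c₀ / s) • U, ?_, V, hV, W, hW, ?_⟩
  · rw [Matrix.mem_unitaryGroup_iff', star_smul, smul_mul_smul_comm, hμ, one_smul]
    exact Matrix.mem_unitaryGroup_iff'.1 hU
  · rw [Ψ_eq, hdec, applyABC_prodKet_add, Matrix.smul_mulVec, Matrix.smul_mulVec, hU0, hU1, hV0,
      hV1, hW0, hW1]
    congr 1 <;> funext i j k <;> simp only [prodKet, Pi.smul_apply, smul_eq_mul]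
    · rw [← hc₀]
      have : c₀ = c₀ / s * (s₀ * (s₁ * s₂)) := by
        have : (s₀ * (s₁ * s₂) : ℂ) = s := by push_cast [hs]; rfl
        rw [this, div_mul_cancel₀ _ hsC]
      nth_rewrite 1 [this]
      ring
    · rw [← hc₁]
      have : c₁ = c₀ / s * (t₀ * (t₁ * t₂)) := by
        field_simp
        apply mul_left_cancel₀ hsC
        linear_combination -c₁ * hcs - c₀ * hct
      nth_rewrite 1 [this]
      ring

/-! ### Protocols in which one party measures -/

theorem gx_mul_sigmaX (t : ℝ) : gx t * sigmaX = sigmaX * gx t := by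
  ext i j
  fin_cases i <;> fin_cases j <;> simp [gx, sigmaX, Matrix.mul_apply]

theorem sigmaX_mul_self : sigmaX * sigmaX = 1 := by
  ext i j
  fin_cases i <;> fin_cases j <;> simp [sigmaX, Matrix.mul_apply]

theorem sigmaX_conjTranspose : sigmaXᴴ = sigmaX := by
  ext i j
  fin_cases i <;> fin_cases j <;> simp [sigmaX, Matrix.conjTranspose_apply]

theorem applyABC_sigmaX_ghz : applyABC sigmaX sigmaX sigmaX ghz = ghz := by
  funext i j k
  fin_cases i <;> fin_cases j <;> fin_cases k <;>
    simp [applyABC, applyA, applyB, applyC, sigmaX, ghz]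

theorem applyABC_Pz_ghz (A B C : Matrix (Fin 2) (Fin 2) ℂ) (z : ℂ) :
    applyABC A B C (applyA (Pz z) ghz) = applyABC (A * Pz z) B C ghz := by
  have : applyA (Pz z) ghz = applyABC (Pz z) 1 1 ghz := by
    rw [applyABC, applyC_one, applyB_one]
  rw [this, applyABC_applyABC, mul_one, mul_one]

/-- The local operator `gx t * Pz z` has the Gram matrix `Pz† (1/2 + t σ_x) Pz`. -/
theorem gram_gx_Pz {t : ℝ} (h0 : 0 ≤ t) (h1 : t < 1 / 2) (z : ℂ) :
    (gx t * Pz z)ᴴ * (gx t * Pz z) =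
      !![((‖z‖ ^ 2 / 2 : ℝ) : ℂ), star z * z⁻¹ * t;
        star (star z * z⁻¹) * t, ((‖z⁻¹‖ ^ 2 / 2 : ℝ) : ℂ)] := by
  rw [Matrix.conjTranspose_mul, mul_assoc, ← mul_assoc (gx t)ᴴ,
    gx_conjTranspose_mul_self t (by linarith) h1.le]
  have e0 : star z * z = ((‖z‖ ^ 2 : ℝ) : ℂ) := by
    rw [Complex.star_def, Complex.conj_mul']
    norm_cast
  have e1 : star z⁻¹ * z⁻¹ = ((‖z⁻¹‖ ^ 2 : ℝ) : ℂ) := by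
    rw [Complex.star_def, Complex.conj_mul']
    norm_cast
  ext i j
  fin_cases i <;> fin_cases j <;>
    simp [Pz, sigmaX, Matrix.mul_apply, Matrix.conjTranspose_apply, Matrix.diagonal] <;>
    push_cast at e0 e1 <;> simp at e0 e1
  · linear_combination (1 / 2 : ℂ) * e0
  · ring
  · ring
  · linear_combination (1 / 2 : ℂ) * e1

theorem ghzVector_eq_smul_Ψ {g : Fin 3 → ℝ} {z : ℂ} (h : IsParam g z) :
    ghzVector g z = ((nrm g z : ℂ))⁻¹ • Ψ g z := by
  rw [Ψ_eq_smul, inv_smul_smul₀ (Complex.ofReal_ne_zero.2 (nrm_pos h).ne')]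

/-- A two-outcome measurement by the first party. On the second outcome the two product terms are
interchanged, and the other two parties undo this by `σ_x`. -/
theorem reaches_of_mix {g h : Fin 3 → ℝ} {z z' : ℂ} (hg : IsParam g z) (hh : IsParam h z')
    (h1 : h 1 = g 1) (h2 : h 2 = g 2) {p q : ℝ} (hp : 0 ≤ p) (hq : 0 ≤ q)
    (e0 : ‖z‖ ^ 2 = p * ‖z'‖ ^ 2 + q * ‖z'⁻¹‖ ^ 2)
    (e1 : ‖z⁻¹‖ ^ 2 = p * ‖z'⁻¹‖ ^ 2 + q * ‖z'‖ ^ 2)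
    (e2 : star z * z⁻¹ * g 0 = h 0 * (p * (star z' * z'⁻¹) + q * star (star z' * z'⁻¹))) :
    Reaches (Ψ g z) (Ψ h z') := by
  refine LOCC.smul ?_ (Complex.ofReal_ne_zero.2 (nrm_pos hg).ne')
  set M := gx (h 0) * Pz z' with hM
  set M₀ := gx (g 0) * Pz z with hM₀
  have hdet : IsUnit M₀.det := by
    rw [hM₀, Matrix.det_mul]
    have a : (gx (g 0)).det ≠ 0 := by
      have := det2_gcol_ne_zero (hg.1 0).1 (hg.1 0).2
      rwa [← det_colMat, show colMat (gcol (g 0) 0) (gcol (g 0) 1) = gx (g 0) by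
        ext i j; fin_cases j <;> rfl] at this
    have b : (Pz z).det = 1 := by
      simp [Pz, Matrix.det_diagonal, Fin.prod_univ_two, hg.2.1]
    rw [b, mul_one]
    exact a.isUnit
  have key : ((p : ℝ) : ℂ) • (Mᴴ * M) + ((q : ℝ) : ℂ) • (sigmaX * (Mᴴ * M) * sigmaX) =
      M₀ᴴ * M₀ := by
    rw [hM, hM₀, gram_gx_Pz (hh.1 0).1 (hh.1 0).2, gram_gx_Pz (hg.1 0).1 (hg.1 0).2]
    have e2' := congrArg star e2
    simp only [star_mul', star_add, Complex.star_def, Complex.conj_ofReal, map_inv₀,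
      Complex.conj_conj] at e2 e2'
    rw [e0, e1]
    ext i j
    fin_cases i <;> fin_cases j <;> simp [sigmaX]
    · ring
    · linear_combination -e2
    · linear_combination -e2'
    · ring
  have hsp : star ((√p : ℝ) : ℂ) * ((√p : ℝ) : ℂ) = (p : ℂ) := by
    rw [Complex.star_def, Complex.conj_ofReal]
    exact_mod_cast Real.mul_self_sqrt hp
  have hsq : star ((√q : ℝ) : ℂ) * ((√q : ℝ) : ℂ) = (q : ℂ) := by
    rw [Complex.star_def, Complex.conj_ofReal]
    exact_mod_cast Real.mul_self_sqrt hq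
  have hinv : M₀⁻¹ * M₀ = 1 := Matrix.nonsing_inv_mul _ hdet
  have hvec : ∀ N : Matrix (Fin 2) (Fin 2) ℂ, applyA (N * M₀⁻¹) (ghzVector g z) =
      applyABC N (gx (h 1)) (gx (h 2)) ghz := by
    intro N
    rw [ghzVector, applyABC_Pz_ghz, applyABC, applyA_applyA, mul_assoc, hinv, mul_one, h1, h2]
    rfl
  have hN : ∀ s : ℂ, ∀ N : Matrix (Fin 2) (Fin 2) ℂ, ∀ ψ : Ket 2 2 2,
      applyA (s • N) ψ = s • applyA N ψ := by
    intro s N ψ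
    funext i j k
    simp [applyA, mul_assoc, mul_add]
  have hfin : ∀ s : ℂ, s • ghzVector h z' ≠ 0 → LOCC (Ψ h z') (s • ghzVector h z') := by
    intro s hs
    rw [ghzVector_eq_smul_Ψ hh, smul_smul]
    refine .finish _ _ (mul_ne_zero (left_ne_zero_of_smul hs) ?_) rfl
    exact inv_ne_zero (Complex.ofReal_ne_zero.2 (nrm_pos hh).ne')
  refine .alice _ 2 2 ![((√p : ℝ) : ℂ) • (M * M₀⁻¹), ((√q : ℝ) : ℂ) • (M * sigmaX * M₀⁻¹)] ?_ ?_
  · have hx : (M₀⁻¹)ᴴ * (M₀ᴴ * M₀) * M₀⁻¹ = 1 := by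
      rw [← mul_assoc, ← Matrix.conjTranspose_mul, mul_assoc, Matrix.mul_nonsing_inv _ hdet,
        Matrix.conjTranspose_one, mul_one]
    rw [Fin.sum_univ_two]
    simp only [Matrix.cons_val_zero, Matrix.cons_val_one, Matrix.conjTranspose_smul,
      Matrix.conjTranspose_mul, smul_mul_smul_comm, hsp, hsq, sigmaX_conjTranspose]
    rw [← hx, ← key, mul_add, add_mul, mul_smul_comm, mul_smul_comm, smul_mul_assoc,
      smul_mul_assoc]
    simp only [mul_assoc]
  · intro i hi
    fin_cases i
    · simp only [Fin.zero_eta, Matrix.cons_val_zero] at hi ⊢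
      rw [hN, hvec, hM, ← applyABC_Pz_ghz] at hi ⊢
      exact hfin _ hi
    · simp only [Fin.mk_one, Matrix.cons_val_one, Matrix.cons_val_fin_one] at hi ⊢
      refine .of_isometryC (U := sigmaX) (by rw [sigmaX_conjTranspose, sigmaX_mul_self]) ?_
      refine .of_isometryB (U := sigmaX) (by rw [sigmaX_conjTranspose, sigmaX_mul_self]) ?_
      have hflip : applyB sigmaX (applyC sigmaX
          (applyA (((√q : ℝ) : ℂ) • (M * sigmaX * M₀⁻¹)) (ghzVector g z))) =
          ((√q : ℝ) : ℂ) • ghzVector h z' := by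
        rw [hN, hvec, applyC_smul, applyB_smul]
        congr 1
        have : ∀ χ : Ket 2 2 2, applyB sigmaX (applyC sigmaX χ) = applyABC 1 sigmaX sigmaX χ := by
          intro χ
          rw [applyABC, applyA_one]
        rw [this, applyABC_applyABC, one_mul, ← gx_mul_sigmaX, ← gx_mul_sigmaX,
          ← applyABC_applyABC, applyABC_sigmaX_ghz, ghzVector, applyABC_Pz_ghz]
      rw [hflip]
      refine hfin _ ?_
      rw [← hflip]
      intro h0
      apply hi
      have h0' := congrArg (fun χ => applyB sigmaX (applyC sigmaX χ)) h0
      rw [← applyB_applyC, applyC_applyC, sigmaX_mul_self, applyC_one, applyB_applyB,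
        sigmaX_mul_self, applyB_one] at h0'
      rw [h0']
      funext i j k
      simp [applyB, applyC]

/-! ### Bloch coordinates of `z` -/

/-- `(a, b, c)` is the point of the unit sphere with stereographic coordinate `z²`. -/
structure IsBloch (z : ℂ) (a b c : ℝ) : Prop where
  norm_sq : ‖z‖ ^ 2 = zS z / 2 * (1 - c)
  norm_inv_sq : ‖z⁻¹‖ ^ 2 = zS z / 2 * (1 + c)
  phase : star z * z⁻¹ = ((zS z / 2 : ℝ) : ℂ) * (a - b * Complex.I)

theorem norm_sq_mul_norm_inv_sq {z : ℂ} (hz : z ≠ 0) : ‖z‖ ^ 2 * ‖z⁻¹‖ ^ 2 = 1 := by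
  rw [← mul_pow, ← norm_mul, mul_inv_cancel₀ hz]
  simp

theorem exists_isBloch {z : ℂ} (hz : z ≠ 0) (h1 : ‖z‖ ≤ 1) :
    ∃ b c : ℝ, IsBloch z (bx z) b c ∧ bx z ^ 2 + b ^ 2 + c ^ 2 = 1 ∧ 0 ≤ c ∧ c < 1 := by
  have hS := zS_pos hz
  have hzn : 0 < ‖z‖ := norm_pos_iff.2 hz
  have hm := norm_sq_mul_norm_inv_sq hz
  have hbx := bx_mul_zS hz
  have hun : (star z * z⁻¹).re ^ 2 + (star z * z⁻¹).im ^ 2 = 1 := by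
    have : ‖star z * z⁻¹‖ ^ 2 = 1 := by
      rw [norm_mul, norm_star, mul_pow, hm]
    rw [← Complex.normSq_eq_norm_sq, Complex.normSq_apply] at this
    linear_combination this
  refine ⟨-2 * (star z * z⁻¹).im / zS z, (‖z⁻¹‖ ^ 2 - ‖z‖ ^ 2) / zS z, ⟨?_, ?_, ?_⟩, ?_, ?_, ?_⟩
  · field_simp
    rw [zS]
    ring_nf
  · field_simp
    rw [zS]
    ring_nf
  · apply Complex.ext
    · simp only [Complex.mul_re, Complex.ofReal_re, Complex.ofReal_im, Complex.sub_re,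
        Complex.sub_im, Complex.I_re, Complex.I_im, Complex.mul_im] at hbx ⊢
      linear_combination hbx / 2
    · simp only [Complex.mul_re, Complex.ofReal_re, Complex.ofReal_im, Complex.sub_re,
        Complex.sub_im, Complex.I_re, Complex.I_im, Complex.mul_im]
      field_simp
      ring
  · have : bx z = 2 * (star z * z⁻¹).re / zS z := by
      rw [hbx]
      field_simp
    have hS2 : zS z ^ 2 = (‖z⁻¹‖ ^ 2 - ‖z‖ ^ 2) ^ 2 + 4 := by
      rw [zS]
      linear_combination 4 * hm
    rw [this]
    generalize (star z * z⁻¹).re = R at *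
    generalize (star z * z⁻¹).im = J at *
    generalize ‖z⁻¹‖ ^ 2 - ‖z‖ ^ 2 = D at *
    generalize zS z = S at *
    field_simp
    linear_combination 4 * hun - hS2
  · refine div_nonneg (sub_nonneg.2 ?_) hS.le
    have : ‖z‖ ^ 2 ≤ 1 := pow_le_one₀ hzn.le h1
    nlinarith [sq_nonneg ‖z⁻¹‖]
  · rw [div_lt_one hS, zS]
    nlinarith [pow_pos hzn 2]

theorem exists_of_sphere {a b c : ℝ} (h : a ^ 2 + b ^ 2 + c ^ 2 = 1) (h0 : 0 ≤ c) (h1 : c < 1) :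
    ∃ z : ℂ, z ≠ 0 ∧ ‖z‖ ≤ 1 ∧ IsBloch z a b c ∧ bx z = a := by
  obtain ⟨z, hz⟩ := IsAlgClosed.exists_pow_nat_eq
    (((1 + c : ℝ) : ℂ)⁻¹ * (a + b * Complex.I)) (n := 2) two_pos
  have hc : 0 < 1 + c := by linarith
  have hsq : (‖z‖ ^ 2) ^ 2 = (1 - c) / (1 + c) := by
    rw [← norm_pow, hz, norm_mul, mul_pow, norm_inv, Complex.norm_real, Real.norm_eq_abs,
      abs_of_pos hc, ← Complex.normSq_eq_norm_sq, Complex.normSq_add_mul_I]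
    field_simp
    linear_combination h
  have hz0 : z ≠ 0 := by
    rintro rfl
    rw [norm_zero] at hsq
    have : 0 < (1 - c) / (1 + c) := div_pos (by linarith) hc
    rw [← hsq] at this
    norm_num at this
  have hzn : 0 < ‖z‖ := norm_pos_iff.2 hz0
  have hr2 : 0 < ‖z‖ ^ 2 := pow_pos hzn 2
  have hinv : ‖z⁻¹‖ ^ 2 = (‖z‖ ^ 2)⁻¹ := by rw [norm_inv, inv_pow]
  have hsq' : (‖z‖ ^ 2) ^ 2 * (1 + c) = 1 - c := by
    rw [hsq]
    field_simp
  have hS : zS z / 2 * (1 + c) = ‖z⁻¹‖ ^ 2 := by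
    rw [zS, hinv]
    generalize ‖z‖ ^ 2 = r at *
    field_simp
    linear_combination hsq'
  have hb : IsBloch z a b c := by
    refine ⟨?_, hS.symm, ?_⟩
    · rw [zS] at hS ⊢
      linear_combination hS
    · have e1 : star z * z⁻¹ = star (z ^ 2) * ((‖z⁻¹‖ ^ 2 : ℝ) : ℂ) := by
        rw [hinv, Complex.inv_def, Complex.normSq_eq_norm_sq, star_pow, Complex.star_def]
        ring
      rw [e1, hz, ← hS]
      have : ((1 + c : ℝ) : ℂ) ≠ 0 := Complex.ofReal_ne_zero.2 hc.ne'
      simp only [star_mul', star_add, Complex.star_def, map_inv₀, Complex.conj_ofReal,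
        Complex.conj_I]
      rw [Complex.ofReal_mul]
      field_simp
      ring
  refine ⟨z, hz0, ?_, hb, ?_⟩
  · have : (‖z‖ ^ 2) ^ 2 ≤ 1 := by
      rw [hsq, div_le_one hc]
      linarith
    rw [← pow_mul] at this
    exact (pow_le_one_iff_of_nonneg hzn.le (by norm_num)).1 this
  · have e := bx_mul_zS hz0
    rw [hb.phase] at e
    apply mul_right_cancel₀ (zS_pos hz0).ne'
    rw [← e]
    simp
    ring

/-- The one-party protocol in Bloch coordinates: the first party can turn `g₁` into `h₁` when
`g₁ a = h₁ a'`, `g₁ b = d h₁ b'` and `c = d c'` for some `d ∈ [-1, 1]`; here `(1 ± d) / 2` are the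
(rescaled) weights of the two outcomes. -/
theorem reaches_of_isBloch {g h : Fin 3 → ℝ} {z z' : ℂ} (hg : IsParam g z) (hh : IsParam h z')
    (h1 : h 1 = g 1) (h2 : h 2 = g 2) {a b c a' b' c' d : ℝ} (hz : IsBloch z a b c)
    (hz' : IsBloch z' a' b' c') (hd : |d| ≤ 1) (ea : g 0 * a = h 0 * a')
    (eb : g 0 * b = h 0 * (d * b')) (ec : c = d * c') : Reaches (Ψ g z) (Ψ h z') := by
  have hS := zS_pos hg.2.1
  have hS' := zS_pos hh.2.1
  obtain ⟨hd1, hd2⟩ := abs_le.1 hd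
  refine reaches_of_mix hg hh h1 h2 (p := zS z / zS z' * ((1 + d) / 2))
    (q := zS z / zS z' * ((1 - d) / 2)) (mul_nonneg (div_pos hS hS').le (by linarith))
    (mul_nonneg (div_pos hS hS').le (by linarith)) ?_ ?_ ?_
  · rw [hz.norm_sq, hz'.norm_sq, hz'.norm_inv_sq, ec]
    field_simp
    ring
  · rw [hz.norm_inv_sq, hz'.norm_sq, hz'.norm_inv_sq, ec]
    field_simp
    ring
  · rw [hz.phase, hz'.phase]
    have eaC : (g 0 : ℂ) * a = h 0 * a' := by exact_mod_cast ea
    have ebC : (g 0 : ℂ) * b = h 0 * (d * b') := by exact_mod_cast eb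
    have hS'C : (zS z' : ℂ) ≠ 0 := Complex.ofReal_ne_zero.2 hS'.ne'
    simp only [star_mul', star_sub, Complex.star_def, Complex.conj_ofReal, Complex.conj_I]
    push_cast
    field_simp
    linear_combination (zS z : ℂ) * 2 * eaC - (zS z : ℂ) * 2 * Complex.I * ebC

/-! ### Cyclic relabelling of the parties -/

theorem rot_Pz_ghz (z : ℂ) : rot (applyA (Pz z) ghz) = applyA (Pz z) ghz := by
  funext j k i
  fin_cases i <;> fin_cases j <;> fin_cases k <;> simp [rot, ghz, applyA, Pz]

theorem normSq_rot {a b c : ℕ} (ψ : Ket a b c) : normSq (rot ψ) = normSq ψ := by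
  simp only [normSq, rot]
  rw [Finset.sum_comm]
  conv_rhs => rw [Finset.sum_comm]
  rw [Finset.sum_comm]
  refine Finset.sum_congr rfl fun i _ => ?_
  rw [Finset.sum_comm]

theorem rot_ghzVector (g : Fin 3 → ℝ) (z : ℂ) :
    rot (ghzVector g z) = ghzVector ![g 1, g 2, g 0] z := by
  rw [ghzVector, ← applyABC_rot, rot_Pz_ghz]
  rfl

theorem rot_Ψ (g : Fin 3 → ℝ) (z : ℂ) : rot (Ψ g z) = Ψ ![g 1, g 2, g 0] z := by
  rw [Ψ, Ψ, ← rot_ghzVector, normSq_rot, rot_smul]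

theorem isParam_cons {x₀ x₁ x₂ : ℝ} {z : ℂ} :
    IsParam ![x₀, x₁, x₂] z ↔ ((0 ≤ x₀ ∧ x₀ < 1 / 2) ∧ (0 ≤ x₁ ∧ x₁ < 1 / 2) ∧
      (0 ≤ x₂ ∧ x₂ < 1 / 2)) ∧ z ≠ 0 ∧ ‖z‖ ≤ 1 := by
  simp [IsParam, Fin.forall_fin_succ]

theorem cons_eta (g : Fin 3 → ℝ) : ![g 0, g 1, g 2] = g := by
  funext i
  fin_cases i <;> rfl

theorem reaches_rot {x₀ x₁ x₂ y₀ y₁ y₂ : ℝ} {z z' : ℂ}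
    (h : Reaches (Ψ ![x₀, x₁, x₂] z) (Ψ ![y₀, y₁, y₂] z')) :
    Reaches (Ψ ![x₁, x₂, x₀] z) (Ψ ![y₁, y₂, y₀] z') := by
  have := LOCC.rot h
  rwa [rot_Ψ, rot_Ψ] at this

/-! ### Accessible and source states -/

/-- The first party can increase `g₁`. -/
theorem exists_reaches_first {x₀ x₁ x₂ h₀ : ℝ} {z : ℂ} (hp : IsParam ![x₀, x₁, x₂] z)
    (hx : 0 < x₀) (hle : x₀ ≤ h₀) (hlt : h₀ < 1 / 2) (hb : |bx z| < 1) :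
    ∃ z', z' ≠ 0 ∧ ‖z'‖ ≤ 1 ∧ |bx z'| < 1 ∧
      Reaches (Ψ ![x₀, x₁, x₂] z) (Ψ ![h₀, x₁, x₂] z') := by
  obtain ⟨b, c, hB, hs, hc0, hc1⟩ := exists_isBloch hp.2.1 hp.2.2
  set a := bx z
  have hh : 0 < h₀ := hx.trans_le hle
  obtain ⟨t, ht⟩ : ∃ t, t = x₀ / h₀ := ⟨_, rfl⟩
  have ht0 : 0 < t := ht ▸ div_pos hx hh
  have ht1 : t ≤ 1 := ht ▸ (div_le_one hh).2 hle
  have hth : t * h₀ = x₀ := by rw [ht, div_mul_cancel₀ _ hh.ne']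
  have ha2 : a ^ 2 < 1 := (sq_lt_one_iff_abs_lt_one a).2 hb
  have ht2 : t ^ 2 ≤ 1 := pow_le_one₀ ht0.le ht1
  have hta : t ^ 2 * a ^ 2 < 1 := by nlinarith [sq_nonneg a]
  have hnum : 0 < t ^ 2 * b ^ 2 + c ^ 2 := by
    rcases (sq_nonneg b).eq_or_lt with h0 | h0
    · nlinarith
    · nlinarith [mul_pos (pow_pos ht0 2) h0, sq_nonneg c]
  have hden : 0 < 1 - t ^ 2 * a ^ 2 := by linarith
  obtain ⟨d, hd⟩ : ∃ d, d = √((t ^ 2 * b ^ 2 + c ^ 2) / (1 - t ^ 2 * a ^ 2)) := ⟨_, rfl⟩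
  have hd0 : 0 < d := hd ▸ Real.sqrt_pos.2 (div_pos hnum hden)
  have hd2 : d ^ 2 * (1 - t ^ 2 * a ^ 2) = t ^ 2 * b ^ 2 + c ^ 2 := by
    rw [hd, Real.sq_sqrt (div_pos hnum hden).le, div_mul_cancel₀ _ hden.ne']
  have hd1 : d ≤ 1 := by
    rw [hd]
    refine Real.sqrt_le_one.2 ((div_le_one hden).2 ?_)
    nlinarith [sq_nonneg a, sq_nonneg b]
  have hsph : (t * a) ^ 2 + (t * b / d) ^ 2 + (c / d) ^ 2 = 1 := by
    field_simp
    linear_combination -hd2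
  have hcd : 0 ≤ c / d := div_nonneg hc0 hd0.le
  have hab : 0 < a ^ 2 + b ^ 2 := by nlinarith
  have hcd1 : c / d < 1 := by
    by_contra! hge
    have h1 : 1 ≤ (c / d) ^ 2 := one_le_pow₀ hge
    have h2 : (t * a) ^ 2 = 0 := by nlinarith [sq_nonneg (t * a), sq_nonneg (t * b / d)]
    have h3 : (t * b / d) ^ 2 = 0 := by nlinarith [sq_nonneg (t * a), sq_nonneg (t * b / d)]
    have h4 : a = 0 := by
      have := pow_eq_zero_iff two_ne_zero |>.1 h2
      exact (mul_eq_zero.1 this).resolve_left ht0.ne'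
    have h5 : b = 0 := by
      have := pow_eq_zero_iff two_ne_zero |>.1 h3
      rw [div_eq_zero_iff] at this
      exact (mul_eq_zero.1 (this.resolve_right hd0.ne')).resolve_left ht0.ne'
    rw [h4, h5] at hab
    norm_num at hab
  obtain ⟨z', hz0, hz1, hB', hbx⟩ := exists_of_sphere hsph hcd hcd1
  have hp' := isParam_cons.1 hp
  refine ⟨z', hz0, hz1, ?_, ?_⟩
  · rw [hbx, ← sq_lt_one_iff_abs_lt_one, mul_pow]
    exact hta
  · refine reaches_of_isBloch hp (isParam_cons.2 ⟨⟨⟨hh.le, hlt⟩, hp'.1.2⟩, hz0, hz1⟩) rfl rfl hB hB'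
      (d := d) (by rw [abs_of_pos hd0]; exact hd1) ?_ ?_ ?_
    · simp only [Matrix.cons_val_zero]
      rw [← hth]
      ring
    · simp only [Matrix.cons_val_zero]
      rw [← hth]
      field_simp
    · field_simp

/-- From a state with all `g_i ≠ 0` and `f_z < 1`, all larger values of the `g_i` are accessible. -/
theorem exists_reaches_of_le {g h : Fin 3 → ℝ} {z : ℂ} (hp : IsParam g z) (hg : ∀ i, 0 < g i)
    (hle : ∀ i, g i ≤ h i) (hlt : ∀ i, h i < 1 / 2) (hb : |bx z| < 1) :
    ∃ z', IsParam h z' ∧ Reaches (Ψ g z) (Ψ h z') := by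
  have n : ∀ i, 0 ≤ h i := fun i => (hg i).le.trans (hle i)
  rw [← cons_eta g] at hp ⊢
  have hp' := isParam_cons.1 hp
  obtain ⟨z₁, hz₁, hn₁, hb₁, r₁⟩ := exists_reaches_first hp (hg 0) (hle 0) (hlt 0) hb
  obtain ⟨z₂, hz₂, hn₂, hb₂, r₂⟩ := exists_reaches_first
    (isParam_cons.2 ⟨⟨hp'.1.2.1, hp'.1.2.2, ⟨n 0, hlt 0⟩⟩, hz₁, hn₁⟩) (hg 1) (hle 1) (hlt 1) hb₁
  obtain ⟨z₃, hz₃, hn₃, hb₃, r₃⟩ := exists_reaches_first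
    (isParam_cons.2 ⟨⟨hp'.1.2.2, ⟨n 0, hlt 0⟩, ⟨n 1, hlt 1⟩⟩, hz₂, hn₂⟩) (hg 2) (hle 2) (hlt 2) hb₂
  refine ⟨z₃, ⟨fun i => ⟨n i, hlt i⟩, hz₃, hn₃⟩, ?_⟩
  rw [← cons_eta h]
  exact r₁.trans ((reaches_rot (reaches_rot r₂)).trans (reaches_rot r₃))

/-- A state is reached from one with a smaller `g₁`, as long as `f_z` stays at most `1`. -/
theorem exists_reaches_to_first {x₀ x₁ x₂ h₀ : ℝ} {z : ℂ} (hp : IsParam ![x₀, x₁, x₂] z)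
    (hh : 0 < h₀) (hle : h₀ ≤ x₀) (hb : x₀ * |bx z| ≤ h₀) :
    ∃ z', z' ≠ 0 ∧ ‖z'‖ ≤ 1 ∧ h₀ * |bx z'| = x₀ * |bx z| ∧
      Reaches (Ψ ![h₀, x₁, x₂] z') (Ψ ![x₀, x₁, x₂] z) := by
  obtain ⟨b, c, hB, hs, hc0, hc1⟩ := exists_isBloch hp.2.1 hp.2.2
  have hba := abs_bx_le_one z
  set a := bx z
  have hx : 0 < x₀ := hh.trans_le hle
  have hp' := isParam_cons.1 hp
  obtain ⟨t, ht⟩ : ∃ t, t = h₀ / x₀ := ⟨_, rfl⟩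
  have ht0 : 0 < t := ht ▸ div_pos hh hx
  have ht1 : t ≤ 1 := ht ▸ (div_le_one hx).2 hle
  have hth : t * x₀ = h₀ := by rw [ht, div_mul_cancel₀ _ hx.ne']
  have hat : |a| ≤ t := by
    rw [ht, le_div_iff₀ hx]
    linarith
  rcases hba.eq_or_lt with h1 | h1
  · -- here `f_z = 1` and so `h₀ = x₀`
    have : h₀ = x₀ := by
      rw [h1, mul_one] at hb
      exact le_antisymm hle hb
    rw [this]
    exact ⟨z, hp.2.1, hp.2.2, rfl, .refl _⟩
  have ha2 : a ^ 2 < 1 := (sq_lt_one_iff_abs_lt_one a).2 h1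
  have hat2 : a ^ 2 ≤ t ^ 2 := sq_le_sq.2 (by rwa [abs_of_pos ht0])
  have ht2 : t ^ 2 ≤ 1 := pow_le_one₀ ht0.le ht1
  have hden : 0 < b ^ 2 + t ^ 2 * c ^ 2 := by
    rcases (sq_nonneg b).eq_or_lt with h0 | h0
    · have : 0 < c ^ 2 := by nlinarith
      nlinarith [mul_pos (pow_pos ht0 2) this]
    · nlinarith [mul_nonneg (sq_nonneg t) (sq_nonneg c)]
  obtain ⟨d, hd⟩ : ∃ d, d = √((t ^ 2 - a ^ 2) / (b ^ 2 + t ^ 2 * c ^ 2)) := ⟨_, rfl⟩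
  have hd0 : 0 ≤ d := hd ▸ Real.sqrt_nonneg _
  have hd2 : d ^ 2 * (b ^ 2 + t ^ 2 * c ^ 2) = t ^ 2 - a ^ 2 := by
    rw [hd, Real.sq_sqrt (div_nonneg (by linarith) hden.le), div_mul_cancel₀ _ hden.ne']
  have hd1 : d ≤ 1 := by
    rw [hd]
    refine Real.sqrt_le_one.2 ((div_le_one hden).2 ?_)
    nlinarith [sq_nonneg a, sq_nonneg b]
  have hsph : (a / t) ^ 2 + (d * b / t) ^ 2 + (d * c) ^ 2 = 1 := by
    field_simp
    linear_combination hd2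
  have hcd : 0 ≤ d * c := mul_nonneg hd0 hc0
  have hcd1 : d * c < 1 := (mul_le_of_le_one_left hc0 hd1).trans_lt hc1
  obtain ⟨z', hz0, hz1, hB', hbx⟩ := exists_of_sphere hsph hcd hcd1
  refine ⟨z', hz0, hz1, ?_, ?_⟩
  · rw [hbx, abs_div, abs_of_pos ht0, ← hth]
    field_simp
  · refine reaches_of_isBloch
      (isParam_cons.2 ⟨⟨⟨hh.le, hle.trans_lt hp'.1.1.2⟩, hp'.1.2⟩, hz0, hz1⟩) hp rfl rfl hB' hB
      (d := d) (by rwa [abs_of_nonneg hd0]) ?_ ?_ rfl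
    · simp only [Matrix.cons_val_zero]
      rw [← hth]
      field_simp
    · simp only [Matrix.cons_val_zero]
      rw [← hth]
      field_simp

/-- A state is reached from states with any smaller nonzero values of the `g_i`, as long as their
product is at least `f_z g₁ g₂ g₃`. -/
theorem exists_reaches_to_of_le {g h : Fin 3 → ℝ} {z : ℂ} (hp : IsParam g z) (hh : ∀ i, 0 < h i)
    (hle : ∀ i, h i ≤ g i) (hb : g 0 * g 1 * g 2 * |bx z| ≤ h 0 * h 1 * h 2) :
    ∃ z', IsParam h z' ∧ Reaches (Ψ h z') (Ψ g z) := by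
  have hlt : ∀ i, h i < 1 / 2 := fun i => (hle i).trans_lt (hp.1 i).2
  have hg : ∀ i, 0 < g i := fun i => (hh i).trans_le (hle i)
  rw [← cons_eta g] at hp ⊢
  have hp' := isParam_cons.1 hp
  have k0 : g 0 * |bx z| ≤ h 0 := by
    have h12 : h 1 * h 2 ≤ g 1 * g 2 := mul_le_mul (hle 1) (hle 2) (hh 2).le (hg 1).le
    have : (g 1 * g 2) * (g 0 * |bx z|) ≤ (g 1 * g 2) * h 0 := by nlinarith [hh 0]
    exact le_of_mul_le_mul_left this (mul_pos (hg 1) (hg 2))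
  obtain ⟨z₁, hz₁, hn₁, hb₁, r₁⟩ := exists_reaches_to_first hp (hh 0) (hle 0) k0
  have k1 : g 1 * |bx z₁| ≤ h 1 := by
    have : (h 0 * g 2) * (g 1 * |bx z₁|) ≤ (h 0 * g 2) * h 1 := by
      calc (h 0 * g 2) * (g 1 * |bx z₁|) = g 0 * g 1 * g 2 * |bx z| := by
            linear_combination (g 1 * g 2) * hb₁
        _ ≤ h 0 * h 1 * h 2 := hb
        _ ≤ h 0 * h 1 * g 2 := mul_le_mul_of_nonneg_left (hle 2) (mul_pos (hh 0) (hh 1)).le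
        _ = _ := by ring
    exact le_of_mul_le_mul_left this (mul_pos (hh 0) (hg 2))
  obtain ⟨z₂, hz₂, hn₂, hb₂, r₂⟩ := exists_reaches_to_first
    (isParam_cons.2 ⟨⟨hp'.1.2.1, hp'.1.2.2, ⟨(hh 0).le, hlt 0⟩⟩, hz₁, hn₁⟩) (hh 1) (hle 1) k1
  have k2 : g 2 * |bx z₂| ≤ h 2 := by
    have : (h 0 * h 1) * (g 2 * |bx z₂|) ≤ (h 0 * h 1) * h 2 := by
      calc (h 0 * h 1) * (g 2 * |bx z₂|) = g 0 * g 1 * g 2 * |bx z| := by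
            linear_combination (g 1 * g 2) * hb₁ + (h 0 * g 2) * hb₂
        _ ≤ _ := hb
    exact le_of_mul_le_mul_left this (mul_pos (hh 0) (hh 1))
  obtain ⟨z₃, hz₃, hn₃, hb₃, r₃⟩ := exists_reaches_to_first
    (isParam_cons.2 ⟨⟨hp'.1.2.2, ⟨(hh 0).le, hlt 0⟩, ⟨(hh 1).le, hlt 1⟩⟩, hz₂, hn₂⟩) (hh 2) (hle 2)
    k2
  refine ⟨z₃, ⟨fun i => ⟨(hh i).le, hlt i⟩, hz₃, hn₃⟩, ?_⟩
  rw [← cons_eta h]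
  exact (reaches_rot r₃).trans ((reaches_rot (reaches_rot r₂)).trans r₁)

/-! ### The states `Φ` -/

theorem isBloch_one : IsBloch 1 1 0 0 := by
  constructor <;> simp [zS]

theorem isBloch_I : IsBloch Complex.I (-1) 0 0 := by
  constructor <;> simp [zS]

theorem fz_nonneg (z : ℂ) : 0 ≤ fz z := by
  rw [fz_eq_abs_bx]
  exact abs_nonneg _

theorem fz_le_one (z : ℂ) : fz z ≤ 1 := by
  rw [fz_eq_abs_bx]
  exact abs_bx_le_one z

theorem isParam_Φ {g : Fin 3 → ℝ} {z : ℂ} (hp : IsParam g z) :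
    IsParam ![g 0, g 1, fz z * g 2] (if 0 < (z ^ 2).re then 1 else Complex.I) := by
  have h2 := hp.1 2
  refine isParam_cons.2 ⟨⟨hp.1 0, hp.1 1, mul_nonneg (fz_nonneg z) h2.1, ?_⟩, ?_, ?_⟩
  · exact (mul_le_of_le_one_left h2.1 (fz_le_one z)).trans_lt h2.2
  · split_ifs <;> simp
  · split_ifs <;> simp

theorem bx_pos_iff {z : ℂ} : 0 < bx z ↔ 0 < (z ^ 2).re := by
  have h : 0 < 1 + ‖z‖ ^ 4 := by positivity
  rw [bx, div_pos_iff_of_pos_right h, mul_pos_iff_of_pos_left two_pos]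

theorem bx_neg_iff {z : ℂ} : bx z < 0 ↔ (z ^ 2).re < 0 := by
  have h : 0 < 1 + ‖z‖ ^ 4 := by positivity
  rw [bx, div_lt_iff₀ h, zero_mul]
  constructor <;> intro <;> linarith

/-- The last party turns `Φ` into `Ψ(g, z)`, with two equiprobable outcomes. -/
theorem reaches_Φ {g : Fin 3 → ℝ} {z : ℂ} (hp : IsParam g z) : Reaches (Φ g z) (Ψ g z) := by
  obtain ⟨b, c, hB, -⟩ := exists_isBloch hp.2.1 hp.2.2
  have hpΦ := isParam_cons.1 (isParam_Φ hp)
  have hp' : IsParam ![g 2, g 0, g 1] z := isParam_cons.2 ⟨⟨hp.1 2, hp.1 0, hp.1 1⟩, hp.2⟩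
  have r : Reaches (Ψ ![fz z * g 2, g 0, g 1] (if 0 < (z ^ 2).re then 1 else Complex.I))
      (Ψ ![g 2, g 0, g 1] z) := by
    by_cases h : 0 < (z ^ 2).re
    · refine reaches_of_isBloch
        (isParam_cons.2 ⟨⟨hpΦ.1.2.2, hpΦ.1.1, hpΦ.1.2.1⟩, hpΦ.2⟩) hp' rfl rfl
        (by rw [if_pos h]; exact isBloch_one) hB (d := 0) (by simp) ?_ (by simp) (by simp)
      rw [fz_eq_abs_bx, abs_of_pos (bx_pos_iff.2 h)]
      simp [mul_comm]
    · refine reaches_of_isBloch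
        (isParam_cons.2 ⟨⟨hpΦ.1.2.2, hpΦ.1.1, hpΦ.1.2.1⟩, hpΦ.2⟩) hp' rfl rfl
        (by rw [if_neg h]; exact isBloch_I) hB (d := 0) (by simp) ?_ (by simp) (by simp)
      rw [fz_eq_abs_bx, abs_of_nonpos (not_lt.1 (mt bx_pos_iff.1 h))]
      simp [mul_comm]
  have := reaches_rot r
  rwa [cons_eta] at this

theorem inMES_Φ {g : Fin 3 → ℝ} {z : ℂ} (hp : IsParam g z) (hg : ∀ i, g i ≠ 0)
    (hz : (z ^ 2).re ≠ 0) : InMES (Φ g z) := by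
  have hf : fz z ≠ 0 := by
    have h : 0 < 1 + ‖z‖ ^ 4 := by positivity
    rw [fz]
    exact div_ne_zero (mul_ne_zero two_ne_zero (abs_ne_zero.2 hz)) h.ne'
  refine inMES_of_sq (isParam_Φ hp) ?_ ?_
  · simp [Fin.forall_fin_succ, hg, hf]
  · split_ifs
    · simp
    · simp

/-- `f_z = 1` only for `z² = ±1`, so `f_z < 1` for generic states. -/
theorem Generic.abs_bx_lt_one {g : Fin 3 → ℝ} {z : ℂ} (h : Generic g z) : |bx z| < 1 := by
  refine lt_of_le_of_ne (abs_bx_le_one z) fun h1 => h.2.2 (inMES_of_sq h.1 h.2.1 ?_)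
  rw [← fz_eq_abs_bx, fz, div_eq_one_iff_eq (by positivity)] at h1
  have hre : |(z ^ 2).re| ≤ ‖z‖ ^ 2 := (Complex.abs_re_le_norm _).trans (norm_pow z 2).le
  have hn : ‖z‖ ^ 2 = 1 := by nlinarith [sq_nonneg (‖z‖ ^ 2 - 1)]
  have hr : |(z ^ 2).re| = 1 := by
    have : ‖z‖ ^ 4 = 1 := by
      rw [show ‖z‖ ^ 4 = (‖z‖ ^ 2) ^ 2 by ring, hn, one_pow]
    linarith
  have hns := Complex.normSq_apply (z ^ 2)
  rw [Complex.normSq_eq_norm_sq, norm_pow, hn, ← abs_mul_abs_self (z ^ 2).re, hr] at hns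
  have him : (z ^ 2).im = 0 := by
    apply mul_self_eq_zero.1
    linarith
  rcases eq_or_eq_neg_of_abs_eq hr with e | e
  · left
    exact Complex.ext (by simpa using e) (by simpa using him)
  · right
    exact Complex.ext (by simpa using e) (by simpa using him)

/-! ### Accessible and source volumes -/

theorem Generic.pos {g : Fin 3 → ℝ} {z : ℂ} (h : Generic g z) (i : Fin 3) : 0 < g i :=
  lt_of_le_of_ne (h.1.1 i).1 (h.2.1 i).symm

theorem fst_image_accessibleSet {g : Fin 3 → ℝ} {z : ℂ} (h : Generic g z) :
    Prod.fst '' accessibleSet (Ψ g z) = Set.pi Set.univ fun i => Set.Ico (g i) (1 / 2) := by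
  ext x
  constructor
  · rintro ⟨⟨x, z'⟩, ⟨hp, hr⟩, rfl⟩ i -
    exact ⟨(reaches_necessary h.1 hp hr).1 i, (hp.1 i).2⟩
  · intro hx
    obtain ⟨z', hp, hr⟩ := exists_reaches_of_le h.1 h.pos (fun i => (hx i trivial).1)
      (fun i => (hx i trivial).2) h.abs_bx_lt_one
    exact ⟨(x, z'), ⟨hp, hr⟩, rfl⟩

theorem accessibleVolume_eq {g : Fin 3 → ℝ} {z : ℂ} (h : Generic g z) :
    accessibleVolume (Ψ g z) = (1 / 2 - g 0) * (1 / 2 - g 1) * (1 / 2 - g 2) := by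
  rw [accessibleVolume, fst_image_accessibleSet h,
    Real.volume_pi_Ico_toReal fun i => (h.1.1 i).2.le, Fin.prod_univ_three]

/-- The part of the unit cube on which the product of the coordinates is at least `f`. -/
def cubeRegion (f : ℝ) : Set (Fin 3 → ℝ) :=
  {u | (∀ i, 0 ≤ u i ∧ u i ≤ 1) ∧ f ≤ u 0 * u 1 * u 2}

/-- The volume of `cubeRegion f`. -/
def cubeVolume (f : ℝ) : ℝ := (volume (cubeRegion f)).toReal

theorem volume_cubeRegion_ne_top (f : ℝ) : volume (cubeRegion f) ≠ ⊤ := by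
  refine ne_top_of_le_ne_top (b := volume (Set.Icc (0 : Fin 3 → ℝ) 1)) ?_ (measure_mono ?_)
  · rw [Real.volume_Icc_pi]
    simp
  · intro u hu
    exact ⟨fun i => (hu.1 i).1, fun i => (hu.1 i).2⟩

theorem cubeVolume_strictAnti {f₁ f₂ : ℝ} (h0 : 0 ≤ f₁) (h : f₁ < f₂) (h1 : f₂ ≤ 1) :
    cubeVolume f₂ < cubeVolume f₁ := by
  set V : Set (Fin 3 → ℝ) :=
    {u | (∀ i, 0 < u i ∧ u i < 1) ∧ f₁ < u 0 * u 1 * u 2 ∧ u 0 * u 1 * u 2 < f₂} with hV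
  have hopen : IsOpen V := by
    have hc : Continuous fun u : Fin 3 → ℝ => u 0 * u 1 * u 2 := by fun_prop
    have e : V = (⋂ i, {u | 0 < u i} ∩ {u | u i < 1}) ∩
        ({u | f₁ < u 0 * u 1 * u 2} ∩ {u | u 0 * u 1 * u 2 < f₂}) := by
      ext u
      simp [hV]
    rw [e]
    refine (isOpen_iInter_of_finite fun i => ?_).inter
      ((isOpen_lt continuous_const hc).inter (isOpen_lt hc continuous_const))
    exact (isOpen_lt continuous_const (continuous_apply i)).inter
      (isOpen_lt (continuous_apply i) continuous_const)
  have hne : V.Nonempty := by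
    -- a point on the diagonal, with product strictly between `f₁` and `f₂`
    obtain ⟨m, hm1, hm2⟩ := exists_between h
    have hm0 : 0 < m := h0.trans_lt hm1
    have hs : (m ^ ((3 : ℕ) : ℝ)⁻¹) ^ 3 = m := Real.rpow_inv_natCast_pow hm0.le (by norm_num)
    have hs0 : 0 < m ^ ((3 : ℕ) : ℝ)⁻¹ := Real.rpow_pos_of_pos hm0 _
    generalize m ^ ((3 : ℕ) : ℝ)⁻¹ = s at hs hs0
    have hs1 : s < 1 := by
      by_contra! hge
      have := one_le_pow₀ hge (n := 3)
      linarith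
    have e : s * s * s = m := by rw [← hs]; ring
    exact ⟨fun _ => s, fun _ => ⟨hs0, hs1⟩, by rwa [e], by rwa [e]⟩
  have hpos := hopen.measure_pos volume hne
  have hdisj : Disjoint (cubeRegion f₂) V :=
    Set.disjoint_left.2 fun u hu hu' => absurd hu.2 (not_le.2 hu'.2.2)
  have hsub : cubeRegion f₂ ∪ V ⊆ cubeRegion f₁ := by
    rintro u (hu | hu)
    · exact ⟨hu.1, h.le.trans hu.2⟩
    · exact ⟨fun i => ⟨(hu.1 i).1.le, (hu.1 i).2.le⟩, hu.2.1.le⟩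
  refine (ENNReal.toReal_lt_toReal (volume_cubeRegion_ne_top _) (volume_cubeRegion_ne_top _)).2 ?_
  calc volume (cubeRegion f₂) < volume (cubeRegion f₂) + volume V :=
        ENNReal.lt_add_right (volume_cubeRegion_ne_top _) hpos.ne'
    _ = volume (cubeRegion f₂ ∪ V) := (measure_union hdisj hopen.measurableSet).symm
    _ ≤ volume (cubeRegion f₁) := measure_mono hsub

theorem cubeVolume_pos {f : ℝ} (h0 : 0 ≤ f) (h1 : f < 1) : 0 < cubeVolume f :=
  ENNReal.toReal_nonneg.trans_lt (cubeVolume_strictAnti h0 h1 le_rfl)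

theorem cubeVolume_injOn {f₁ f₂ : ℝ} (h₁ : 0 ≤ f₁) (h₁' : f₁ ≤ 1) (h₂ : 0 ≤ f₂) (h₂' : f₂ ≤ 1)
    (h : cubeVolume f₁ = cubeVolume f₂) : f₁ = f₂ := by
  rcases lt_trichotomy f₁ f₂ with h' | h' | h'
  · exact absurd h (cubeVolume_strictAnti h₁ h' h₂').ne'
  · exact h'
  · exact absurd h (cubeVolume_strictAnti h₂ h' h₁').ne

/-- The cube region stretched by `g`, which is the region of source states up to a null set. -/
def sourceRegion (g : Fin 3 → ℝ) (f : ℝ) : Set (Fin 3 → ℝ) :=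
  {h | (∀ i, 0 ≤ h i ∧ h i ≤ g i) ∧ g 0 * g 1 * g 2 * f ≤ h 0 * h 1 * h 2}

theorem volume_sourceRegion {g : Fin 3 → ℝ} (hg : ∀ i, 0 < g i) (f : ℝ) :
    (volume (sourceRegion g f)).toReal = g 0 * g 1 * g 2 * cubeVolume f := by
  have hdet : (Matrix.diagonal fun i => (g i)⁻¹).det = (g 0 * g 1 * g 2)⁻¹ := by
    rw [Matrix.det_diagonal, Fin.prod_univ_three, mul_inv, mul_inv]
  have hG : 0 < g 0 * g 1 * g 2 := mul_pos (mul_pos (hg 0) (hg 1)) (hg 2)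
  have key := MeasureTheory.Measure.addHaar_preimage_linearMap (volume : Measure (Fin 3 → ℝ))
    (f := Matrix.toLin' (Matrix.diagonal fun i => (g i)⁻¹))
    (by rw [LinearMap.det_toLin', hdet]; exact inv_ne_zero hG.ne') (cubeRegion f)
  have hpre : (Matrix.toLin' (Matrix.diagonal fun i => (g i)⁻¹)) ⁻¹' cubeRegion f =
      sourceRegion g f := by
    ext h
    have e : ∀ i, (Matrix.toLin' (Matrix.diagonal fun i => (g i)⁻¹)) h i = h i / g i := fun i => by
      rw [Matrix.toLin'_apply, Matrix.mulVec_diagonal, div_eq_inv_mul]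
    simp only [Set.mem_preimage, cubeRegion, sourceRegion, Set.mem_ofPred_eq, e]
    refine and_congr (forall_congr' fun i => and_congr ?_ (div_le_one (hg i))) ?_
    · rw [le_div_iff₀ (hg i), zero_mul]
    · rw [div_mul_div_comm, div_mul_div_comm, le_div_iff₀ hG, mul_comm]
  rw [hpre, LinearMap.det_toLin', hdet, inv_inv, abs_of_pos hG] at key
  rw [key, ENNReal.toReal_mul, ENNReal.toReal_ofReal hG.le, cubeVolume]

theorem sourceVolume_eq {g : Fin 3 → ℝ} {z : ℂ} (h : Generic g z) :
    sourceVolume (Ψ g z) = g 0 * g 1 * g 2 * cubeVolume (fz z) := by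
  rw [← volume_sourceRegion h.pos, sourceVolume]
  congr 1
  refine le_antisymm (measure_mono ?_) ?_
  · rintro x ⟨⟨x, z'⟩, ⟨hp, hr⟩, rfl⟩
    obtain ⟨h1, h2⟩ := reaches_necessary hp h.1 hr
    refine ⟨fun i => ⟨(hp.1 i).1, h1 i⟩, ?_⟩
    have hx : 0 ≤ x 0 * x 1 * x 2 := (prod_lt_of_isParam hp).1
    have hg : 0 ≤ g 0 * g 1 * g 2 := (prod_lt_of_isParam h.1).1
    calc g 0 * g 1 * g 2 * fz z = |g 0 * g 1 * g 2 * bx z| := by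
          rw [abs_mul, abs_of_nonneg hg, fz_eq_abs_bx]
      _ = x 0 * x 1 * x 2 * |bx z'| := by rw [← h2, abs_mul, abs_of_nonneg hx]
      _ ≤ x 0 * x 1 * x 2 := mul_le_of_le_one_right hx (abs_bx_le_one z')
  · -- the points with a vanishing coordinate form a null set
    have hsub : sourceRegion g (fz z) ⊆
        Prod.fst '' sourceSet (Ψ g z) ∪ ⋃ i, (Function.eval i) ⁻¹' {(0 : ℝ)} := by
      intro x hx
      by_cases h0 : ∀ i, x i ≠ 0
      · left
        obtain ⟨z', hp, hr⟩ := exists_reaches_to_of_le h.1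
          (fun i => lt_of_le_of_ne (hx.1 i).1 (h0 i).symm) (fun i => (hx.1 i).2)
          (by rw [← fz_eq_abs_bx]; exact hx.2)
        exact ⟨(x, z'), ⟨hp, hr⟩, rfl⟩
      · right
        push Not at h0
        obtain ⟨i, hi⟩ := h0
        exact Set.mem_iUnion.2 ⟨i, hi⟩
    refine (measure_mono hsub).trans ((measure_union_le _ _).trans ?_)
    have : volume (⋃ i : Fin 3, (Function.eval i) ⁻¹' {(0 : ℝ)} : Set (Fin 3 → ℝ)) = 0 :=
      measure_iUnion_null fun i => Measure.pi_hyperplane (fun _ => volume) i 0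
    rw [this, add_zero]

theorem bddAbove_volumes (A : (Fin 3 → ℝ) → ℂ → Set ((Fin 3 → ℝ) × ℂ))
    (hA : ∀ g z, ∀ p ∈ A g z, IsParam p.1 p.2) :
    BddAbove {v | ∃ g z, Generic g z ∧ v = (volume (Prod.fst '' A g z)).toReal} := by
  refine ⟨(volume (Set.Icc (0 : Fin 3 → ℝ) 1)).toReal, ?_⟩
  rintro v ⟨g, z, -, rfl⟩
  refine ENNReal.toReal_mono (by rw [Real.volume_Icc_pi]; simp) (measure_mono ?_)
  rintro x ⟨p, hp, rfl⟩
  have := (hA g z p hp).1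
  exact ⟨fun i => (this i).1, fun i => (this i).2.le.trans (by norm_num)⟩

theorem accessibleVolumeSup_pos {g : Fin 3 → ℝ} {z : ℂ} (h : Generic g z) :
    0 < accessibleVolumeSup := by
  have h0 : 0 < accessibleVolume (Ψ g z) := by
    rw [accessibleVolume_eq h]
    exact mul_pos (mul_pos (sub_pos.2 (h.1.1 0).2) (sub_pos.2 (h.1.1 1).2))
      (sub_pos.2 (h.1.1 2).2)
  exact h0.trans_le (le_csSup (bddAbove_volumes (fun g z => accessibleSet (Ψ g z))
    fun _ _ _ hp => hp.1) ⟨g, z, h, rfl⟩)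

theorem sourceVolumeSup_pos {g : Fin 3 → ℝ} {z : ℂ} (h : Generic g z) :
    0 < sourceVolumeSup := by
  have h0 : 0 < sourceVolume (Ψ g z) := by
    rw [sourceVolume_eq h]
    refine mul_pos (mul_pos (mul_pos (h.pos 0) (h.pos 1)) (h.pos 2))
      (cubeVolume_pos (fz_nonneg z) ?_)
    rw [fz_eq_abs_bx]
    exact h.abs_bx_lt_one
  exact h0.trans_le (le_csSup (bddAbove_volumes (fun g z => sourceSet (Ψ g z))
    fun _ _ _ hp => hp.1) ⟨g, z, h, rfl⟩)

/-! ### Concurrences -/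

theorem sqConcurrence_one_eq_rot (ψ : Ket 2 2 2) : sqConcurrence 1 ψ = sqConcurrence 0 (rot ψ) := by
  have : reduced ψ 1 = reduced (rot ψ) 0 := by
    ext x y
    simp only [reduced, Matrix.cons_val_zero, Matrix.cons_val_one, Matrix.of_apply, rot]
    rw [Finset.sum_comm]
  rw [sqConcurrence, sqConcurrence, this]

theorem sqConcurrence_two_eq_rot (ψ : Ket 2 2 2) :
    sqConcurrence 2 ψ = sqConcurrence 0 (rot (rot ψ)) := by
  have : reduced ψ 2 = reduced (rot (rot ψ)) 0 := by
    ext x y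
    simp only [reduced, Matrix.cons_val_zero, Matrix.cons_val, Matrix.of_apply, rot]
  rw [sqConcurrence, sqConcurrence, this]

theorem trace_reduced_zero (ψ : Ket 2 2 2) : (reduced ψ 0).trace = (normSq ψ : ℂ) := by
  simp only [reduced, Matrix.cons_val_zero, Matrix.trace, Matrix.diag_apply, Matrix.of_apply,
    normSq, Complex.ofReal_sum]
  refine Finset.sum_congr rfl fun i _ => Finset.sum_congr rfl fun j _ =>
    Finset.sum_congr rfl fun k _ => ?_
  rw [Complex.star_def, Complex.mul_conj']
  norm_cast

/-- For a normalized vector, `2 (1 - tr ρ²) = 4 det ρ`. -/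
theorem sqConcurrence_zero_eq_det {ψ : Ket 2 2 2} (h : normSq ψ = 1) :
    sqConcurrence 0 ψ = 4 * ((reduced ψ 0).det).re := by
  have ht := trace_reduced_zero ψ
  rw [h, Matrix.trace_fin_two] at ht
  have e : (reduced ψ 0 * reduced ψ 0).trace = 1 - 2 * (reduced ψ 0).det := by
    rw [Matrix.det_fin_two, Matrix.trace_fin_two, Matrix.mul_apply, Matrix.mul_apply,
      Fin.sum_univ_two, Fin.sum_univ_two]
    push_cast at ht
    linear_combination (reduced ψ 0 0 0 + reduced ψ 0 1 1 + 1) * ht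
  rw [sqConcurrence, e]
  simp
  ring

/-- The reduced state of a sum of two product vectors has the determinant of the Gram matrix of
the first factors times that of the remaining factors. -/
theorem det_reduced_zero (x₀ x₁ y₀ y₁ w₀ w₁ : Fin 2 → ℂ) :
    (reduced (prodKet x₀ y₀ w₀ + prodKet x₁ y₁ w₁) 0).det =
      det2 x₀ x₁ * star (det2 x₀ x₁) * (ip y₀ y₀ * ip w₀ w₀ * (ip y₁ y₁ * ip w₁ w₁) -
        ip y₀ y₁ * ip w₀ w₁ * (ip y₁ y₀ * ip w₁ w₀)) := by
  have h : reduced (prodKet x₀ y₀ w₀ + prodKet x₁ y₁ w₁) 0 =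
      colMat x₀ x₁ * !![ip y₀ y₀ * ip w₀ w₀, ip y₁ y₀ * ip w₁ w₀;
        ip y₀ y₁ * ip w₀ w₁, ip y₁ y₁ * ip w₁ w₁] * (colMat x₀ x₁)ᴴ := by
    ext i j
    simp [reduced, prodKet, colMat, Matrix.mul_apply, Matrix.conjTranspose_apply, ip, dotProduct,
      Fin.sum_univ_two]
    ring
  rw [h, Matrix.det_mul, Matrix.det_mul, Matrix.det_conjTranspose, det_colMat,
    Matrix.det_fin_two_of]
  ring

/-- The common factor of the three squared concurrences. -/
def concFactor (g : Fin 3 → ℝ) (z : ℂ) : ℝ :=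
  4 / (zS z ^ 2 * (1 + 8 * (g 0 * g 1 * g 2) * bx z) ^ 2)

/-- The factor of a squared concurrence that depends on `g` only, in terms of `s_i = 4 g_i²`. -/
def concShape (s₀ s₁ s₂ : ℝ) : ℝ := (1 - s₀) * (1 - s₁ * s₂)

theorem concFactor_pos {g : Fin 3 → ℝ} {z : ℂ} (h : IsParam g z) : 0 < concFactor g z :=
  div_pos (by norm_num) (mul_pos (pow_pos (zS_pos h.2.1) 2) (pow_pos (one_add_pos h z) 2))

theorem nrm_sq {g : Fin 3 → ℝ} {z : ℂ} (h : IsParam g z) :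
    nrm g z ^ 2 = 16 / (zS z * (1 + 8 * (g 0 * g 1 * g 2) * bx z)) := by
  have h0 := normSq_ghzVector_pos h
  rw [nrm, inv_pow, Real.sq_sqrt h0.le, normSq_ghzVector h]
  have := one_add_pos h z
  have := zS_pos h.2.1
  field_simp

theorem sqConcurrence_zero_Ψ {g : Fin 3 → ℝ} {z : ℂ} (h : IsParam g z) :
    sqConcurrence 0 (Ψ g z) =
      concFactor g z * concShape (4 * g 0 ^ 2) (4 * g 1 ^ 2) (4 * g 2 ^ 2) := by
  rw [sqConcurrence_zero_eq_det (normSq_Ψ h), Ψ_eq, det_reduced_zero, det2_smul_smul, det2_gcol,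
    ip_swap (gcol (g 1) 0) (gcol (g 1) 1), ip_swap (gcol (g 2) 0) (gcol (g 2) 1)]
  simp only [ip_self, nsq_gcol (h.1 _).1 (h.1 _).2, ip_gcol_zero_one (h.1 _).1 (h.1 _).2]
  have e1 : (√(1 / 2 + g 0) * √(1 / 2 - g 0)) ^ 2 = 1 / 4 - g 0 ^ 2 := by
    rw [mul_pow, Real.sq_sqrt (by linarith [(h.1 0).1]), Real.sq_sqrt (by linarith [(h.1 0).2])]
    ring
  have e2 : coef g z z * coef g z z⁻¹ * ((√(1 / 2 + g 0) * √(1 / 2 - g 0) : ℝ) : ℂ) *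
      star (coef g z z * coef g z z⁻¹ * ((√(1 / 2 + g 0) * √(1 / 2 - g 0) : ℝ) : ℂ)) =
      ((nrm g z ^ 4 / 4 * (1 / 4 - g 0 ^ 2) : ℝ) : ℂ) := by
    rw [Complex.star_def, Complex.mul_conj']
    have n1 := norm_coef_sq g z z
    have n2 := norm_coef_sq g z z⁻¹
    have n3 := norm_sq_mul_norm_inv_sq h.2.1
    norm_cast
    rw [norm_mul, norm_mul, Complex.norm_real, mul_pow, mul_pow, n1, n2, Real.norm_eq_abs, sq_abs,
      e1]
    linear_combination (nrm g z ^ 4 / 4 * (1 / 4 - g 0 ^ 2)) * n3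
  rw [e2]
  have e3 : ((1 / 2 : ℝ) : ℂ) * ((1 / 2 : ℝ) : ℂ) * (((1 / 2 : ℝ) : ℂ) * ((1 / 2 : ℝ) : ℂ)) -
      (g 1 : ℂ) * (g 2 : ℂ) * (star (g 1 : ℂ) * star (g 2 : ℂ)) =
      ((1 / 16 - g 1 ^ 2 * g 2 ^ 2 : ℝ) : ℂ) := by
    simp only [Complex.star_def, Complex.conj_ofReal]
    push_cast
    ring
  rw [e3, ← Complex.ofReal_mul, Complex.ofReal_re, show nrm g z ^ 4 = (nrm g z ^ 2) ^ 2 by ring,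
    nrm_sq h, concFactor, concShape]
  have := one_add_pos h z
  have := zS_pos h.2.1
  field_simp
  ring

theorem sqConcurrence_Ψ {g : Fin 3 → ℝ} {z : ℂ} (h : IsParam g z) :
    sqConcurrence 0 (Ψ g z) =
      concFactor g z * concShape (4 * g 0 ^ 2) (4 * g 1 ^ 2) (4 * g 2 ^ 2) ∧
    sqConcurrence 1 (Ψ g z) =
      concFactor g z * concShape (4 * g 1 ^ 2) (4 * g 2 ^ 2) (4 * g 0 ^ 2) ∧
    sqConcurrence 2 (Ψ g z) =
      concFactor g z * concShape (4 * g 2 ^ 2) (4 * g 0 ^ 2) (4 * g 1 ^ 2) := by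
  have h1 : IsParam ![g 1, g 2, g 0] z := isParam_cons.2 ⟨⟨h.1 1, h.1 2, h.1 0⟩, h.2⟩
  have h2 : IsParam ![g 2, g 0, g 1] z := isParam_cons.2 ⟨⟨h.1 2, h.1 0, h.1 1⟩, h.2⟩
  have k1 : concFactor ![g 1, g 2, g 0] z = concFactor g z := by
    simp only [concFactor, Matrix.cons_val_zero, Matrix.cons_val_one, Matrix.cons_val]
    rw [show g 1 * g 2 * g 0 = g 0 * g 1 * g 2 by ring]
  have k2 : concFactor ![g 2, g 0, g 1] z = concFactor g z := by
    simp only [concFactor, Matrix.cons_val_zero, Matrix.cons_val_one, Matrix.cons_val]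
    rw [show g 2 * g 0 * g 1 = g 0 * g 1 * g 2 by ring]
  refine ⟨sqConcurrence_zero_Ψ h, ?_, ?_⟩
  · rw [sqConcurrence_one_eq_rot, rot_Ψ, sqConcurrence_zero_Ψ h1, k1]
    rfl
  · rw [sqConcurrence_two_eq_rot, rot_Ψ, rot_Ψ]
    refine (sqConcurrence_zero_Ψ h2).trans ?_
    rw [k2]
    rfl

/-! ### The parameters are determined by the measures -/

/-- The ratio of the sum of two of the squared concurrences to the third. -/
def concRatio (s₀ s₁ s₂ : ℝ) : ℝ :=
  (concShape s₁ s₂ s₀ + concShape s₂ s₀ s₁) / concShape s₀ s₁ s₂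

theorem mul_lt_one_of_lt {a b : ℝ} (ha : 0 ≤ a ∧ a < 1) (hb : 0 ≤ b ∧ b < 1) : a * b < 1 := by
  nlinarith

theorem concShape_pos {s₀ s₁ s₂ : ℝ} (h₀ : 0 ≤ s₀ ∧ s₀ < 1) (h₁ : 0 ≤ s₁ ∧ s₁ < 1)
    (h₂ : 0 ≤ s₂ ∧ s₂ < 1) : 0 < concShape s₀ s₁ s₂ :=
  mul_pos (by linarith) (by linarith [mul_lt_one_of_lt h₁ h₂])

theorem concRatio_lt_first {s₀ t₀ s₁ s₂ : ℝ} (h₀ : 0 ≤ s₀ ∧ s₀ < 1) (k₀ : 0 ≤ t₀ ∧ t₀ < 1)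
    (h₁ : 0 ≤ s₁ ∧ s₁ < 1) (h₂ : 0 ≤ s₂ ∧ s₂ < 1) (h : s₀ < t₀) :
    concRatio s₀ s₁ s₂ < concRatio t₀ s₁ s₂ := by
  rw [concRatio, concRatio, div_lt_div_iff₀ (concShape_pos h₀ h₁ h₂) (concShape_pos k₀ h₁ h₂)]
  have := mul_pos (mul_pos (sub_pos.2 h) (sub_pos.2 (mul_lt_one_of_lt h₁ h₂)))
    (mul_pos (sub_pos.2 h₁.2) (sub_pos.2 h₂.2))
  simp only [concShape]
  linear_combination 2 * this

theorem concRatio_lt_second {s₀ s₁ t₁ s₂ : ℝ} (h₀ : 0 ≤ s₀ ∧ s₀ < 1) (h₁ : 0 ≤ s₁ ∧ s₁ < 1)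
    (k₁ : 0 ≤ t₁ ∧ t₁ < 1) (h₂ : 0 ≤ s₂ ∧ s₂ < 1) (h : t₁ < s₁) :
    concRatio s₀ s₁ s₂ < concRatio s₀ t₁ s₂ := by
  rw [concRatio, concRatio, div_lt_div_iff₀ (concShape_pos h₀ h₁ h₂) (concShape_pos h₀ k₁ h₂)]
  have := mul_pos (mul_pos (sub_pos.2 h) (sub_pos.2 h₀.2))
    (mul_pos (by linarith : 0 < 1 + s₀) (pow_pos (sub_pos.2 h₂.2) 2))
  simp only [concShape]
  linear_combination this

theorem concRatio_swap (s₀ s₁ s₂ : ℝ) : concRatio s₀ s₁ s₂ = concRatio s₀ s₂ s₁ := by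
  simp only [concRatio, concShape]
  congr 1 <;> ring

theorem concRatio_lt_third {s₀ s₁ s₂ t₂ : ℝ} (h₀ : 0 ≤ s₀ ∧ s₀ < 1) (h₁ : 0 ≤ s₁ ∧ s₁ < 1)
    (h₂ : 0 ≤ s₂ ∧ s₂ < 1) (k₂ : 0 ≤ t₂ ∧ t₂ < 1) (h : t₂ < s₂) :
    concRatio s₀ s₁ s₂ < concRatio s₀ s₁ t₂ := by
  rw [concRatio_swap s₀ s₁ s₂, concRatio_swap s₀ s₁ t₂]
  exact concRatio_lt_second h₀ h₂ k₂ h₁ h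

/-- `concRatio` is strictly increasing in the first and strictly decreasing in the other two
arguments, so it separates points that differ in these directions. -/
theorem eq_of_concRatio_eq {s₀ s₁ s₂ t₀ t₁ t₂ : ℝ} (h₀ : 0 ≤ s₀ ∧ s₀ < 1) (h₁ : 0 ≤ s₁ ∧ s₁ < 1)
    (h₂ : 0 ≤ s₂ ∧ s₂ < 1) (k₀ : 0 ≤ t₀ ∧ t₀ < 1) (k₁ : 0 ≤ t₁ ∧ t₁ < 1) (k₂ : 0 ≤ t₂ ∧ t₂ < 1)
    (h : concRatio s₀ s₁ s₂ = concRatio t₀ t₁ t₂) (e₀ : s₀ ≤ t₀) (e₁ : t₁ ≤ s₁) (e₂ : t₂ ≤ s₂) :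
    s₀ = t₀ ∧ s₁ = t₁ ∧ s₂ = t₂ := by
  have a : concRatio s₀ s₁ s₂ ≤ concRatio t₀ s₁ s₂ := by
    rcases e₀.eq_or_lt with e | e
    · rw [e]
    · exact (concRatio_lt_first h₀ k₀ h₁ h₂ e).le
  have b : concRatio t₀ s₁ s₂ ≤ concRatio t₀ t₁ s₂ := by
    rcases e₁.eq_or_lt with e | e
    · rw [e]
    · exact (concRatio_lt_second k₀ h₁ k₁ h₂ e).le
  have c : concRatio t₀ t₁ s₂ ≤ concRatio t₀ t₁ t₂ := by
    rcases e₂.eq_or_lt with e | e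
    · rw [e]
    · exact (concRatio_lt_third k₀ k₁ h₂ k₂ e).le
  refine ⟨?_, ?_, ?_⟩
  · by_contra hne
    linarith [concRatio_lt_first h₀ k₀ h₁ h₂ (lt_of_le_of_ne e₀ hne)]
  · by_contra hne
    linarith [concRatio_lt_second k₀ h₁ k₁ h₂ (lt_of_le_of_ne e₁ (Ne.symm hne))]
  · by_contra hne
    linarith [concRatio_lt_third k₀ k₁ h₂ k₂ (lt_of_le_of_ne e₂ (Ne.symm hne))]

theorem eq_of_le_of_prod_eq {a₀ a₁ a₂ b₀ b₁ b₂ : ℝ} (ha₀ : a₀ < 1 / 2) (ha₁ : a₁ < 1 / 2)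
    (ha₂ : a₂ < 1 / 2) (hb₀ : b₀ < 1 / 2) (hb₁ : b₁ < 1 / 2) (hb₂ : b₂ < 1 / 2)
    (h₀ : a₀ ≤ b₀) (h₁ : a₁ ≤ b₁) (h₂ : a₂ ≤ b₂)
    (h : (1 / 2 - a₀) * (1 / 2 - a₁) * (1 / 2 - a₂) = (1 / 2 - b₀) * (1 / 2 - b₁) * (1 / 2 - b₂)) :
    a₀ = b₀ ∧ a₁ = b₁ ∧ a₂ = b₂ := by
  obtain ⟨e0, e1, e2⟩ := eq_of_mul_eq_of_le (sub_le_sub_left h₀ (1 / 2))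
    (sub_le_sub_left h₁ (1 / 2)) (sub_le_sub_left h₂ (1 / 2)) (sub_nonneg.2 hb₀.le)
    (sub_nonneg.2 hb₁.le) (sub_nonneg.2 hb₂.le)
    (sub_pos.2 ha₀) (sub_pos.2 ha₁) (sub_pos.2 ha₂) (by linear_combination -h)
  exact ⟨by linarith, by linarith, by linarith⟩

/-- The ratios of the squared concurrences and the accessible volume determine `g`. Equal ratios
force two parameter triples to be comparable, and the accessible volume is strictly decreasing. -/
theorem eq_of_conc_eq {a b : Fin 3 → ℝ} (ha : ∀ i, 0 ≤ a i ∧ a i < 1 / 2)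
    (hb : ∀ i, 0 ≤ b i ∧ b i < 1 / 2)
    (r₀ : concRatio (4 * a 0 ^ 2) (4 * a 1 ^ 2) (4 * a 2 ^ 2) =
      concRatio (4 * b 0 ^ 2) (4 * b 1 ^ 2) (4 * b 2 ^ 2))
    (r₁ : concRatio (4 * a 1 ^ 2) (4 * a 2 ^ 2) (4 * a 0 ^ 2) =
      concRatio (4 * b 1 ^ 2) (4 * b 2 ^ 2) (4 * b 0 ^ 2))
    (r₂ : concRatio (4 * a 2 ^ 2) (4 * a 0 ^ 2) (4 * a 1 ^ 2) =
      concRatio (4 * b 2 ^ 2) (4 * b 0 ^ 2) (4 * b 1 ^ 2))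
    (h : (1 / 2 - a 0) * (1 / 2 - a 1) * (1 / 2 - a 2) =
      (1 / 2 - b 0) * (1 / 2 - b 1) * (1 / 2 - b 2)) : a = b := by
  have sq : ∀ {x : ℝ}, 0 ≤ x ∧ x < 1 / 2 → 0 ≤ 4 * x ^ 2 ∧ 4 * x ^ 2 < 1 := fun {x} hx =>
    ⟨by positivity, by nlinarith⟩
  have sa := fun i => sq (ha i)
  have sb := fun i => sq (hb i)
  have mono : ∀ {x y : ℝ}, 0 ≤ x → x ≤ y → 4 * x ^ 2 ≤ 4 * y ^ 2 := fun hx hxy => by gcongr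
  have inj : ∀ {x y : ℝ}, 0 ≤ x → 0 ≤ y → 4 * x ^ 2 = 4 * y ^ 2 → x = y := fun hx hy hxy =>
    (sq_eq_sq₀ hx hy).1 (by linarith)
  have fin : a 0 = b 0 ∧ a 1 = b 1 ∧ a 2 = b 2 → a = b := fun ⟨e0, e1, e2⟩ => by
    funext i
    fin_cases i
    exacts [e0, e1, e2]
  have fin' : 4 * a 0 ^ 2 = 4 * b 0 ^ 2 ∧ 4 * a 1 ^ 2 = 4 * b 1 ^ 2 ∧ 4 * a 2 ^ 2 = 4 * b 2 ^ 2 →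
      a = b := fun ⟨e0, e1, e2⟩ =>
    fin ⟨inj (ha 0).1 (hb 0).1 e0, inj (ha 1).1 (hb 1).1 e1, inj (ha 2).1 (hb 2).1 e2⟩
  rcases le_total (a 0) (b 0) with l0 | l0 <;> rcases le_total (a 1) (b 1) with l1 | l1 <;>
    rcases le_total (a 2) (b 2) with l2 | l2
  · exact fin (eq_of_le_of_prod_eq (ha 0).2 (ha 1).2 (ha 2).2 (hb 0).2 (hb 1).2 (hb 2).2 l0 l1 l2 h)
  · obtain ⟨e2, e0, e1⟩ := eq_of_concRatio_eq (sb 2) (sb 0) (sb 1) (sa 2) (sa 0) (sa 1) r₂.symm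
      (mono (hb 2).1 l2) (mono (ha 0).1 l0) (mono (ha 1).1 l1)
    exact fin' ⟨e0.symm, e1.symm, e2.symm⟩
  · obtain ⟨e1, e2, e0⟩ := eq_of_concRatio_eq (sb 1) (sb 2) (sb 0) (sa 1) (sa 2) (sa 0) r₁.symm
      (mono (hb 1).1 l1) (mono (ha 2).1 l2) (mono (ha 0).1 l0)
    exact fin' ⟨e0.symm, e1.symm, e2.symm⟩
  · exact fin' (eq_of_concRatio_eq (sa 0) (sa 1) (sa 2) (sb 0) (sb 1) (sb 2) r₀
      (mono (ha 0).1 l0) (mono (hb 1).1 l1) (mono (hb 2).1 l2))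
  · obtain ⟨e0, e1, e2⟩ := eq_of_concRatio_eq (sb 0) (sb 1) (sb 2) (sa 0) (sa 1) (sa 2) r₀.symm
      (mono (hb 0).1 l0) (mono (ha 1).1 l1) (mono (ha 2).1 l2)
    exact fin' ⟨e0.symm, e1.symm, e2.symm⟩
  · obtain ⟨e1, e2, e0⟩ := eq_of_concRatio_eq (sa 1) (sa 2) (sa 0) (sb 1) (sb 2) (sb 0) r₁
      (mono (ha 1).1 l1) (mono (hb 2).1 l2) (mono (hb 0).1 l0)
    exact fin' ⟨e0, e1, e2⟩
  · obtain ⟨e2, e0, e1⟩ := eq_of_concRatio_eq (sa 2) (sa 0) (sa 1) (sb 2) (sb 0) (sb 1) r₂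
      (mono (ha 2).1 l2) (mono (hb 0).1 l0) (mono (hb 1).1 l1)
    exact fin' ⟨e0, e1, e2⟩
  · obtain ⟨e0, e1, e2⟩ := eq_of_le_of_prod_eq (hb 0).2 (hb 1).2 (hb 2).2 (ha 0).2 (ha 1).2 (ha 2).2
      l0 l1 l2 h.symm
    exact fin ⟨e0.symm, e1.symm, e2.symm⟩

/-- The five measures of a generic state determine `g`, `f_z` and the factor `concFactor`. -/
theorem SameMeasures.params {g g' : Fin 3 → ℝ} {z z' : ℂ} (h : Generic g z) (h' : Generic g' z')
    (hs : SameMeasures (Ψ g z) (Ψ g' z')) :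
    g' = g ∧ fz z' = fz z ∧ concFactor g z' = concFactor g z := by
  obtain ⟨hC, hE, hA⟩ := hs
  have hV : accessibleVolume (Ψ g z) = accessibleVolume (Ψ g' z') :=
    (div_left_inj' (accessibleVolumeSup_pos h).ne').1 hA
  have hW : sourceVolume (Ψ g z) = sourceVolume (Ψ g' z') :=
    (div_left_inj' (sourceVolumeSup_pos h).ne').1 (sub_right_injective hE)
  rw [accessibleVolume_eq h, accessibleVolume_eq h'] at hV
  rw [sourceVolume_eq h, sourceVolume_eq h'] at hW
  have c0 := hC 0
  have c1 := hC 1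
  have c2 := hC 2
  obtain ⟨p0, p1, p2⟩ := sqConcurrence_Ψ h.1
  obtain ⟨q0, q1, q2⟩ := sqConcurrence_Ψ h'.1
  rw [p0, q0] at c0
  rw [p1, q1] at c1
  rw [p2, q2] at c2
  have hK := (concFactor_pos h.1).ne'
  have hK' := (concFactor_pos h'.1).ne'
  have r : ∀ {s₀ s₁ s₂ t₀ t₁ t₂ : ℝ},
      concFactor g z * concShape s₀ s₁ s₂ = concFactor g' z' * concShape t₀ t₁ t₂ →
      concFactor g z * concShape s₁ s₂ s₀ = concFactor g' z' * concShape t₁ t₂ t₀ →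
      concFactor g z * concShape s₂ s₀ s₁ = concFactor g' z' * concShape t₂ t₀ t₁ →
      concRatio s₀ s₁ s₂ = concRatio t₀ t₁ t₂ := by
    intro s₀ s₁ s₂ t₀ t₁ t₂ e0 e1 e2
    rw [concRatio, concRatio, ← mul_div_mul_left _ _ hK,
      ← mul_div_mul_left (_ + _) (concShape t₀ _ _) hK', mul_add, mul_add, e0, e1, e2]
  have hg : g = g' := eq_of_conc_eq h.1.1 h'.1.1 (r c0 c1 c2) (r c1 c2 c0) (r c2 c0 c1) hV
  subst hg
  refine ⟨rfl, ?_, ?_⟩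
  · have hG : 0 < g 0 * g 1 * g 2 := mul_pos (mul_pos (h.pos 0) (h.pos 1)) (h.pos 2)
    exact (cubeVolume_injOn (fz_nonneg z) (fz_le_one z) (fz_nonneg z') (fz_le_one z')
      (mul_left_cancel₀ hG.ne' hW)).symm
  · have sq : ∀ i, 0 ≤ 4 * g i ^ 2 ∧ 4 * g i ^ 2 < 1 := fun i =>
      ⟨by positivity, by nlinarith [h.1.1 i]⟩
    exact (mul_right_cancel₀ (concShape_pos (sq 0) (sq 1) (sq 2)).ne' c0).symm

/-! ### Local unitaries and complex conjugation -/

theorem LUEquiv.refl (ψ : Ket 2 2 2) : LUEquiv ψ ψ :=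
  ⟨1, one_mem _, 1, one_mem _, 1, one_mem _, by rw [applyABC, applyC_one, applyB_one, applyA_one]⟩

theorem LUEquiv.neg (ψ : Ket 2 2 2) : LUEquiv ψ (-ψ) := by
  refine ⟨-1, ?_, 1, one_mem _, 1, one_mem _, ?_⟩
  · rw [Matrix.mem_unitaryGroup_iff]
    simp
  · rw [applyABC, applyC_one, applyB_one]
    funext i j k
    simp [applyA, Matrix.one_apply]

theorem Ψ_neg (g : Fin 3 → ℝ) (z : ℂ) : Ψ g (-z) = -Ψ g z := by
  have h : ghzVector g (-z) = (-1 : ℂ) • ghzVector g z := by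
    rw [ghzVector_eq, ghzVector_eq]
    funext i j k
    simp only [prodKet, Pi.add_apply, Pi.smul_apply, smul_eq_mul, inv_neg]
    ring
  rw [Ψ, Ψ, h, normSq_smul]
  simp

theorem conjKet_Ψ (g : Fin 3 → ℝ) (z : ℂ) : conjKet (Ψ g z) = Ψ g (star z) := by
  have hg : ∀ t s i, star (gcol t s i) = gcol t s i := fun t s i => by
    fin_cases s <;> fin_cases i <;>
      simp only [gcol, gx, Complex.star_def, Matrix.of_apply, Matrix.cons_val', Fin.zero_eta,
        Fin.mk_one, Matrix.cons_val_zero, Matrix.cons_val_one, Matrix.cons_val_fin_one,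
        Complex.conj_ofReal]
  have h : ∀ i j k, star (ghzVector g z i j k) = ghzVector g (star z) i j k := by
    intro i j k
    rw [ghzVector_eq, ghzVector_eq]
    simp only [prodKet, Pi.add_apply, Pi.smul_apply, smul_eq_mul, star_add, star_mul', hg,
      star_inv₀]
    simp only [Complex.star_def, Complex.conj_ofReal]
  have hn : normSq (ghzVector g (star z)) = normSq (ghzVector g z) := by
    simp only [normSq, ← h, norm_star]
  funext i j k
  simp only [conjKet, Ψ, Pi.smul_apply, smul_eq_mul, star_mul', h, hn]
  simp only [Complex.star_def, Complex.conj_ofReal]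

theorem bx_star (z : ℂ) : bx (star z) = bx z := by
  rw [bx, bx, ← star_pow, norm_star, Complex.star_def, Complex.conj_re]

theorem IsParam.star {g : Fin 3 → ℝ} {z : ℂ} (h : IsParam g z) : IsParam g (star z) :=
  ⟨h.1, star_ne_zero.2 h.2.1, by rw [norm_star]; exact h.2.2⟩

/-- Up to local unitaries and conjugation, `Ψ(g, z)` depends on `g`, `Re(z²)` and `|z|` only. -/
theorem LUConjEquiv.of_bx_eq {g : Fin 3 → ℝ} {z z' : ℂ} (h : IsParam g z) (h' : IsParam g z')
    (hb : bx z' = bx z) (hK : concFactor g z' = concFactor g z) : LUConjEquiv (Ψ g z) (Ψ g z') := by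
  have p := one_add_pos h z
  have s := zS_pos h.2.1
  have s' := zS_pos h'.2.1
  have hS : zS z' = zS z := by
    rw [concFactor, concFactor, hb, div_eq_div_iff (by positivity) (by positivity)] at hK
    have : zS z' ^ 2 = zS z ^ 2 := by
      apply mul_right_cancel₀ (pow_pos p 2).ne'
      linear_combination -hK / 4
    exact (sq_eq_sq₀ s'.le s.le).1 this
  have r0 : 0 < ‖z‖ ^ 2 := pow_pos (norm_pos_iff.2 h.2.1) 2
  have r0' : 0 < ‖z'‖ ^ 2 := pow_pos (norm_pos_iff.2 h'.2.1) 2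
  have r1 : ‖z‖ ^ 2 ≤ 1 := pow_le_one₀ (norm_nonneg _) h.2.2
  have r1' : ‖z'‖ ^ 2 ≤ 1 := pow_le_one₀ (norm_nonneg _) h'.2.2
  have hn : ‖z'‖ ^ 2 = ‖z‖ ^ 2 := by
    rw [zS, zS, norm_inv, norm_inv, inv_pow, inv_pow] at hS
    generalize ‖z‖ ^ 2 = r at *
    generalize ‖z'‖ ^ 2 = r' at *
    have e : (r' - r) * (r * r' - 1) = 0 := by
      field_simp at hS
      linear_combination hS
    rcases mul_eq_zero.1 e with e | e
    · linarith
    · nlinarith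
  have hn4 : ‖z'‖ ^ 4 = ‖z‖ ^ 4 := by
    rw [show ‖z'‖ ^ 4 = (‖z'‖ ^ 2) ^ 2 by ring, hn]
    ring
  have hre : (z' ^ 2).re = (z ^ 2).re := by
    have q : 0 < 1 + ‖z‖ ^ 4 := by positivity
    rw [bx, bx, hn4, div_left_inj' q.ne'] at hb
    linarith
  have him : (z' ^ 2).im ^ 2 = (z ^ 2).im ^ 2 := by
    have a := Complex.normSq_apply (z ^ 2)
    have a' := Complex.normSq_apply (z' ^ 2)
    rw [Complex.normSq_eq_norm_sq, norm_pow] at a a'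
    rw [hn, a, hre] at a'
    linarith
  have main : ∀ u : ℂ, z' ^ 2 = u ^ 2 → LUEquiv (Ψ g u) (Ψ g z') := by
    intro u hu
    rcases sq_eq_sq_iff_eq_or_eq_neg.1 hu with rfl | rfl
    · exact .refl _
    · rw [Ψ_neg]
      exact .neg _
  rcases sq_eq_sq_iff_eq_or_eq_neg.1 him with e | e
  · exact Or.inl (main z (Complex.ext hre e))
  · right
    rw [conjKet_Ψ]
    refine main _ (Complex.ext ?_ ?_)
    · rw [← star_pow, Complex.star_def, Complex.conj_re, hre]
    · rw [← star_pow, Complex.star_def, Complex.conj_im, e]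

/-- Local unitaries and conjugation preserve `Re(z²) / (1 + |z|⁴)`, which LOCC conserves at
fixed `g`. -/
theorem not_LUConjEquiv {g : Fin 3 → ℝ} {z z' : ℂ} (h : IsParam g z) (h' : IsParam g z')
    (hg : ∀ i, 0 < g i) (hb : bx z ≠ bx z') : ¬ LUConjEquiv (Ψ g z) (Ψ g z') := by
  have hG : 0 < g 0 * g 1 * g 2 := mul_pos (mul_pos (hg 0) (hg 1)) (hg 2)
  rintro (e | e)
  · exact hb (mul_left_cancel₀ hG.ne' (reaches_necessary h h' e.reaches).2)
  · rw [conjKet_Ψ] at e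
    have := mul_left_cancel₀ hG.ne' (reaches_necessary h.star h' e.reaches).2
    rw [bx_star] at this
    exact hb this

/-! ### The entanglement of `Φ` -/

theorem sumConcurrence_Ψ {g : Fin 3 → ℝ} {z : ℂ} (h : IsParam g z) :
    sumConcurrence (Ψ g z) = concFactor g z *
      (concShape (4 * g 0 ^ 2) (4 * g 1 ^ 2) (4 * g 2 ^ 2) +
        concShape (4 * g 1 ^ 2) (4 * g 2 ^ 2) (4 * g 0 ^ 2) +
        concShape (4 * g 2 ^ 2) (4 * g 0 ^ 2) (4 * g 1 ^ 2)) := by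
  obtain ⟨p0, p1, p2⟩ := sqConcurrence_Ψ h
  rw [sumConcurrence, Fin.sum_univ_three, p0, p1, p2]
  ring

theorem sumConcurrence_one_lt_I {g : Fin 3 → ℝ} (h1 : IsParam g 1) (hI : IsParam g Complex.I)
    (hg : ∀ i, 0 < g i) : sumConcurrence (Ψ g 1) < sumConcurrence (Ψ g Complex.I) := by
  rw [sumConcurrence_Ψ h1, sumConcurrence_Ψ hI]
  have sq : ∀ i, 0 ≤ 4 * g i ^ 2 ∧ 4 * g i ^ 2 < 1 := fun i =>
    ⟨by positivity, by nlinarith [h1.1 i]⟩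
  refine mul_lt_mul_of_pos_right ?_ (add_pos (add_pos (concShape_pos (sq 0) (sq 1) (sq 2))
    (concShape_pos (sq 1) (sq 2) (sq 0))) (concShape_pos (sq 2) (sq 0) (sq 1)))
  have b1 : bx 1 = 1 := by norm_num [bx]
  have bI : bx Complex.I = -1 := by norm_num [bx]
  have s1 : zS 1 = 2 := by norm_num [zS]
  have sI : zS Complex.I = 2 := by norm_num [zS]
  have hG : 0 < g 0 * g 1 * g 2 := mul_pos (mul_pos (hg 0) (hg 1)) (hg 2)
  have p := one_add_pos hI Complex.I
  rw [bI] at p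
  rw [concFactor, concFactor, b1, bI, s1, sI]
  refine div_lt_div_of_pos_left (by norm_num) (mul_pos (by norm_num) (pow_pos p 2)) ?_
  nlinarith

theorem sumConcurrence_Φ_lt {g : Fin 3 → ℝ} {z₁ z₂ : ℂ} (h₁ : IsParam g z₁) (h₂ : IsParam g z₂)
    (hg : ∀ i, 0 < g i) (hz₁ : 0 < (z₁ ^ 2).re) (hz₂ : (z₂ ^ 2).re < 0) (hf : fz z₁ = fz z₂) :
    sumConcurrence (Φ g z₁) < sumConcurrence (Φ g z₂) := by
  have p₁ := isParam_Φ h₁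
  have p₂ := isParam_Φ h₂
  rw [if_pos hz₁] at p₁
  rw [if_neg hz₂.not_gt] at p₂
  rw [Φ, Φ, if_pos hz₁, if_neg hz₂.not_gt]
  rw [hf] at p₁ ⊢
  have hf0 : 0 < fz z₂ := by
    rw [fz_eq_abs_bx]
    exact abs_pos.2 (bx_neg_iff.2 hz₂).ne
  refine sumConcurrence_one_lt_I p₁ p₂ ?_
  simp [Fin.forall_fin_succ, hg, hf0]

/-! ### Compatible states -/

theorem SameMeasures.symm {ψ φ : Ket 2 2 2} (h : SameMeasures ψ φ) : SameMeasures φ ψ :=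
  ⟨fun i => (h.1 i).symm, h.2.1.symm, h.2.2.symm⟩

theorem SameMeasures.trans {ψ φ χ : Ket 2 2 2} (h : SameMeasures ψ φ) (h' : SameMeasures φ χ) :
    SameMeasures ψ χ :=
  ⟨fun i => (h.1 i).trans (h'.1 i), h.2.1.trans h'.2.1, h.2.2.trans h'.2.2⟩

theorem SameMeasures.refl (ψ : Ket 2 2 2) : SameMeasures ψ ψ := ⟨fun _ => rfl, rfl, rfl⟩

/-- Compatible generic states whose `Re(z²)` do not have opposite signs are equivalent. -/
theorem SameMeasures.luConjEquiv {g g' : Fin 3 → ℝ} {z z' : ℂ} (h : Generic g z)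
    (h' : Generic g' z') (hs : SameMeasures (Ψ g z) (Ψ g' z')) (hb : 0 ≤ bx z * bx z') :
    LUConjEquiv (Ψ g z) (Ψ g' z') := by
  obtain ⟨rfl, hf, hK⟩ := hs.params h h'
  rw [fz_eq_abs_bx, fz_eq_abs_bx] at hf
  refine .of_bx_eq h.1 h'.1 ?_ hK
  rcases abs_eq_abs.1 hf with e | e
  · exact e
  · rw [e] at hb
    have : bx z = 0 := by nlinarith
    rw [e, this, neg_zero]

/-- `Φ` depends only on the common parameters and on the sign of `Re(z²)`. -/
theorem Φ_congr {g : Fin 3 → ℝ} {z z' : ℂ} (hf : fz z' = fz z)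
    (hs : 0 < (z' ^ 2).re ↔ 0 < (z ^ 2).re) : Φ g z' = Φ g z := by
  rw [Φ, Φ, hf]
  simp only [hs]

/-- The second alternative, for a compatible pair of generic states with opposite signs of
`Re(z²)`. -/
theorem compatible_pair {g : Fin 3 → ℝ} {z z₁ z₂ : ℂ} (hz : z₁ = z ∨ z₂ = z)
    (h₁ : Generic g z₁) (h₂ : Generic g z₂) (b₁ : 0 < bx z₁) (b₂ : bx z₂ < 0)
    (hs : SameMeasures (Ψ g z₁) (Ψ g z₂)) :
      0 < (z₁ ^ 2).re ∧ (z₂ ^ 2).re < 0 ∧ fz z₁ = fz z₂ ∧ SameMeasures (Ψ g z₁) (Ψ g z₂) ∧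
      ¬ LUConjEquiv (Ψ g z₁) (Ψ g z₂) ∧
      (∀ (g' : Fin 3 → ℝ) (z' : ℂ), Generic g' z' → SameMeasures (Ψ g z) (Ψ g' z') →
        LUConjEquiv (Ψ g z₁) (Ψ g' z') ∨ LUConjEquiv (Ψ g z₂) (Ψ g' z')) ∧
      InMES (Φ g z₁) ∧ InMES (Φ g z₂) ∧ Reaches (Φ g z₁) (Ψ g z₁) ∧ Reaches (Φ g z₂) (Ψ g z₂) ∧
      sumConcurrence (Φ g z₁) < sumConcurrence (Φ g z₂) ∧
      (∀ (g' : Fin 3 → ℝ) (z' : ℂ), Generic g' z' → SameMeasures (Ψ g z) (Ψ g' z') →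
        bitValue (Φ g z₁) (Φ g z₂) (Φ g z) = bitValue (Φ g z₁) (Φ g z₂) (Φ g' z') →
        LUConjEquiv (Ψ g z) (Ψ g' z')) := by
  have r₁ := bx_pos_iff.1 b₁
  have r₂ := bx_neg_iff.1 b₂
  have hf : fz z₁ = fz z₂ := (hs.params h₁ h₂).2.1.symm
  have hlt := sumConcurrence_Φ_lt h₁.1 h₂.1 h₁.pos r₁ r₂ hf
  have hs₁ : SameMeasures (Ψ g z₁) (Ψ g z) := by
    rcases hz with rfl | rfl
    exacts [.refl _, hs]
  have hs₂ : SameMeasures (Ψ g z₂) (Ψ g z) := hs.symm.trans hs₁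
  have hgen : Generic g z := by
    rcases hz with rfl | rfl
    exacts [h₁, h₂]
  refine ⟨r₁, r₂, hf, hs, not_LUConjEquiv h₁.1 h₂.1 h₁.pos (b₂.trans b₁).ne', ?_,
    inMES_Φ h₁.1 h₁.2.1 r₁.ne', inMES_Φ h₂.1 h₂.2.1 r₂.ne, reaches_Φ h₁.1, reaches_Φ h₂.1, hlt, ?_⟩
  · intro g' z' h' hs'
    rcases le_total 0 (bx z') with hb | hb
    · exact Or.inl ((hs₁.trans hs').luConjEquiv h₁ h' (mul_nonneg b₁.le hb))
    · exact Or.inr ((hs₂.trans hs').luConjEquiv h₂ h' (mul_nonneg_of_nonpos_of_nonpos b₂.le hb))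
  · intro g' z' h' hs' hbit
    -- the bit is `0` at states with `Re(z²) > 0` and `1` at states with `Re(z²) < 0`
    have bit : ∀ {u : ℂ}, Generic g u → SameMeasures (Ψ g z) (Ψ g u) →
        (bitValue (Φ g z₁) (Φ g z₂) (Φ g u) = 0 ∧ 0 < bx u) ∨
        (bitValue (Φ g z₁) (Φ g z₂) (Φ g u) = 1 ∧ bx u < 0) := by
      intro u hu hsu
      have f₁ := ((hs₁.trans hsu).params h₁ hu).2.1
      have f₂ := ((hs₂.trans hsu).params h₂ hu).2.1
      have hne : bx u ≠ 0 := by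
        intro h0
        rw [fz_eq_abs_bx, fz_eq_abs_bx, h0, abs_zero] at f₁
        exact b₁.ne' (abs_eq_zero.1 f₁.symm)
      rcases hne.lt_or_gt with hb | hb
      · right
        have e : Φ g u = Φ g z₂ := Φ_congr f₂
          ⟨fun h => absurd h (bx_neg_iff.1 hb).not_gt, fun h => absurd h r₂.not_gt⟩
        refine ⟨?_, hb⟩
        rw [e, bitValue, max_eq_right hlt.le, if_pos rfl]
      · left
        have e : Φ g u = Φ g z₁ := Φ_congr f₁ ⟨fun _ => r₁, fun _ => bx_pos_iff.1 hb⟩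
        refine ⟨?_, hb⟩
        rw [e, bitValue, max_eq_right hlt.le, if_neg hlt.ne]
    obtain ⟨rfl, -⟩ := hs'.params hgen h'
    refine hs'.luConjEquiv hgen h' ?_
    rcases bit hgen (.refl _) with ⟨e, hb⟩ | ⟨e, hb⟩ <;>
      rcases bit h' hs' with ⟨e', hb'⟩ | ⟨e', hb'⟩
    · exact (mul_pos hb hb').le
    · rw [e, e'] at hbit
      exact absurd hbit (by decide)
    · rw [e, e'] at hbit
      exact absurd hbit (by decide)
    · exact (mul_pos_of_neg_of_neg hb hb').le

end ThreeQubit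

end

/-! ### Reconstruction of generic states -/

theorem lemma1 (g : Fin 3 → ℝ) (z : ℂ) (hgen : ThreeQubit.Generic g z) :
    (∀ (g' : Fin 3 → ℝ) (z' : ℂ), ThreeQubit.Generic g' z' →
      ThreeQubit.SameMeasures (ThreeQubit.Ψ g z) (ThreeQubit.Ψ g' z') →
      ThreeQubit.LUConjEquiv (ThreeQubit.Ψ g z) (ThreeQubit.Ψ g' z')) ∨
    (∃ z₁ z₂ : ℂ,
      (z₁ = z ∨ z₂ = z) ∧
      ThreeQubit.Generic g z₁ ∧ ThreeQubit.Generic g z₂ ∧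
      0 < (z₁ ^ 2).re ∧ (z₂ ^ 2).re < 0 ∧
      ThreeQubit.fz z₁ = ThreeQubit.fz z₂ ∧
      ThreeQubit.SameMeasures (ThreeQubit.Ψ g z₁) (ThreeQubit.Ψ g z₂) ∧
      ¬ ThreeQubit.LUConjEquiv (ThreeQubit.Ψ g z₁) (ThreeQubit.Ψ g z₂) ∧
      (∀ (g' : Fin 3 → ℝ) (z' : ℂ), ThreeQubit.Generic g' z' →
        ThreeQubit.SameMeasures (ThreeQubit.Ψ g z) (ThreeQubit.Ψ g' z') →
        ThreeQubit.LUConjEquiv (ThreeQubit.Ψ g z₁) (ThreeQubit.Ψ g' z') ∨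
        ThreeQubit.LUConjEquiv (ThreeQubit.Ψ g z₂) (ThreeQubit.Ψ g' z')) ∧
      ThreeQubit.InMES (ThreeQubit.Φ g z₁) ∧ ThreeQubit.InMES (ThreeQubit.Φ g z₂) ∧
      ThreeQubit.Reaches (ThreeQubit.Φ g z₁) (ThreeQubit.Ψ g z₁) ∧
      ThreeQubit.Reaches (ThreeQubit.Φ g z₂) (ThreeQubit.Ψ g z₂) ∧
      ThreeQubit.sumConcurrence (ThreeQubit.Φ g z₁) <
        ThreeQubit.sumConcurrence (ThreeQubit.Φ g z₂) ∧
      (∀ (g' : Fin 3 → ℝ) (z' : ℂ), ThreeQubit.Generic g' z' →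
        ThreeQubit.SameMeasures (ThreeQubit.Ψ g z) (ThreeQubit.Ψ g' z') →
        ThreeQubit.bitValue (ThreeQubit.Φ g z₁) (ThreeQubit.Φ g z₂) (ThreeQubit.Φ g z) =
          ThreeQubit.bitValue (ThreeQubit.Φ g z₁) (ThreeQubit.Φ g z₂) (ThreeQubit.Φ g' z') →
        ThreeQubit.LUConjEquiv (ThreeQubit.Ψ g z) (ThreeQubit.Ψ g' z'))) := by
  by_cases hex : ∃ (g' : Fin 3 → ℝ) (z' : ℂ), ThreeQubit.Generic g' z' ∧
      ThreeQubit.SameMeasures (ThreeQubit.Ψ g z) (ThreeQubit.Ψ g' z') ∧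
      ThreeQubit.bx z * ThreeQubit.bx z' < 0
  · right
    obtain ⟨g', z', h', hs, hb⟩ := hex
    obtain ⟨rfl, -⟩ := hs.params hgen h'
    rcases mul_neg_iff.1 hb with ⟨b₁, b₂⟩ | ⟨b₂, b₁⟩
    · exact ⟨z, z', Or.inl rfl, hgen, h',
        ThreeQubit.compatible_pair (Or.inl rfl) hgen h' b₁ b₂ hs⟩
    · exact ⟨z', z, Or.inr rfl, h', hgen,
        ThreeQubit.compatible_pair (Or.inr rfl) h' hgen b₁ b₂ hs.symm⟩
  · left
    intro g' z' h' hs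
    refine hs.luConjEquiv hgen h' (not_lt.1 fun hb => hex ⟨g', z', h', hs, hb⟩)
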